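/- **Conventions.** Let $n\ge 1$, $\chi=8(n+2)$. For scalars, or for row vectors in $\mathbb C^{n-1}$, write $C_xy=x\bar y^{t}-y\bar x^{t}$, $A_xy=x\bar y^{t}+y\bar x^{t}$, $S_xy=xy^{t}+yx^{t}$; for row vectors write $\mathbf C_xy=\bar x^{t}y-\bar y^{t}x$, $\mathbf S_xy=x^{t}\bar y+\bar y^{t}x$ (matrices), $R_yx=xy$ for a scalar $x$ and a vector $y$, $L_yX=yX$ for a scalar or vector $y$ and a vector or matrix $X$, and $\mathbf cX=\bar X$. Let $\mathfrak{sp}(n+1)=\mathfrak h\oplus\mathfrak m$, $\mathfrak h=\mathfrak{sp}(1)\oplus\mathfrak{sp}(n)$, consist of the matrices $\begin{pmatrix}P&Q\\-\bar Q&\bar P\end{pmatrix}$, $P^t=-\bar P$, $Q^t=Q$, of size $2(n+1)$, and write $P,Q$ in blocks of sizes $1,1,n-1$. Put $e_x=\chi^{-1/2}\,(1)\in\mathfrak m_\parallel$, where $(a)$, $a\in\mathbb R$, has $P=\begin{pmatrix}0&a&0\\-a&0&0\\0&0&0\end{pmatrix}$, $Q=0$. The complement $\mathfrak m_\perp$ consists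 of $((a,b),(\mathbf a,\mathbf b))$ with $P=\begin{pmatrix}0&a&\mathbf a\\a&0&0\\-\bar{\mathbf a}^t&0&0\end{pmatrix}$, $Q=\begin{pmatrix}0&b&\mathbf b\\b&0&0\\\mathbf b^t&0&0\end{pmatrix}$; $\mathfrak h_\perp$ consists of $((c,d),(\mathbf c,\mathbf d))$ with $P=\begin{pmatrix}c&0&0\\0&-c&\mathbf c\\0&-\bar{\mathbf c}^t&0\end{pmatrix}$, $Q=\begin{pmatrix}d&0&0\\0&-d&\mathbf d\\0&\mathbf d^t&0\end{pmatrix}$; here $a,c\in i\mathbb R$, $b,d\in\mathbb C$, and the vectors lie in $\mathbb C^{n-1}$. The centraliser $\mathfrak h_\parallel\simeq\mathfrak{sp}(1)\oplus\mathfrak{sp}(n-1)$ of $e_x$ in $\mathfrak h$ consists of $((c,d),(\mathbf C,\mathbf D))$ with $P=\mathrm{diag}(c,c,\mathbf C)$, $Q=\mathrm{diag}(d,d,\mathbf D)$, $c\in i\mathbb R$, $d\in\mathbb C$, $\mathbf C\in\mathfrak u(n-1)$, $\mathbf D$ symmetric; the same formula describes the group $Sp(1)\times Sp(n-1)$, which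 acts on $\mathfrak h_\perp\simeq i\mathbb R\oplus\mathbb C\oplus\mathbb C^{n-1}\oplus\mathbb C^{n-1}$ by conjugation. **Theorem.** Let $\gamma(t,x)$ be a non-stretching curve flow in $Sp(n+1)/Sp(1)\times Sp(n)$ with a parallel frame: along the flow the coframe $e$ and connection $\omega$ satisfy $e_x=\chi^{-1/2}(1)$, $e_t=h_\parallel+h_\perp\in\mathfrak m_\parallel\oplus\mathfrak m_\perp$, $\omega_x=u=((u_1,u_2),(\mathbf u_1,\mathbf u_2))\in\mathfrak h_\perp$, $\omega_t=\varpi^\parallel+\varpi^\perp\in\mathfrak h_\parallel\oplus\mathfrak h_\perp$. Put $h=h^\perp=[e_x,h_\perp]\in\mathfrak h_\perp$ and $\varpi=\varpi^\perp$. The Cartan structure equations $$D_xe_t-D_te_x+[\omega_x,e_t]-[\omega_t,e_x]=0,\qquad D_x\omega_t-D_t\omega_x+[\omega_x,\omega_t]=-[e_x,e_t]$$ hold if and only if $$u_t=\mathcal H(\varpi)+h,\qquad \varpi=\tfrac{\chi}{4}\,\mathcal J(h),$$ where the formal antiderivatives $D_x^{-1}$ are normalised by $\varpi^\parallel=D_x^{-1}\big(-[u,\varpi]_{\parallel}\big)$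 and $h_\parallel=\tfrac{\sqrt\chi}{2}D_x^{-1}\big(A_{u_1}h^1+A_{u_2}h^2+A_{\mathbf u_1}\mathbf h^1+A_{\mathbf u_2}\mathbf h^2\big)$, with existence of these antiderivatives part of the right-hand side. Here $\mathcal H=(\mathcal H_{ij})$ and $\mathcal J=(\mathcal J_{ij})$ are given by $$\begin{aligned} \mathcal H_{11}&=D_x-C_{u_2}D_x^{-1}S_{u_2},\quad \mathcal H_{12}=C_{u_2}D_x^{-1}S_{u_1},\\ \mathcal H_{13}&=\tfrac12C_{\mathbf u_1}-\tfrac12C_{u_2}D_x^{-1}S_{\mathbf u_2},\quad \mathcal H_{14}=\tfrac12C_{\mathbf u_2}+\tfrac12C_{u_2}D_x^{-1}S_{\mathbf u_1},\\ \mathcal H_{21}&=S_{u_1}D_x^{-1}S_{u_2},\quad \mathcal H_{22}=D_x-S_{u_2}D_x^{-1}C_{u_2}-S_{u_1}D_x^{-1}S_{u_1},\\ \mathcal H_{23}&=\tfrac12S_{\mathbf u_2}-\tfrac12S_{u_2}D_x^{-1}C_{\mathbf u_1}+\tfrac12S_{u_1}D_x^{-1}S_{\mathbf u_2},\\ \mathcal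 H_{24}&=-\tfrac12S_{\mathbf u_1}-\tfrac12S_{u_2}D_x^{-1}C_{\mathbf u_2}-\tfrac12S_{u_1}D_x^{-1}S_{\mathbf u_1},\\ \mathcal H_{31}&=R_{\mathbf u_1}+R_{\bar{\mathbf u}_2}D_x^{-1}S_{u_2},\quad \mathcal H_{32}=-R_{\bar{\mathbf u}_2}-R_{\mathbf u_1}D_x^{-1}C_{u_2}-R_{\bar{\mathbf u}_2}D_x^{-1}S_{u_1},\\ \mathcal H_{33}&=D_x-L_{u_1}-\tfrac12R_{\mathbf u_1}D_x^{-1}C_{\mathbf u_1}+L_{\mathbf u_1}D_x^{-1}\mathbf C_{\mathbf u_1}+\tfrac12R_{\bar{\mathbf u}_2}D_x^{-1}S_{\mathbf u_2}+L_{\mathbf u_2}D_x^{-1}\mathbf c\,\mathbf S_{\mathbf u_2},\\ \mathcal H_{34}&=L_{u_2}\mathbf c-\tfrac12R_{\mathbf u_1}D_x^{-1}C_{\mathbf u_2}+L_{\mathbf u_1}D_x^{-1}\mathbf c\,\mathbf C_{\mathbf u_2}-\tfrac12R_{\bar{\mathbf u}_2}D_x^{-1}S_{\mathbf u_1}-L_{\mathbf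 u_2}D_x^{-1}\mathbf S_{\mathbf u_1},\\ \mathcal H_{41}&=R_{\mathbf u_2}-R_{\bar{\mathbf u}_1}D_x^{-1}S_{u_2},\quad \mathcal H_{42}=R_{\bar{\mathbf u}_1}-R_{\mathbf u_2}D_x^{-1}C_{u_2}+R_{\bar{\mathbf u}_1}D_x^{-1}S_{u_1},\\ \mathcal H_{43}&=-L_{u_2}\mathbf c-\tfrac12R_{\mathbf u_2}D_x^{-1}C_{\mathbf u_1}+L_{\mathbf u_2}D_x^{-1}\mathbf c\,\mathbf C_{\mathbf u_1}-\tfrac12R_{\bar{\mathbf u}_1}D_x^{-1}S_{\mathbf u_2}-L_{\mathbf u_1}D_x^{-1}\mathbf S_{\mathbf u_2},\\ \mathcal H_{44}&=D_x-L_{u_1}-\tfrac12R_{\mathbf u_2}D_x^{-1}C_{\mathbf u_2}+L_{\mathbf u_2}D_x^{-1}\mathbf C_{\mathbf u_2}+\tfrac12R_{\bar{\mathbf u}_1}D_x^{-1}S_{\mathbf u_1}+L_{\mathbf u_1}D_x^{-1}\mathbf c\,\mathbf S_{\mathbf u_1}, \end{aligned}$$ $$\begin{aligned} \mathcal J_{11}&=D_x+S_{u_1}D_x^{-1}A_{u_1},\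 \ \mathcal J_{12}=S_{u_1}D_x^{-1}A_{u_2},\ \ \mathcal J_{13}=C_{\mathbf u_1}+S_{u_1}D_x^{-1}A_{\mathbf u_1},\ \ \mathcal J_{14}=C_{\mathbf u_2}+S_{u_1}D_x^{-1}A_{\mathbf u_2},\\ \mathcal J_{21}&=S_{u_2}D_x^{-1}A_{u_1},\ \ \mathcal J_{22}=D_x+S_{u_2}D_x^{-1}A_{u_2},\ \ \mathcal J_{23}=S_{\mathbf u_2}+S_{u_2}D_x^{-1}A_{\mathbf u_1},\ \ \mathcal J_{24}=-S_{\mathbf u_1}+S_{u_2}D_x^{-1}A_{\mathbf u_2},\\ \mathcal J_{31}&=2R_{\mathbf u_1}+2R_{\mathbf u_1}D_x^{-1}A_{u_1},\ \ \mathcal J_{32}=-2R_{\bar{\mathbf u}_2}+2R_{\mathbf u_1}D_x^{-1}A_{u_2},\\ \mathcal J_{33}&=4D_x+4L_{u_1}+2R_{\mathbf u_1}D_x^{-1}A_{\mathbf u_1},\ \ \mathcal J_{34}=-4L_{u_2}\mathbf c+2R_{\mathbf u_1}D_x^{-1}A_{\mathbf u_2},\\ \mathcal J_{41}&=2R_{\mathbf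 u_2}+2R_{\mathbf u_2}D_x^{-1}A_{u_1},\ \ \mathcal J_{42}=2R_{\bar{\mathbf u}_1}+2R_{\mathbf u_2}D_x^{-1}A_{u_2},\\ \mathcal J_{43}&=4L_{u_2}\mathbf c+2R_{\mathbf u_2}D_x^{-1}A_{\mathbf u_1},\ \ \mathcal J_{44}=4D_x+4L_{u_1}+2R_{\mathbf u_2}D_x^{-1}A_{\mathbf u_2}. \end{aligned}$$ Moreover, with the real pairing $\langle X,Y\rangle=A_{X_1}Y_1+A_{X_2}Y_2+A_{\mathbf X_1}\mathbf Y_1+A_{\mathbf X_2}\mathbf Y_2$ on $i\mathbb R\oplus\mathbb C\oplus\mathbb C^{n-1}\oplus\mathbb C^{n-1}$, and with all integral identities understood formally, i.e. modulo total $x$-derivatives in an arbitrary differential $*$-algebra containing $u$, the explicit coefficients, and the nonlocal variables that occur: 1. $\mathcal H$ is a cosymplectic Hamiltonian operator: the bracket $\{F,G\}_{\mathcal H}=\int\langle\delta F/\delta u,\mathcal H(\delta G/\delta u)\rangle\,dx$ on real functionals with differential polynomial densities (with explicit coefficients) is skew-symmetric and satisfies the Jacobi identity. 2. $\mathcal J$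 is a symplectic operator: the $2$-form $\omega(X_1,X_2)=\int\langle X_1u,\mathcal J(X_2u)\rangle\,dx$ on evolutionary vector fields is skew-symmetric and closed. 3. $\mathcal H$ and $\mathcal J$ are compatible: for all real $c_1,c_2$ the operator $c_1\mathcal H+c_2\mathcal J^{-1}$, with $\mathcal J^{-1}$ the formal inverse, is a cosymplectic Hamiltonian operator. 4. $\mathcal H$ and $\mathcal J$ are invariant under $Sp(1)\times Sp(n-1)$: $\mathcal O_{gu}(gP)=g\,\mathcal O_u(P)$ for $\mathcal O=\mathcal H,\mathcal J$ and all $g\in Sp(1)\times Sp(n-1)$. -/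

import Mathlib

open scoped Matrix

noncomputable section

namespace SpFlow

/-- A differential `*`-algebra with a formal antiderivative: a commutative complex `*`-algebra `B`
(its elements play the role of complex functions on the `x`-jet space, possibly extended by nonlocal
variables, or of complex functions of `x` or of `(t,x)`), with the total derivative `D` and a formal
antiderivative `Dinv`, both complex-linear and real, that is, commuting with complex conjugation.
`Dinv f` is meaningful as an antiderivative of `f` exactly when `D (Dinv f) = f`; it is *not* required
that every element has an antiderivative, so that the quotient of `B` by total derivatives need not
be trivial. -/
structure Calc (B : Type) [CommRing B] [Algebra ℂ B] [StarRing B] [StarModule ℂ B] where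
  D : Derivation ℂ B B
  D_star : ∀ f, D (star f) = star (D f)
  Dinv : B →ₗ[ℂ] B
  Dinv_star : ∀ f, Dinv (star f) = star (Dinv f)

/-- The vector space `ℂ ⊕ ℂ ⊕ ℂ^m ⊕ ℂ^m`, with `ℂ` replaced by `B`. The space
`iℝ ⊕ ℂ ⊕ ℂ^m ⊕ ℂ^m` of the theory is cut out by `Fld.IsImag`. -/
@[ext] structure Fld (m : ℕ) (B : Type) where
  s1 : B
  s2 : B
  v1 : Fin m → B
  v2 : Fin m → B

/-- Components `((c, d), (C, D))` of an element of `𝔰𝔭(1) ⊕ 𝔰𝔭(m)`, or of `Sp(1) × Sp(m)`. -/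
@[ext] structure ParFld (m : ℕ) (B : Type) where
  c : B
  d : B
  C : Matrix (Fin m) (Fin m) B
  D : Matrix (Fin m) (Fin m) B

/-- Index set of `(m+2) × (m+2)` matrices, split as `1 + 1 + m`. -/
abbrev Idx (m : ℕ) : Type := Fin 2 ⊕ Fin m

/-- `2(m+2) × 2(m+2)` matrices; for `m = n - 1` these are `2(n+1) × 2(n+1)` matrices. -/
abbrev Mat (m : ℕ) (B : Type) : Type := Matrix (Idx m ⊕ Idx m) (Idx m ⊕ Idx m) B

section Operators

variable {B : Type} [CommRing B] [Algebra ℂ B] [StarRing B] {m : ℕ}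

/-! Inner products of scalars, inner products of (row) vectors, outer products of vectors. -/

def sC (x y : B) : B := x * star y - y * star x
def sA (x y : B) : B := x * star y + y * star x
def sS (x y : B) : B := x * y + y * x

def vC (x y : Fin m → B) : B := x ⬝ᵥ star y - y ⬝ᵥ star x
def vA (x y : Fin m → B) : B := x ⬝ᵥ star y + y ⬝ᵥ star x
def vS (x y : Fin m → B) : B := x ⬝ᵥ y + y ⬝ᵥ x

/-- `x̄ᵗ y - ȳᵗ x` for row vectors `x`, `y`. -/
def oC (x y : Fin m → B) : Matrix (Fin m) (Fin m) B :=
  Matrix.vecMulVec (star x) y - Matrix.vecMulVec (star y) x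

/-- `xᵗ ȳ + ȳᵗ x` for row vectors `x`, `y`. -/
def oS (x y : Fin m → B) : Matrix (Fin m) (Fin m) B :=
  Matrix.vecMulVec x (star y) + Matrix.vecMulVec (star y) x

/-- Right multiplication `R_y x = x y` of a vector `y` by a scalar `x`. -/
def R (y : Fin m → B) (x : B) : Fin m → B := x • y

/-- Left multiplication `L_y X = y X` of a vector by a scalar. -/
def Ls (y : B) (x : Fin m → B) : Fin m → B := y • x

/-- Left multiplication `L_y X = y X` of a matrix by a row vector. -/
def L (y : Fin m → B) (X : Matrix (Fin m) (Fin m) B) : Fin m → B := y ᵥ* X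

/-- Entrywise complex conjugation of a matrix. -/
def cc (X : Matrix (Fin m) (Fin m) B) : Matrix (Fin m) (Fin m) B := X.map star

namespace Fld

def IsImag (u : Fld m B) : Prop := star u.s1 = -u.s1

def map (f : B → B) (u : Fld m B) : Fld m B :=
  ⟨f u.s1, f u.s2, fun k => f (u.v1 k), fun k => f (u.v2 k)⟩

def add (u w : Fld m B) : Fld m B :=
  ⟨u.s1 + w.s1, u.s2 + w.s2, u.v1 + w.v1, u.v2 + w.v2⟩

def sub (u w : Fld m B) : Fld m B :=
  ⟨u.s1 - w.s1, u.s2 - w.s2, u.v1 - w.v1, u.v2 - w.v2⟩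

def smul (r : ℝ) (u : Fld m B) : Fld m B :=
  ⟨(r : ℂ) • u.s1, (r : ℂ) • u.s2, (r : ℂ) • u.v1, (r : ℂ) • u.v2⟩

end Fld

/-- The real pairing `∑ A(xᵢ, yᵢ)` over all components. -/
def pair (x y : Fld m B) : B := sA x.s1 y.s1 + sA x.s2 y.s2 + vA x.v1 y.v1 + vA x.v2 y.v2

namespace ParFld

def map {B' : Type} (f : B → B') (p : ParFld m B) : ParFld m B' :=
  ⟨f p.c, f p.d, p.C.map f, p.D.map f⟩

/-- `((c, d), (C, D))` lies in `𝔰𝔭(1) ⊕ 𝔰𝔭(m)`. -/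
def IsAlg (p : ParFld m B) : Prop := star p.c = -p.c ∧ p.Cᴴ = -p.C ∧ p.Dᵀ = p.D

end ParFld

variable [StarModule ℂ B] (K : Calc B) (u : Fld m B)

/-- Entrywise antiderivative of a matrix. -/
def Calc.DinvM (X : Matrix (Fin m) (Fin m) B) : Matrix (Fin m) (Fin m) B := X.map K.Dinv

/-- Componentwise derivative of a vector. -/
def Calc.DV (x : Fin m → B) : Fin m → B := fun k => K.D (x k)

local notation "½" => ((1 / 2 : ℂ))

/-! The entries of the first operator, `ℋ`. -/

def H11 (w : B) : B := K.D w - sC u.s2 (K.Dinv (sS u.s2 w))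
def H12 (w : B) : B := sC u.s2 (K.Dinv (sS u.s1 w))
def H13 (w : Fin m → B) : B := ½ • vC u.v1 w - ½ • sC u.s2 (K.Dinv (vS u.v2 w))
def H14 (w : Fin m → B) : B := ½ • vC u.v2 w + ½ • sC u.s2 (K.Dinv (vS u.v1 w))

def H21 (w : B) : B := sS u.s1 (K.Dinv (sS u.s2 w))
def H22 (w : B) : B :=
  K.D w - sS u.s2 (K.Dinv (sC u.s2 w)) - sS u.s1 (K.Dinv (sS u.s1 w))
def H23 (w : Fin m → B) : B :=
  ½ • vS u.v2 w - ½ • sS u.s2 (K.Dinv (vC u.v1 w)) + ½ • sS u.s1 (K.Dinv (vS u.v2 w))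
def H24 (w : Fin m → B) : B :=
  -(½ • vS u.v1 w) - ½ • sS u.s2 (K.Dinv (vC u.v2 w)) - ½ • sS u.s1 (K.Dinv (vS u.v1 w))

def H31 (w : B) : Fin m → B := R u.v1 w + R (star u.v2) (K.Dinv (sS u.s2 w))
def H32 (w : B) : Fin m → B :=
  -R (star u.v2) w - R u.v1 (K.Dinv (sC u.s2 w)) - R (star u.v2) (K.Dinv (sS u.s1 w))
def H33 (w : Fin m → B) : Fin m → B :=
  K.DV w - Ls u.s1 w - ½ • R u.v1 (K.Dinv (vC u.v1 w)) + L u.v1 (K.DinvM (oC u.v1 w))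
    + ½ • R (star u.v2) (K.Dinv (vS u.v2 w)) + L u.v2 (K.DinvM (cc (oS u.v2 w)))
def H34 (w : Fin m → B) : Fin m → B :=
  Ls u.s2 (star w) - ½ • R u.v1 (K.Dinv (vC u.v2 w)) + L u.v1 (K.DinvM (cc (oC u.v2 w)))
    - ½ • R (star u.v2) (K.Dinv (vS u.v1 w)) - L u.v2 (K.DinvM (oS u.v1 w))

def H41 (w : B) : Fin m → B := R u.v2 w - R (star u.v1) (K.Dinv (sS u.s2 w))
def H42 (w : B) : Fin m → B :=
  R (star u.v1) w - R u.v2 (K.Dinv (sC u.s2 w)) + R (star u.v1) (K.Dinv (sS u.s1 w))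
def H43 (w : Fin m → B) : Fin m → B :=
  -Ls u.s2 (star w) - ½ • R u.v2 (K.Dinv (vC u.v1 w)) + L u.v2 (K.DinvM (cc (oC u.v1 w)))
    - ½ • R (star u.v1) (K.Dinv (vS u.v2 w)) - L u.v1 (K.DinvM (oS u.v2 w))
def H44 (w : Fin m → B) : Fin m → B :=
  K.DV w - Ls u.s1 w - ½ • R u.v2 (K.Dinv (vC u.v2 w)) + L u.v2 (K.DinvM (oC u.v2 w))
    + ½ • R (star u.v1) (K.Dinv (vS u.v1 w)) + L u.v1 (K.DinvM (cc (oS u.v1 w)))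

/-- The operator `ℋ = (ℋᵢⱼ)` at `u`, applied to the column `w`. -/
def opH (w : Fld m B) : Fld m B :=
  ⟨H11 K u w.s1 + H12 K u w.s2 + H13 K u w.v1 + H14 K u w.v2,
   H21 K u w.s1 + H22 K u w.s2 + H23 K u w.v1 + H24 K u w.v2,
   H31 K u w.s1 + H32 K u w.s2 + H33 K u w.v1 + H34 K u w.v2,
   H41 K u w.s1 + H42 K u w.s2 + H43 K u w.v1 + H44 K u w.v2⟩

/-! The entries of the second operator, `𝒥`. -/

def J11 (h : B) : B := K.D h + sS u.s1 (K.Dinv (sA u.s1 h))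
def J12 (h : B) : B := sS u.s1 (K.Dinv (sA u.s2 h))
def J13 (h : Fin m → B) : B := vC u.v1 h + sS u.s1 (K.Dinv (vA u.v1 h))
def J14 (h : Fin m → B) : B := vC u.v2 h + sS u.s1 (K.Dinv (vA u.v2 h))

def J21 (h : B) : B := sS u.s2 (K.Dinv (sA u.s1 h))
def J22 (h : B) : B := K.D h + sS u.s2 (K.Dinv (sA u.s2 h))
def J23 (h : Fin m → B) : B := vS u.v2 h + sS u.s2 (K.Dinv (vA u.v1 h))
def J24 (h : Fin m → B) : B := -vS u.v1 h + sS u.s2 (K.Dinv (vA u.v2 h))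

def J31 (h : B) : Fin m → B :=
  (2 : ℂ) • R u.v1 h + (2 : ℂ) • R u.v1 (K.Dinv (sA u.s1 h))
def J32 (h : B) : Fin m → B :=
  -((2 : ℂ) • R (star u.v2) h) + (2 : ℂ) • R u.v1 (K.Dinv (sA u.s2 h))
def J33 (h : Fin m → B) : Fin m → B :=
  (4 : ℂ) • K.DV h + (4 : ℂ) • Ls u.s1 h + (2 : ℂ) • R u.v1 (K.Dinv (vA u.v1 h))
def J34 (h : Fin m → B) : Fin m → B :=
  -((4 : ℂ) • Ls u.s2 (star h)) + (2 : ℂ) • R u.v1 (K.Dinv (vA u.v2 h))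

def J41 (h : B) : Fin m → B :=
  (2 : ℂ) • R u.v2 h + (2 : ℂ) • R u.v2 (K.Dinv (sA u.s1 h))
def J42 (h : B) : Fin m → B :=
  (2 : ℂ) • R (star u.v1) h + (2 : ℂ) • R u.v2 (K.Dinv (sA u.s2 h))
def J43 (h : Fin m → B) : Fin m → B :=
  (4 : ℂ) • Ls u.s2 (star h) + (2 : ℂ) • R u.v2 (K.Dinv (vA u.v1 h))
def J44 (h : Fin m → B) : Fin m → B :=
  (4 : ℂ) • K.DV h + (4 : ℂ) • Ls u.s1 h + (2 : ℂ) • R u.v2 (K.Dinv (vA u.v2 h))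

/-- The operator `𝒥 = (𝒥ᵢⱼ)` at `u`, applied to the column `h`. -/
def opJ (h : Fld m B) : Fld m B :=
  ⟨J11 K u h.s1 + J12 K u h.s2 + J13 K u h.v1 + J14 K u h.v2,
   J21 K u h.s1 + J22 K u h.s2 + J23 K u h.v1 + J24 K u h.v2,
   J31 K u h.s1 + J32 K u h.s2 + J33 K u h.v1 + J34 K u h.v2,
   J41 K u h.s1 + J42 K u h.s2 + J43 K u h.v1 + J44 K u h.v2⟩

/-- The four nonlocal combinations of `u` and `w` to which `Dinv` is applied in `ℋ w`, after the
terms of each row of `ℋ` have been collected. -/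
def srcH (w : Fld m B) : ParFld m B where
  c := sC u.s2 w.s2 + ½ • vC u.v1 w.v1 + ½ • vC u.v2 w.v2
  d := sS u.s2 w.s1 - sS u.s1 w.s2 + ½ • vS u.v2 w.v1 - ½ • vS u.v1 w.v2
  C := oC u.v1 w.v1 + cc (oC u.v2 w.v2)
  D := cc (oS u.v1 w.v2) - oS u.v2 w.v1

end Operators

/-- A (possibly nonlocal, possibly only partially defined or multivalued) linear operator depending on
`u`: the relation `X = 𝒪_u(P)`, over every differential `*`-algebra. -/
def NonlocalOp (m : ℕ) : Type 1 :=
  ∀ (B : Type) [CommRing B] [Algebra ℂ B] [StarRing B] [StarModule ℂ B],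
    Calc B → Fld m B → Fld m B → Fld m B → Prop

/-- The operator `ℋ`, defined where the antiderivatives occurring in it exist. -/
def relH (m : ℕ) : NonlocalOp m := fun _ _ _ _ _ K u P X =>
  P.IsImag ∧ ((srcH u P).map K.Dinv).map K.D = srcH u P ∧ X = opH K u P

/-- The operator `𝒥`, defined where the antiderivative `Dinv (∑ A(uᵢ, hᵢ))` occurring in it exists. -/
def relJ (m : ℕ) : NonlocalOp m := fun _ _ _ _ _ K u h X =>
  h.IsImag ∧ K.D (K.Dinv (pair u h)) = pair u h ∧ X = opJ K u h

/-- The operator `c₁ 𝒪₁ + c₂ 𝒪₂⁻¹` with the formal inverse of `𝒪₂`: the value at `P` is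
`c₁ Y + c₂ W` where `Y = 𝒪₁ P` and `𝒪₂ W = P`. -/
def addInv {m : ℕ} (c₁ c₂ : ℝ) (O₁ O₂ : NonlocalOp m) : NonlocalOp m := fun B _ _ _ _ K u P X =>
  ∃ Y W : Fld m B, (c₁ ≠ 0 → O₁ B K u P Y) ∧ (c₂ ≠ 0 → O₂ B K u W P) ∧
    X = (Y.smul c₁).add (W.smul c₂)

/-! ### Functionals on the jet space and their variational derivatives -/

/-- The real coordinates of `iℝ ⊕ ℂ ⊕ ℂ^m ⊕ ℂ^m`. -/
inductive Coord (m : ℕ) : Type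
  | im1
  | re2
  | im2
  | reV1 (k : Fin m)
  | imV1 (k : Fin m)
  | reV2 (k : Fin m)
  | imV2 (k : Fin m)

/-- Densities of functionals: polynomials in the real jet variables `(α, k)`, standing for the `k`-th
`x`-derivative of the coordinate `α`, with coefficients in `B`. -/
abbrev Density (m : ℕ) (B : Type) [CommRing B] : Type := MvPolynomial (Coord m × ℕ) B

section Functionals

variable {B : Type} [CommRing B] [Algebra ℂ B] [StarRing B] {m : ℕ}

def re (b : B) : B := (1 / 2 : ℂ) • (b + star b)
def im (b : B) : B := (-Complex.I / 2) • (b - star b)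

def Fld.coord (u : Fld m B) : Coord m → B
  | .im1 => im u.s1
  | .re2 => re u.s2
  | .im2 => im u.s2
  | .reV1 k => re (u.v1 k)
  | .imV1 k => im (u.v1 k)
  | .reV2 k => re (u.v2 k)
  | .imV2 k => im (u.v2 k)

/-- A density is real if all its coefficients are. -/
def IsRealDensity (f : Density m B) : Prop := ∀ s, star (f.coeff s) = f.coeff s

variable [StarModule ℂ B] (K : Calc B) (u : Fld m B)

/-- The value of a density along `u`. -/
def evalJet (f : Density m B) : B :=
  MvPolynomial.eval (fun p : Coord m × ℕ => (⇑K.D)^[p.2] (u.coord p.1)) f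

/-- The Euler operator `∑ₖ (-D)ᵏ ∂f/∂u_{α,k}` along `u`. -/
def euler (f : Density m B) (α : Coord m) : B :=
  ∑ k ∈ f.vars.image Prod.snd,
    (-1) ^ k * (⇑K.D)^[k] (evalJet K u (MvPolynomial.pderiv (α, k) f))

/-- The variational derivative of `∫ f dx`, normalised by
`δ(∫ f dx) = ∫ pair (δf/δu) (δu) dx`. -/
def varDer (f : Density m B) : Fld m B where
  s1 := (Complex.I / 2) • euler K u f .im1
  s2 := (1 / 2 : ℂ) • (euler K u f .re2 + Complex.I • euler K u f .im2)
  v1 := fun k => (1 / 2 : ℂ) • (euler K u f (.reV1 k) + Complex.I • euler K u f (.imV1 k))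
  v2 := fun k => (1 / 2 : ℂ) • (euler K u f (.reV2 k) + Complex.I • euler K u f (.imV2 k))

/-- `f` is a total derivative, that is, `∫ f dx = 0`. -/
def IsTotal (f : B) : Prop := ∃ g, f = K.D g

/-- A prolonged evolutionary vector field: a real derivation commuting with the total derivative.
It acts on `u` by the characteristic `u.map E`. -/
structure IsEvol (E : Derivation ℂ B B) : Prop where
  comm : ∀ f, E (K.D f) = K.D (E f)
  real : ∀ f, E (star f) = star (E f)

/-- The coefficients of `f` do not depend on `u`, as far as the vector field `E` is concerned. -/
def Kills (E : Derivation ℂ B B) (f : Density m B) : Prop := ∀ s, E (f.coeff s) = 0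

end Functionals

/-! ### Hamiltonian (cosymplectic) and symplectic operators -/

/-- `𝒪` is a cosymplectic Hamiltonian operator: the bracket
`{F, G} = ∫ pair (δF/δu) (𝒪 (δG/δu)) dx` of real functionals is skew-symmetric and satisfies the
Jacobi identity `{{F₁, F₂}, F₃} + cyclic = 0`, where the bracket of an arbitrary functional with `Fᵢ`
is its derivative along the evolutionary vector field `Eᵢ` with characteristic `𝒪 (δFᵢ/δu)`.
All identities hold modulo total derivatives. -/
structure IsCosymplectic {m : ℕ} (O : NonlocalOp m) : Prop where
  skew : ∀ (B : Type) [CommRing B] [Algebra ℂ B] [StarRing B] [StarModule ℂ B]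
    (K : Calc B) (u : Fld m B), u.IsImag →
    ∀ F G : Density m B, IsRealDensity F → IsRealDensity G →
    ∀ X Y : Fld m B, O B K u (varDer K u F) X → O B K u (varDer K u G) Y →
      IsTotal K (pair (varDer K u F) Y + pair (varDer K u G) X)
  jacobi : ∀ (B : Type) [CommRing B] [Algebra ℂ B] [StarRing B] [StarModule ℂ B]
    (K : Calc B) (u : Fld m B), u.IsImag →
    ∀ F : Fin 3 → Density m B, (∀ i, IsRealDensity (F i)) →
    ∀ E : Fin 3 → Derivation ℂ B B, (∀ i, IsEvol K (E i)) → (∀ i j, Kills (E i) (F j)) →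
      (∀ i, O B K u (varDer K u (F i)) (u.map (E i))) →
      IsTotal K
        (E 2 (pair (varDer K u (F 0)) (u.map (E 1))) +
         E 0 (pair (varDer K u (F 1)) (u.map (E 2))) +
         E 1 (pair (varDer K u (F 2)) (u.map (E 0))))

/-- `𝒪` is a symplectic operator: the `2`-form `ω(X₁, X₂) = ∫ pair (X₁ u) (𝒪 (X₂ u)) dx` on
evolutionary vector fields is skew-symmetric and closed,
`X₁ ω(X₂, X₃) - ω([X₁, X₂], X₃) + cyclic = 0`. All identities hold modulo total derivatives. -/
structure IsSymplectic {m : ℕ} (O : NonlocalOp m) : Prop where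
  skew : ∀ (B : Type) [CommRing B] [Algebra ℂ B] [StarRing B] [StarModule ℂ B]
    (K : Calc B) (u : Fld m B), u.IsImag →
    ∀ h₁ h₂ Y₁ Y₂ : Fld m B, O B K u h₁ Y₁ → O B K u h₂ Y₂ →
      IsTotal K (pair h₁ Y₂ + pair h₂ Y₁)
  closed : ∀ (B : Type) [CommRing B] [Algebra ℂ B] [StarRing B] [StarModule ℂ B]
    (K : Calc B) (u : Fld m B), u.IsImag →
    ∀ E : Fin 3 → Derivation ℂ B B, (∀ i, IsEvol K (E i)) →
    ∀ Y : Fin 3 → Fld m B, (∀ i, O B K u (u.map (E i)) (Y i)) →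
      IsTotal K
        (E 0 (pair (u.map (E 1)) (Y 2)) - pair (u.map (⁅E 0, E 1⁆ : Derivation ℂ B B)) (Y 2) +
         (E 1 (pair (u.map (E 2)) (Y 0)) - pair (u.map (⁅E 1, E 2⁆ : Derivation ℂ B B)) (Y 0)) +
         (E 2 (pair (u.map (E 0)) (Y 1)) - pair (u.map (⁅E 2, E 0⁆ : Derivation ℂ B B)) (Y 1)))

/-! ### The symmetric Lie algebra `𝔰𝔭(n+1) = 𝔥 ⊕ 𝔪`, with `m = n - 1` -/

section LieAlgebra

variable {B : Type} [CommRing B] [StarRing B] {m : ℕ}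

/-- The matrix `[[A, B], [-B̄, Ā]]`. -/
def quat (X Y : Matrix (Idx m) (Idx m) B) : Mat m B :=
  Matrix.fromBlocks X Y (-(Y.map star)) (X.map star)

/-- The element `(a)` of the centraliser `𝔪_∥` of `e_x`, for real `a`. -/
def mPar (m : ℕ) (a : B) : Mat m B :=
  quat (Matrix.fromBlocks !![0, a; -a, 0] 0 0 0) 0

/-- The element `((s₁, s₂), (v₁, v₂))` of `𝔪_⊥`, for imaginary `s₁`. -/
def mPerp (h : Fld m B) : Mat m B :=
  quat
    (Matrix.fromBlocks !![0, h.s1; h.s1, 0] (Matrix.of ![h.v1, 0]) (-(Matrix.of ![h.v1, 0])ᴴ) 0)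
    (Matrix.fromBlocks !![0, h.s2; h.s2, 0] (Matrix.of ![h.v2, 0]) (Matrix.of ![h.v2, 0])ᵀ 0)

/-- The element `((c, d), (C, D))` of `𝔥_∥ ≃ 𝔰𝔭(1) ⊕ 𝔰𝔭(n-1)`, or of `Sp(1) × Sp(n-1)`. -/
def hPar (p : ParFld m B) : Mat m B :=
  quat (Matrix.fromBlocks !![p.c, 0; 0, p.c] 0 0 p.C) (Matrix.fromBlocks !![p.d, 0; 0, p.d] 0 0 p.D)

/-- The element `((s₁, s₂), (v₁, v₂))` of `𝔥_⊥`, for imaginary `s₁`. -/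
def hPerp (h : Fld m B) : Mat m B :=
  quat
    (Matrix.fromBlocks !![h.s1, 0; 0, -h.s1] (Matrix.of ![0, h.v1]) (-(Matrix.of ![0, h.v1])ᴴ) 0)
    (Matrix.fromBlocks !![h.s2, 0; 0, -h.s2] (Matrix.of ![0, h.v2]) (Matrix.of ![0, h.v2])ᵀ 0)

/-- The components of an element of `𝔥_⊥`. -/
def ofHPerp (X : Mat m B) : Fld m B where
  s1 := X (.inl (.inl 0)) (.inl (.inl 0))
  s2 := X (.inl (.inl 0)) (.inr (.inl 0))
  v1 := fun k => X (.inl (.inl 1)) (.inl (.inr k))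
  v2 := fun k => X (.inl (.inl 1)) (.inr (.inr k))

/-- The matrix `J` of the symplectic form. -/
def sympJ (m : ℕ) (B : Type) [CommRing B] : Mat m B := Matrix.fromBlocks 0 1 (-1) 0

variable [Algebra ℂ B]

/-- `p` represents an element of the group `Sp(1) × Sp(m)`. -/
def IsSpSp (p : ParFld m ℂ) : Prop := (hPar p)ᴴ * hPar p = 1

/-- The adjoint action of the (constant) element `p` of `Sp(1) × Sp(m)` on `𝔥_⊥`. -/
def Ad (p : ParFld m ℂ) (u : Fld m B) : Fld m B :=
  ofHPerp ((hPar p).map (algebraMap ℂ B) * hPerp u * ((hPar p).map (algebraMap ℂ B))ᴴ)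

/-- The normalisation constant `χ = 8 (n + 2)`. -/
def chi (n : ℕ) : ℝ := 8 * ((n : ℝ) + 2)

/-- The constant unit vector `e_x = χ^{-1/2} (1) ∈ 𝔪_∥`. -/
def eX (n : ℕ) (B : Type) [CommRing B] [StarRing B] [Algebra ℂ B] : Mat (n - 1) B :=
  mPar (n - 1) (algebraMap ℂ B ((1 / √(chi n) : ℝ) : ℂ))

/-- The Cartan structure equations (vanishing torsion, and curvature `-[e, e]/2`) pulled back to the
surface of the flow, with total derivatives `Dx`, `Dt`. -/
def CartanEqs (Dx Dt : B → B) (ex et ωx ωt : Mat m B) : Prop :=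
  et.map Dx - ex.map Dt + ⁅ωx, et⁆ - ⁅ωt, ex⁆ = 0 ∧
  ωt.map Dx - ωx.map Dt + ⁅ωx, ωt⁆ = -⁅ex, et⁆

end LieAlgebra

/-- `𝒪` is invariant under `Sp(1) × Sp(m)`. -/
def IsSpInvariant {m : ℕ} (O : NonlocalOp m) : Prop :=
  ∀ p : ParFld m ℂ, IsSpSp p →
  ∀ (B : Type) [CommRing B] [Algebra ℂ B] [StarRing B] [StarModule ℂ B]
    (K : Calc B) (u P X : Fld m B), u.IsImag →
    O B K u P X → O B K (Ad p u) (Ad p P) (Ad p X)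

/-! ### Curve flows -/

def IsSmooth (f : ℝ × ℝ → ℂ) : Prop := ContDiff ℝ ((⊤ : ℕ∞) : WithTop ℕ∞) f

theorem IsSmooth.diffAt {f : ℝ × ℝ → ℂ} (hf : IsSmooth f) (p : ℝ × ℝ) : DifferentiableAt ℝ f p :=
  ContDiffAt.differentiableAt (ContDiff.contDiffAt hf) (by simp)

/-- Smooth complex functions of `(t, x) ∈ ℝ²`. -/
def Smooth : StarSubalgebra ℂ (ℝ × ℝ → ℂ) where
  carrier := {f | IsSmooth f}
  mul_mem' := fun {f g} (hf : IsSmooth f) (hg : IsSmooth g) =>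
    (ContDiff.mul hf hg : IsSmooth (f * g))
  add_mem' := fun {f g} (hf : IsSmooth f) (hg : IsSmooth g) =>
    (ContDiff.add hf hg : IsSmooth (f + g))
  algebraMap_mem' := fun r => (contDiff_const : IsSmooth fun _ => r)
  star_mem' := fun {f} (hf : IsSmooth f) =>
    (Complex.conjCLE.contDiff.comp hf : IsSmooth fun p => Complex.conjCLE (f p))

theorem Smooth.isSmooth (f : Smooth) : IsSmooth f.1 := f.2

/-- The directional derivative along `v`. -/
def Smooth.deriv (v : ℝ × ℝ) : Derivation ℂ Smooth Smooth :=
  Derivation.mk'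
    { toFun := fun f => ⟨fun p => fderiv ℝ f.1 p v,
        ((Smooth.isSmooth f).fderiv_right (m := ((⊤ : ℕ∞) : WithTop ℕ∞)) (by simp)).clm_apply
          contDiff_const⟩
      map_add' := by
        intro f g
        apply Subtype.ext
        funext p
        have h := fderiv_add ((Smooth.isSmooth f).diffAt p) ((Smooth.isSmooth g).diffAt p)
        exact congrArg (fun T => T v) h
      map_smul' := by
        intro c f
        apply Subtype.ext
        funext p
        have h := fderiv_const_smul ((Smooth.isSmooth f).diffAt p) c
        exact congrArg (fun T => T v) h }
    (by
      intro f g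
      apply Subtype.ext
      funext p
      have h := fderiv_mul ((Smooth.isSmooth f).diffAt p) ((Smooth.isSmooth g).diffAt p)
      exact congrArg (fun T => T v) h)

/-- `∂/∂t`. -/
def Smooth.dt : Derivation ℂ Smooth Smooth := Smooth.deriv (1, 0)

/-- `∂/∂x`. -/
def Smooth.dx : Derivation ℂ Smooth Smooth := Smooth.deriv (0, 1)

/-- A non-stretching curve flow `γ(t,x)` in `Sp(n+1)/Sp(1)×Sp(n)`, given through a smooth lift
`g(t,x) ∈ Sp(n+1)`, `γ = g · (Sp(1)×Sp(n))`, which is a parallel frame: the pulled back coframe `e`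
and connection `ω` are the `𝔪`- and `𝔥`-components of `g⁻¹ dg`, where `e_x` is the constant unit
vector `eX n` (so `x` is the arclength) and `ω_x` lies in `𝔥_⊥`. -/
structure ParallelFlow (n : ℕ) where
  g : Mat (n - 1) Smooth
  unitary : gᴴ * g = 1
  symplectic : gᵀ * sympJ (n - 1) Smooth * g = sympJ (n - 1) Smooth
  /-- The components of `ω_x`. -/
  u : Fld (n - 1) Smooth
  u_imag : u.IsImag
  /-- The component of `e_t` in `𝔪_∥`. -/
  hp : Smooth
  hp_real : star hp = hp
  /-- The component of `e_t` in `𝔪_⊥`. -/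
  hl : Fld (n - 1) Smooth
  hl_imag : hl.IsImag
  /-- The component of `ω_t` in `𝔥_∥`. -/
  wp : ParFld (n - 1) Smooth
  wp_alg : wp.IsAlg
  /-- The component of `ω_t` in `𝔥_⊥`. -/
  w : Fld (n - 1) Smooth
  w_imag : w.IsImag
  frame_x : gᴴ * g.map Smooth.dx = eX n Smooth + hPerp u
  frame_t : gᴴ * g.map Smooth.dt = (mPar (n - 1) hp + mPerp hl) + (hPar wp + hPerp w)

end SpFlow

end

open SpFlow

namespace SpFlow

set_option linter.unusedSectionVars false
set_option linter.flexible false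
set_option linter.unusedSimpArgs false

/-! ### Block calculus for matrices of quaternionic shape -/

section Dictionary

variable {B : Type} [CommRing B] [StarRing B] {m : ℕ}

/-! Everything comes from one covariant derivative, `∇ = D_x + ad u` on `𝔰𝔭(n+1)`-valued functions,
together with the constant `e = (1/2) ∈ 𝔪_∥`. The operators are two reductions of `∇`. Lift `ϖ ∈
𝔥_⊥` to `P = ϖ + ϖ^∥ ∈ 𝔥`, with `ϖ^∥` chosen to cancel the `𝔥_∥`-part of `∇P`; then `∇P = ℋ(ϖ)`
(`opH_eq`, `nabla_hPerp_add_hPar`). Lift `h ∈ 𝔥_⊥` to `M ∈ 𝔪` with `[e, M] = h` and with its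
`𝔪_∥`-part chosen to cancel that of `∇M`; then `∇M = -[e, 𝒥(h)]` (`nabla_mPar_add_mPerp`). The
Cartan equations say exactly `∇e_t + [e_x, ϖ] = 0` and `∇ω_t = u_t - [e_x, e_t]`, so they split into
the two flow equations (`cartanEqs_iff`). For an actual lift `g` they are the odd and even parts of
the Maurer-Cartan equation.

A value `X` of `c₁ℋ + c₂𝒥⁻¹` at `P` has the form `X = c₁∇P + c₂[e, M]` with `∇M = -[e, P]`. The
trace form is ad-invariant, so `D_x⟨X, Y⟩ = ⟨∇X, Y⟩ + ⟨X, ∇Y⟩` and skew-symmetry is immediate. In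
the Jacobi identity the derivatives of the gradients cancel by self-adjointness of their
linearisation (`helmholtz`). What remains is a cyclic sum of terms `⟨P, [X, P]⟩` and `⟨M, [X, M]⟩`.
It is a total derivative because `∇` is a derivation of the bracket and the form `⟨X, [Y, Z]⟩` is
alternating and invariant under `ad e` (`pencil_jacobi`). This treats `ℋ` and its compatibility with
`𝒥` at once. Closedness of `𝒥` is the same computation, where invariance under `ad e` makes the
cubic terms vanish (`symplectic_closed`).

Conjugation by a constant `g ∈ Sp(1) × Sp(n-1)` fixes `e`, preserves the trace form and carries `∇`
at `u` to `∇` at `gu`. It therefore carries lifts to lifts, which gives invariance. -/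

theorem quat_mul (X Y X' Y' : Matrix (Idx m) (Idx m) B) : quat X Y * quat X' Y' =
    quat (X * X' - Y * Y'.map star) (X * Y' + Y * X'.map star) := by
  have hm : ∀ S T : Matrix (Idx m) (Idx m) B, (S * T).map star = S.map star * T.map star :=
    fun S T => Matrix.map_mul (f := starRingEnd B)
  have hm2 : ∀ S : Matrix (Idx m) (Idx m) B, (S.map star).map star = S := by
    intro S; ext i j; simp
  have hs : ∀ S T : Matrix (Idx m) (Idx m) B, (S - T).map star = S.map star - T.map star := by
    intro S T; ext i j; simp
  have ha : ∀ S T : Matrix (Idx m) (Idx m) B, (S + T).map star = S.map star + T.map star := by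
    intro S T; ext i j; simp
  unfold quat
  rw [Matrix.fromBlocks_multiply, Matrix.fromBlocks_inj]
  refine ⟨?_, ?_, ?_, ?_⟩
  · simp [sub_eq_add_neg]
  · simp
  · simp only [ha, hm, hm2, neg_mul, mul_neg]; abel
  · simp only [hs, hm, hm2, neg_mul]; abel

theorem quat_conjTranspose (X Y : Matrix (Idx m) (Idx m) B) :
    (quat X Y)ᴴ = quat Xᴴ (-Yᵀ) := by
  unfold quat
  rw [Matrix.fromBlocks_conjTranspose, Matrix.fromBlocks_inj]
  refine ⟨rfl, ?_, ?_, ?_⟩ <;> ext i j <;> simp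

theorem quat_bracket (X Y X' Y' : Matrix (Idx m) (Idx m) B) :
    ⁅quat X Y, quat X' Y'⁆ =
      quat (X * X' - Y * Y'.map star - (X' * X - Y' * Y.map star))
        (X * Y' + Y * X'.map star - (X' * Y + Y' * X.map star)) := by
  rw [Ring.lie_def, quat_mul, quat_mul]
  ext i j
  rcases i with i | i <;> rcases j with j | j <;> simp [quat]
  all_goals ring

/-- Matrices in blocks of sizes `1, 1, m`. -/
def blk (a b c d : B) (r s p q : Fin m → B) (N : Matrix (Fin m) (Fin m) B) :
    Matrix (Idx m) (Idx m) B :=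
  Matrix.fromBlocks !![a, b; c, d] (Matrix.of ![r, s]) (Matrix.of ![p, q])ᵀ N

theorem blk_inj {a b c d a' b' c' d' : B} {r s p q r' s' p' q' : Fin m → B}
    {N N' : Matrix (Fin m) (Fin m) B} :
    blk a b c d r s p q N = blk a' b' c' d' r' s' p' q' N' ↔
      (a = a' ∧ b = b' ∧ c = c' ∧ d = d') ∧ (r = r' ∧ s = s') ∧ (p = p' ∧ q = q') ∧ N = N' := by
  unfold blk
  rw [Matrix.fromBlocks_inj, Matrix.transpose_inj]
  simp [and_assoc]

theorem blk_mul (a b c d a' b' c' d' : B) (r s p q r' s' p' q' : Fin m → B)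
    (N N' : Matrix (Fin m) (Fin m) B) :
    blk a b c d r s p q N * blk a' b' c' d' r' s' p' q' N' =
      blk (a * a' + b * c' + r ⬝ᵥ p') (a * b' + b * d' + r ⬝ᵥ q')
        (c * a' + d * c' + s ⬝ᵥ p') (c * b' + d * d' + s ⬝ᵥ q')
        (a • r' + b • s' + r ᵥ* N') (c • r' + d • s' + s ᵥ* N')
        (a' • p + c' • q + N *ᵥ p') (b' • p + d' • q + N *ᵥ q')
        (Matrix.vecMulVec p r' + Matrix.vecMulVec q s' + N * N') := by
  unfold blk
  rw [Matrix.fromBlocks_multiply, Matrix.fromBlocks_inj]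
  refine ⟨?_, ?_, ?_, ?_⟩
  · ext i j
    fin_cases i <;> fin_cases j <;> simp [Matrix.vecMul, dotProduct]
  · ext i j
    fin_cases i <;> simp [Matrix.vecMul, dotProduct]
  · ext i j
    fin_cases j <;> simp [Matrix.mul_apply, Fin.sum_univ_two, Matrix.mulVec, dotProduct, mul_comm]
  · ext i j
    simp [Matrix.mul_apply, Fin.sum_univ_two, Matrix.vecMulVec]

theorem blk_map {B' : Type} (f : B → B') (a b c d : B) (r s p q : Fin m → B)
    (N : Matrix (Fin m) (Fin m) B) :
    (blk a b c d r s p q N).map f =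
      Matrix.fromBlocks !![f a, f b; f c, f d] (Matrix.of ![f ∘ r, f ∘ s])
        (Matrix.of ![f ∘ p, f ∘ q])ᵀ (N.map f) := by
  unfold blk
  rw [Matrix.fromBlocks_map, Matrix.fromBlocks_inj]
  refine ⟨?_, ?_, ?_, rfl⟩
  · ext i j
    fin_cases i <;> fin_cases j <;> rfl
  · ext i j
    fin_cases i <;> rfl
  · ext i j
    fin_cases j <;> rfl

theorem blk_map_star (a b c d : B) (r s p q : Fin m → B) (N : Matrix (Fin m) (Fin m) B) :
    (blk a b c d r s p q N).map star =
      blk (star a) (star b) (star c) (star d) (star r) (star s) (star p) (star q) (N.map star) :=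
  blk_map star a b c d r s p q N

theorem blk_add (a b c d a' b' c' d' : B) (r s p q r' s' p' q' : Fin m → B)
    (N N' : Matrix (Fin m) (Fin m) B) :
    blk a b c d r s p q N + blk a' b' c' d' r' s' p' q' N' =
      blk (a + a') (b + b') (c + c') (d + d') (r + r') (s + s') (p + p') (q + q') (N + N') := by
  unfold blk
  rw [Matrix.fromBlocks_add, Matrix.fromBlocks_inj]
  refine ⟨by simp, by simp, ?_, rfl⟩
  ext i j
  fin_cases j <;> rfl

theorem blk_neg (a b c d : B) (r s p q : Fin m → B) (N : Matrix (Fin m) (Fin m) B) :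
    -blk a b c d r s p q N = blk (-a) (-b) (-c) (-d) (-r) (-s) (-p) (-q) (-N) := by
  unfold blk
  rw [Matrix.fromBlocks_neg, Matrix.fromBlocks_inj]
  refine ⟨by simp, by simp, ?_, rfl⟩
  ext i j
  fin_cases j <;> rfl

theorem blk_sub (a b c d a' b' c' d' : B) (r s p q r' s' p' q' : Fin m → B)
    (N N' : Matrix (Fin m) (Fin m) B) :
    blk a b c d r s p q N - blk a' b' c' d' r' s' p' q' N' =
      blk (a - a') (b - b') (c - c') (d - d') (r - r') (s - s') (p - p') (q - q') (N - N') := by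
  simp only [sub_eq_add_neg, blk_neg, blk_add]

theorem zero_eq_blk :
    (0 : Matrix (Idx m) (Idx m) B) = blk 0 0 0 0 0 0 0 0 0 := by
  ext i j
  rcases i with i | i <;> rcases j with j | j
  · fin_cases i <;> fin_cases j <;> rfl
  · fin_cases i <;> rfl
  · fin_cases j <;> rfl
  · rfl

theorem quat_inj {X Y X' Y' : Matrix (Idx m) (Idx m) B} :
    quat X Y = quat X' Y' ↔ X = X' ∧ Y = Y' := by
  constructor
  · intro h
    exact ⟨(Matrix.fromBlocks_inj.1 h).1, (Matrix.fromBlocks_inj.1 h).2.1⟩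
  · rintro ⟨rfl, rfl⟩
    rfl

theorem quat_add (X Y X' Y' : Matrix (Idx m) (Idx m) B) :
    quat X Y + quat X' Y' = quat (X + X') (Y + Y') := by
  unfold quat
  rw [Matrix.fromBlocks_add, Matrix.fromBlocks_inj]
  refine ⟨rfl, rfl, ?_, ?_⟩
  · ext i j; simp [add_comm]
  · ext i j; simp

theorem quat_neg (X Y : Matrix (Idx m) (Idx m) B) : -quat X Y = quat (-X) (-Y) := by
  unfold quat
  rw [Matrix.fromBlocks_neg, Matrix.fromBlocks_inj]
  refine ⟨rfl, rfl, ?_, ?_⟩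
  · ext i j; simp
  · ext i j; simp

theorem quat_sub (X Y X' Y' : Matrix (Idx m) (Idx m) B) :
    quat X Y - quat X' Y' = quat (X - X') (Y - Y') := by
  simp only [sub_eq_add_neg, quat_neg, quat_add]

theorem zero_eq_quat : (0 : Mat m B) = quat 0 0 := by
  ext i j
  rcases i with i | i <;> rcases j with j | j <;> simp [quat]

/-- Once the four summands are in `quat`-`blk` form, every bracket is computed by `quat_bracket` and
`blk_mul` and compared entrywise by `blk_inj`. -/
theorem mPar_eq (a : B) :
    mPar m a = quat (blk 0 a (-a) 0 0 0 0 0 0) (blk 0 0 0 0 0 0 0 0 0) := by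
  rw [mPar, quat_inj, ← zero_eq_blk]
  refine ⟨?_, rfl⟩
  unfold blk
  rw [Matrix.fromBlocks_inj]
  refine ⟨rfl, ?_, ?_, rfl⟩
  · ext i j; fin_cases i <;> rfl
  · ext i j; fin_cases j <;> rfl

theorem mPerp_eq (h : Fld m B) :
    mPerp h = quat (blk 0 h.s1 h.s1 0 h.v1 0 (-star h.v1) 0 0)
      (blk 0 h.s2 h.s2 0 h.v2 0 h.v2 0 0) := by
  rw [mPerp, quat_inj]
  unfold blk
  rw [Matrix.fromBlocks_inj, Matrix.fromBlocks_inj]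
  refine ⟨⟨rfl, rfl, ?_, rfl⟩, rfl, rfl, rfl, rfl⟩
  ext i j; fin_cases j <;> simp

theorem hPerp_eq (h : Fld m B) :
    hPerp h = quat (blk h.s1 0 0 (-h.s1) 0 h.v1 0 (-star h.v1) 0)
      (blk h.s2 0 0 (-h.s2) 0 h.v2 0 h.v2 0) := by
  rw [hPerp, quat_inj]
  unfold blk
  rw [Matrix.fromBlocks_inj, Matrix.fromBlocks_inj]
  refine ⟨⟨rfl, rfl, ?_, rfl⟩, rfl, rfl, rfl, rfl⟩
  ext i j; fin_cases j <;> simp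

theorem hPar_eq (p : ParFld m B) :
    hPar p = quat (blk p.c 0 0 p.c 0 0 0 0 p.C) (blk p.d 0 0 p.d 0 0 0 0 p.D) := by
  rw [hPar, quat_inj]
  unfold blk
  rw [Matrix.fromBlocks_inj, Matrix.fromBlocks_inj]
  refine ⟨⟨rfl, ?_, ?_, rfl⟩, rfl, ?_, ?_, rfl⟩
  all_goals ext i j; first | (fin_cases i; rfl; rfl) | (fin_cases j <;> rfl)

end Dictionary

/-! ### Brackets between the summands `𝔪_∥`, `𝔪_⊥`, `𝔥_∥`, `𝔥_⊥` -/

section Brackets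

variable {B : Type} [CommRing B] [Algebra ℂ B] [StarRing B] {m : ℕ}

/-- The `𝔥_⊥`-component of the bracket of two elements of `𝔥_⊥`. -/
noncomputable def brPerp (u w : Fld m B) : Fld m B where
  s1 := (1 / 2 : ℂ) • (vC u.v1 w.v1 + vC u.v2 w.v2)
  s2 := (1 / 2 : ℂ) • (vS u.v2 w.v1 - vS u.v1 w.v2)
  v1 := R u.v1 w.s1 - R (star u.v2) w.s2 - Ls u.s1 w.v1 + Ls u.s2 (star w.v2)
  v2 := R u.v2 w.s1 + R (star u.v1) w.s2 - Ls u.s2 (star w.v1) - Ls u.s1 w.v2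

/-- The bracket of an element of `𝔥_⊥` with an element of `𝔥_∥`. -/
noncomputable def brPar (u : Fld m B) (p : ParFld m B) : Fld m B where
  s1 := -sC u.s2 p.d
  s2 := sS u.s1 p.d - sS u.s2 p.c
  v1 := L u.v1 p.C - L u.v2 (cc p.D) - R u.v1 p.c + R (star u.v2) p.d
  v2 := L u.v1 p.D + L u.v2 (cc p.C) - R u.v2 p.c - R (star u.v1) p.d

/-- The `𝔪_⊥`-component of the bracket of an element of `𝔥_⊥` with an element of `𝔪_⊥`. -/
noncomputable def brM (u h : Fld m B) : Fld m B where
  s1 := -((1 / 2 : ℂ) • (vC u.v1 h.v1 + vC u.v2 h.v2))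
  s2 := (1 / 2 : ℂ) • (vS u.v1 h.v2 - vS u.v2 h.v1)
  v1 := Ls u.s1 h.v1 - Ls u.s2 (star h.v2) - R u.v1 h.s1 + R (star u.v2) h.s2
  v2 := Ls u.s1 h.v2 + Ls u.s2 (star h.v1) - R u.v2 h.s1 - R (star u.v1) h.s2

theorem ParFld.IsAlg.mulVec_D {p : ParFld m B} (hp : p.IsAlg) (x : Fin m → B) :
    p.D *ᵥ x = x ᵥ* p.D := by
  rw [← Matrix.vecMul_transpose, hp.2.2]

theorem ParFld.IsAlg.map_star_C {p : ParFld m B} (hp : p.IsAlg) : p.C.map star = -p.Cᵀ := by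
  ext i j
  exact congrFun (congrFun hp.2.1 j) i

theorem ParFld.IsAlg.star_vecMul_C {p : ParFld m B} (hp : p.IsAlg) (x : Fin m → B) :
    star (x ᵥ* p.C) = -(p.C *ᵥ star x) := by
  rw [Matrix.star_vecMul, hp.2.1, Matrix.neg_mulVec]

theorem ParFld.IsAlg.star_vecMul_D {p : ParFld m B} (hp : p.IsAlg) (x : Fin m → B) :
    star (x ᵥ* p.D.map star) = star x ᵥ* p.D := by
  have h : (p.D.map star)ᴴ = p.D := by
    ext i j
    simpa using congrFun (congrFun hp.2.2 i) j
  rw [Matrix.star_vecMul, h, hp.mulVec_D]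

/-- `𝔥_⊥` is the orthogonal complement of the subalgebra `𝔥_∥` in `𝔥`, hence stable under its
adjoint action. -/
theorem bracket_hPerp_hPar (u : Fld m B) (p : ParFld m B) (hu : u.IsImag) (hp : p.IsAlg) :
    ⁅hPerp u, hPar p⁆ = hPerp (brPar u p) := by
  unfold Fld.IsImag at hu
  rw [hPerp_eq, hPar_eq, hPerp_eq, quat_bracket, quat_inj]
  simp only [blk_map_star, blk_mul, blk_add, blk_sub, blk_inj]
  simp [hu, hp.1, brPar, sC, sS, R, L, cc, hp.mulVec_D, hp.map_star_C, hp.star_vecMul_C,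
    hp.star_vecMul_D, Matrix.vecMul_neg, Matrix.mulVec_neg, Matrix.neg_vecMul,
    Matrix.vecMul_transpose]
  refine ⟨⟨⟨?_, ?_⟩, ?_, ?_⟩, ⟨?_, ?_⟩, ?_, ?_⟩
  all_goals first | module | ring1

/-- The bracket leaves `𝔥_⊥`, and `srcH` is minus the part that leaks into `𝔥_∥`. This is why its
antiderivative is the right `ϖ^∥`. -/
theorem bracket_hPerp_hPerp [StarModule ℂ B] (u w : Fld m B) (hu : u.IsImag) (hw : w.IsImag) :
    ⁅hPerp u, hPerp w⁆ = hPerp (brPerp u w) - hPar (srcH u w) := by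
  unfold Fld.IsImag at hu hw
  rw [hPerp_eq, hPerp_eq, hPerp_eq, hPar_eq, quat_bracket, quat_sub, quat_inj]
  simp only [blk_map_star, blk_mul, blk_add, blk_sub, blk_inj]
  simp [hu, hw, brPerp, srcH, sC, sS, vC, vS, oC, oS, R, Ls, cc]
  simp only [dotProduct_comm w.v1 u.v2, dotProduct_comm w.v2 u.v1, dotProduct_comm w.v1 (star u.v1),
    dotProduct_comm w.v2 (star u.v2)]
  refine ⟨⟨⟨?_, ?_⟩, ?_, ?_, ?_⟩, ⟨?_, ?_⟩, ?_, ?_, ?_⟩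
  case refine_5 => ext i j; simp [Matrix.vecMulVec_apply]; ring
  case refine_10 => ext i j; simp [Matrix.vecMulVec_apply]; ring
  all_goals first | ring1 | module | algebra

/-- The `𝔪_∥`-part is the source of the nonlocal term of `𝒥`: after inverting `ad e_x` on `h` it
becomes a multiple of `pair u h`. -/
theorem bracket_hPerp_mPerp (u h : Fld m B) (hu : u.IsImag) (hh : h.IsImag) :
    ⁅hPerp u, mPerp h⁆ = mPerp (brM u h) +
      mPar m (sS u.s1 h.s1 - sA u.s2 h.s2 + (1 / 2 : ℂ) • (vA u.v1 h.v1 + vA u.v2 h.v2)) := by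
  unfold Fld.IsImag at hu hh
  rw [hPerp_eq, mPerp_eq, mPerp_eq, mPar_eq, quat_bracket, quat_add, quat_inj]
  simp only [blk_map_star, blk_mul, blk_add, blk_sub, blk_inj]
  simp [hu, hh, brM, sA, sS, vC, vS, vA, R, Ls]
  simp only [dotProduct_comm h.v1 u.v2, dotProduct_comm h.v2 u.v1, dotProduct_comm h.v1 (star u.v1),
    dotProduct_comm h.v2 (star u.v2)]
  refine ⟨⟨⟨?_, ?_⟩, ?_, ?_⟩, ⟨?_, ?_⟩, ?_, ?_⟩
  all_goals first | module | algebra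

/-- The weights `2a` on scalars and `-a` on vectors are the root data of the space. The ratio 4 of
their squares reappears as the factor 4 in the vector rows of `𝒥`. -/
theorem bracket_mPar_mPerp (a : B) (ha : star a = a) (h : Fld m B) :
    ⁅mPar m a, mPerp h⁆ =
      hPerp ⟨2 * a * h.s1, 2 * a * h.s2, -(a • h.v1), -(a • h.v2)⟩ := by
  rw [mPar_eq, mPerp_eq, hPerp_eq, quat_bracket, quat_inj]
  simp only [blk_map_star, blk_mul, blk_add, blk_sub, blk_inj]
  simp [ha]
  refine ⟨⟨?_, ?_⟩, ?_, ?_⟩ <;> ring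

theorem bracket_mPar_hPerp (a : B) (ha : star a = a) (h : Fld m B) :
    ⁅mPar m a, hPerp h⁆ =
      mPerp ⟨-(2 * a * h.s1), -(2 * a * h.s2), a • h.v1, a • h.v2⟩ := by
  rw [mPar_eq, hPerp_eq, mPerp_eq, quat_bracket, quat_inj]
  simp only [blk_map_star, blk_mul, blk_add, blk_sub, blk_inj]
  simp [ha]
  refine ⟨?_, ?_⟩ <;> ring

theorem bracket_mPar_hPar (a : B) (ha : star a = a) (p : ParFld m B) :
    ⁅mPar m a, hPar p⁆ = 0 := by
  rw [mPar_eq, hPar_eq, quat_bracket, zero_eq_quat, zero_eq_blk, quat_inj]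
  simp only [blk_map_star, blk_mul, blk_add, blk_sub, blk_inj]
  simp [ha]
  refine ⟨⟨?_, ?_⟩, ?_, ?_⟩ <;> ring

theorem bracket_mPar_mPar (a b : B) (ha : star a = a) (hb : star b = b)  :
    ⁅mPar m a, mPar m b⁆ = 0 := by
  rw [mPar_eq, mPar_eq, quat_bracket, zero_eq_quat, zero_eq_blk, quat_inj]
  simp only [blk_map_star, blk_mul, blk_add, blk_sub, blk_inj]
  simp [ha, hb, mul_comm]

end Brackets

theorem bracket_skew {ι A : Type} [Fintype ι] [CommRing A] (X Y : Matrix ι ι A) :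
    ⁅X, Y⁆ = -⁅Y, X⁆ := by
  rw [Ring.lie_def, Ring.lie_def, neg_sub]

theorem star_dotProduct_star_right {A : Type} [CommRing A] [StarRing A] {m : ℕ} (x y : Fin m → A) :
    star (x ⬝ᵥ star y) = y ⬝ᵥ star x := by
  simp [dotProduct, star_sum, mul_comm]

/-! ### Additivity of the parametrisations -/

section Linear

variable {B : Type} [CommRing B] [StarRing B] {m : ℕ}

theorem hPerp_inj {u w : Fld m B} : hPerp u = hPerp w ↔ u = w := by
  constructor
  · intro h
    rw [hPerp_eq, hPerp_eq, quat_inj, blk_inj, blk_inj] at h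
    obtain ⟨⟨⟨h1, -⟩, ⟨-, h2⟩, -⟩, ⟨h3, -⟩, ⟨-, h4⟩, -⟩ := h
    exact Fld.ext h1 h3 h2 h4
  · rintro rfl
    rfl

theorem hPerp_add (u w : Fld m B) : hPerp (u.add w) = hPerp u + hPerp w := by
  simp only [hPerp_eq, quat_add, blk_add, quat_inj, blk_inj, Fld.add, star_add]
  simp [add_comm]

theorem hPerp_sub (u w : Fld m B) : hPerp (u.sub w) = hPerp u - hPerp w := by
  simp only [hPerp_eq, quat_sub, blk_sub, quat_inj, blk_inj, Fld.sub, star_sub]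
  simp [add_comm, sub_eq_add_neg]

theorem mPerp_add (u w : Fld m B) : mPerp (u.add w) = mPerp u + mPerp w := by
  simp only [mPerp_eq, quat_add, blk_add, quat_inj, blk_inj, Fld.add, star_add]
  simp [add_comm]

theorem mPar_add (a b : B) : mPar m (a + b) = mPar m a + mPar m b := by
  simp only [mPar_eq, quat_add, blk_add, quat_inj, blk_inj]
  simp [add_comm]

end Linear

/-! ### Entrywise action of maps that commute with conjugation -/

section Maps

variable {B B' : Type} [CommRing B] [StarRing B] [CommRing B'] [StarRing B'] {m : ℕ}

/-- Additive maps that commute with the involution. -/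
structure IsRealAdd (f : B → B') : Prop where
  add : ∀ x y, f (x + y) = f x + f y
  map_star : ∀ x, f (star x) = star (f x)

theorem IsRealAdd.zero {f : B → B'} (hf : IsRealAdd f) : f 0 = 0 := by
  have := hf.add 0 0
  simpa using this

theorem IsRealAdd.neg {f : B → B'} (hf : IsRealAdd f) (x : B) : f (-x) = -f x := by
  have := hf.add (-x) x
  rw [neg_add_cancel, hf.zero] at this
  exact eq_neg_of_add_eq_zero_left this.symm

theorem IsRealAdd.quat_map {f : B → B'} (hf : IsRealAdd f) (X Y : Matrix (Idx m) (Idx m) B) :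
    (quat X Y).map f = quat (X.map f) (Y.map f) := by
  ext i j
  rcases i with i | i <;> rcases j with j | j <;> simp [quat, hf.neg, hf.map_star]

theorem IsRealAdd.map_blk {f : B → B'} (_ : IsRealAdd f) (a b c d : B) (r s p q : Fin m → B)
    (N : Matrix (Fin m) (Fin m) B) :
    (blk a b c d r s p q N).map f =
      blk (f a) (f b) (f c) (f d) (f ∘ r) (f ∘ s) (f ∘ p) (f ∘ q) (N.map f) :=
  blk_map f a b c d r s p q N

theorem IsRealAdd.hPar_map {f : B → B'} (hf : IsRealAdd f) (p : ParFld m B) :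
    (hPar p).map f = hPar (p.map f) := by
  have h0 : f ∘ (0 : Fin m → B) = 0 := funext fun _ => hf.zero
  simp only [hPar_eq, hf.quat_map, hf.map_blk, ParFld.map, hf.zero, h0]

theorem IsRealAdd.mPar_map {f : B → B'} (hf : IsRealAdd f) (a : B) :
    (mPar m a).map f = mPar m (f a) := by
  have h0 : f ∘ (0 : Fin m → B) = 0 := funext fun _ => hf.zero
  have h1 : (0 : Matrix (Fin m) (Fin m) B).map f = 0 := by ext; exact hf.zero
  simp only [mPar_eq, hf.quat_map, hf.map_blk, hf.zero, h0, hf.neg, h1]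

theorem IsRealAdd.hPerp_map {f : B → B} (hf : IsRealAdd f) (u : Fld m B) :
    (hPerp u).map f = hPerp (u.map f) := by
  have h0 : f ∘ (0 : Fin m → B) = 0 := funext fun _ => hf.zero
  have h1 : (0 : Matrix (Fin m) (Fin m) B).map f = 0 := by ext; exact hf.zero
  have h2 : f ∘ (-star u.v1) = -star (fun k => f (u.v1 k)) :=
    funext fun _ => by simp [hf.neg, hf.map_star]
  simp only [hPerp_eq, hf.quat_map, hf.map_blk, Fld.map, hf.zero, h0, h1, h2, hf.neg]
  rfl

theorem IsRealAdd.mPerp_map {f : B → B} (hf : IsRealAdd f) (u : Fld m B) :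
    (mPerp u).map f = mPerp (u.map f) := by
  have h0 : f ∘ (0 : Fin m → B) = 0 := funext fun _ => hf.zero
  have h1 : (0 : Matrix (Fin m) (Fin m) B).map f = 0 := by ext; exact hf.zero
  have h2 : f ∘ (-star u.v1) = -star (fun k => f (u.v1 k)) :=
    funext fun _ => by simp [hf.neg, hf.map_star]
  simp only [mPerp_eq, hf.quat_map, hf.map_blk, Fld.map, hf.zero, h0, h1, h2]
  rfl

theorem IsRealAdd.isImag_map {f : B → B} (hf : IsRealAdd f) {u : Fld m B} (hu : u.IsImag) :
    (u.map f).IsImag := by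
  unfold Fld.IsImag at *
  simp only [Fld.map]
  rw [← hf.map_star, hu, hf.neg]

end Maps

/-! ### `ℋ` and `𝒥` as reductions of the covariant derivative -/

section Operators

variable {B : Type} [CommRing B] [Algebra ℂ B] [StarRing B] [StarModule ℂ B] {m : ℕ}

theorem Calc.isRealAdd_D (K : Calc B) : IsRealAdd (K.D : B → B) := ⟨map_add K.D, K.D_star⟩

theorem Calc.isRealAdd_Dinv (K : Calc B) : IsRealAdd (K.Dinv : B → B) :=
  ⟨map_add K.Dinv, K.Dinv_star⟩

theorem star_half_smul (b : B) : star ((1 / 2 : ℂ) • b) = (1 / 2 : ℂ) • star b := by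
  rw [star_smul]; simp

theorem star_algebraMap_ofReal (r : ℝ) :
    star (algebraMap ℂ B (r : ℂ)) = algebraMap ℂ B (r : ℂ) := by
  rw [← algebraMap_star_comm]; simp

theorem two_smul_cancel {x y : B} (h : x + x = y + y) : x = y := by
  have h2 : (1 / 2 : ℂ) • (x + x) = (1 / 2 : ℂ) • (y + y) := by rw [h]
  have h3 : ∀ z : B, (1 / 2 : ℂ) • (z + z) = z := fun z => by
    rw [← two_smul ℂ z, smul_smul]; norm_num
  rwa [h3, h3] at h2

/-- Directness of the sum `𝔥_⊥ ⊕ 𝔥_∥`, which lets equations in `𝔥` be read off componentwise. -/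
theorem hPerp_add_hPar_inj {x y : Fld m B} {a b : ParFld m B} :
    hPerp x + hPar a = hPerp y + hPar b ↔ x = y ∧ a = b := by
  constructor
  · intro h
    simp only [hPerp_eq, hPar_eq, quat_add, blk_add, quat_inj, blk_inj, zero_add, add_zero] at h
    obtain ⟨⟨⟨h1, -, -, h2⟩, ⟨-, h3⟩, -, h4⟩, ⟨⟨h5, -, -, h6⟩, ⟨-, h7⟩, -, h8⟩⟩ := h
    -- The two leading diagonal entries are `c + s1` and `c - s1`; their difference isolates `2 s1`,
    -- and 2 is invertible.
    have e1 : x.s1 = y.s1 := two_smul_cancel (by linear_combination h1 - h2)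
    have e2 : x.s2 = y.s2 := two_smul_cancel (by linear_combination h5 - h6)
    rw [e1] at h1
    rw [e2] at h5
    exact ⟨Fld.ext e1 e2 h3 h7, ParFld.ext (add_left_cancel h1) (add_left_cancel h5) h4 h8⟩
  · rintro ⟨rfl, rfl⟩
    rfl

theorem mPerp_add_mPar_inj {x y : Fld m B} {a b : B} :
    mPerp x + mPar m a = mPerp y + mPar m b ↔ x = y ∧ a = b := by
  constructor
  · intro h
    simp only [mPerp_eq, mPar_eq, quat_add, blk_add, quat_inj, blk_inj, zero_add, add_zero] at h
    obtain ⟨⟨⟨-, h1, h2, -⟩, ⟨h3, -⟩, -⟩, ⟨⟨-, h5, -⟩, ⟨h7, -⟩, -⟩⟩ := h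
    have e1 : x.s1 = y.s1 := two_smul_cancel (by linear_combination h1 + h2)
    rw [e1] at h1
    exact ⟨Fld.ext e1 h5 h3 h7, add_left_cancel h1⟩
  · rintro ⟨rfl, rfl⟩
    rfl

/-- The covariant derivative `D_x + ad u`. -/
noncomputable def nabla (K : Calc B) (u : Fld m B) (X : Mat m B) : Mat m B :=
  X.map K.D + ⁅hPerp u, X⁆

theorem nabla_add (K : Calc B) (u : Fld m B) (X Y : Mat m B) :
    nabla K u (X + Y) = nabla K u X + nabla K u Y := by
  unfold nabla
  rw [Matrix.map_add K.D (map_add K.D), Ring.lie_def, Ring.lie_def, Ring.lie_def, mul_add, add_mul]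
  abel

/-- Needed for `Dinv` of the source to lie in `𝔥_∥`, so that the bracket formulas apply to it. -/
theorem srcH_isAlg (u w : Fld m B) : (srcH u w).IsAlg := by
  refine ⟨?_, ?_, ?_⟩
  · simp only [srcH, sC, vC, star_add, star_half_smul, star_sub, star_mul, star_star,
      star_dotProduct_star_right]
    algebra
  · ext i j
    simp [srcH, oC, cc, Matrix.vecMulVec_apply]
    ring
  · ext i j
    simp [srcH, oS, cc, Matrix.vecMulVec_apply]
    ring

theorem ParFld.IsAlg.map {p : ParFld m B} (hp : p.IsAlg) {f : B → B} (hf : IsRealAdd f) :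
    (p.map f).IsAlg := by
  refine ⟨?_, ?_, ?_⟩
  · simp only [ParFld.map]
    rw [← hf.map_star, hp.1, hf.neg]
  · ext i j
    have := congrFun (congrFun hp.2.1 i) j
    simp only [ParFld.map, Matrix.conjTranspose_apply, Matrix.map_apply, Matrix.neg_apply] at *
    rw [← hf.map_star, this, hf.neg]
  · ext i j
    exact congrArg f (congrFun (congrFun hp.2.2 i) j)

/-- The sixteen entries collapse because each antiderivative in them is a summand of an entry of
`srcH`. What is left is the `𝔥_⊥`-part of `∇(w + ϖ^∥)`. -/
theorem opH_eq (K : Calc B) (u w : Fld m B) :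
    opH K u w = (w.map K.D).add ((brPerp u w).add (brPar u ((srcH u w).map K.Dinv))) := by
  have hn : ∀ (x : Fin m → B) (Y : Matrix (Fin m) (Fin m) B), x ᵥ* (-Y) = -(x ᵥ* Y) :=
    fun x Y => Matrix.vecMul_neg x Y
  have hs : ∀ x : B, K.Dinv (star x) = star (K.Dinv x) := K.Dinv_star
  ext
  · simp only [opH, H11, H12, H13, H14, Fld.add, Fld.map, brPerp, brPar, ParFld.map, srcH, sC,
      map_add, map_sub, map_smul, star_add, star_sub, star_half_smul]
    algebra
  · simp only [opH, H21, H22, H23, H24, Fld.add, Fld.map, brPerp, brPar, ParFld.map, srcH, sS,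
      map_add, map_sub, map_smul, star_add, star_sub, star_half_smul]
    algebra
  · rename_i k
    simp only [opH, H31, H32, H33, H34, Fld.add, Fld.map, brPerp, brPar, ParFld.map, srcH, R, L, Ls,
      Calc.DV, Calc.DinvM, Pi.add_apply, Pi.sub_apply, Pi.smul_apply, Pi.neg_apply, smul_eq_mul,
      map_add, map_sub, map_smul, Matrix.vecMul, dotProduct, Matrix.map_apply, cc,
      Matrix.add_apply, Matrix.sub_apply, star_sub, star_add, star_star, mul_add, mul_sub,
      Finset.sum_add_distrib, Finset.sum_sub_distrib, ← hs]
    algebra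
  · rename_i k
    simp only [opH, H41, H42, H43, H44, Fld.add, Fld.map, brPerp, brPar, ParFld.map, srcH, R, L, Ls,
      Calc.DV, Calc.DinvM, Pi.add_apply, Pi.sub_apply, Pi.smul_apply, Pi.neg_apply, smul_eq_mul,
      map_add, map_sub, map_smul, Matrix.vecMul, dotProduct, Matrix.map_apply, cc,
      Matrix.add_apply, Matrix.sub_apply, star_sub, star_add, star_star, mul_add, mul_sub,
      Finset.sum_add_distrib, Finset.sum_sub_distrib, ← hs]
    algebra

theorem nabla_hPerp_add_hPar (K : Calc B) (u w : Fld m B) (p : ParFld m B) (hu : u.IsImag)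
    (hw : w.IsImag) (hp : p.IsAlg) :
    nabla K u (hPerp w + hPar p) =
      hPerp ((w.map K.D).add ((brPerp u w).add (brPar u p))) +
        (hPar (p.map K.D) - hPar (srcH u w)) := by
  rw [nabla_add, nabla, nabla, K.isRealAdd_D.hPerp_map, K.isRealAdd_D.hPar_map,
    bracket_hPerp_hPerp u w hu hw, bracket_hPerp_hPar u p hu hp, hPerp_add, hPerp_add]
  abel

/-- The element `h_⊥` of `𝔪_⊥` with `[(r), h_⊥] = h`. -/
noncomputable def adInv (r : ℝ) (h : Fld m B) : Fld m B where
  s1 := (1 / (2 * r) : ℂ) • h.s1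
  s2 := (1 / (2 * r) : ℂ) • h.s2
  v1 := -((1 / r : ℂ) • h.v1)
  v2 := -((1 / r : ℂ) • h.v2)

/-- `ad (r)` acts on `𝔪_⊥` by the nonzero weights `2r` and `-r`, so `h` and `h_⊥` determine each
other. -/
theorem bracket_mPar_mPerp_eq_iff (r : ℝ) (hr : r ≠ 0) (h hl : Fld m B) :
    hPerp h = ⁅mPar m (algebraMap ℂ B (r : ℂ)), mPerp hl⁆ ↔ hl = adInv r h := by
  have hr' : (r : ℂ) ≠ 0 := by exact_mod_cast hr
  rw [bracket_mPar_mPerp _ (star_algebraMap_ofReal r), hPerp_inj]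
  have e1 : ∀ b : B, 2 * algebraMap ℂ B (r : ℂ) * b = (2 * (r : ℂ)) • b := fun b => by algebra
  have e2 : ∀ b : Fin m → B, -(algebraMap ℂ B (r : ℂ) • b) = -((r : ℂ) • b) := fun b => by
    rw [algebraMap_smul]
  simp only [e1, e2, adInv]
  constructor
  · rintro rfl
    ext <;> simp only [smul_neg, neg_neg, smul_smul, Pi.smul_apply, Pi.neg_apply]
    all_goals
      field_simp
      rw [one_smul]
  · rintro rfl
    ext <;> simp only [smul_neg, neg_neg, smul_smul, Pi.smul_apply, Pi.neg_apply]
    all_goals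
      field_simp
      rw [one_smul]

/-- The operator `𝒥` with the nonlocal variable `k` in place of `D_x⁻¹ (∑ A(uᵢ, hᵢ))`. -/
noncomputable def opJk (K : Calc B) (u : Fld m B) (k : B) (h : Fld m B) : Fld m B where
  s1 := K.D h.s1 + sS u.s1 k + vC u.v1 h.v1 + vC u.v2 h.v2
  s2 := K.D h.s2 + sS u.s2 k + vS u.v2 h.v1 - vS u.v1 h.v2
  v1 := (2 : ℂ) • R u.v1 h.s1 - (2 : ℂ) • R (star u.v2) h.s2 + (4 : ℂ) • K.DV h.v1
    + (4 : ℂ) • Ls u.s1 h.v1 - (4 : ℂ) • Ls u.s2 (star h.v2) + (2 : ℂ) • R u.v1 k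
  v2 := (2 : ℂ) • R u.v2 h.s1 + (2 : ℂ) • R (star u.v1) h.s2 + (4 : ℂ) • K.DV h.v2
    + (4 : ℂ) • Ls u.s1 h.v2 + (4 : ℂ) • Ls u.s2 (star h.v1) + (2 : ℂ) • R u.v2 k

theorem opJ_eq (K : Calc B) (u h : Fld m B) : opJ K u h = opJk K u (K.Dinv (pair u h)) h := by
  ext
  · simp only [opJ, J11, J12, J13, J14, opJk, pair, sS, map_add]
    ring
  · simp only [opJ, J21, J22, J23, J24, opJk, pair, sS, map_add]
    ring
  · simp only [opJ, J31, J32, J33, J34, opJk, pair, R, map_add, Pi.add_apply, Pi.sub_apply,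
      Pi.smul_apply, Pi.neg_apply, smul_eq_mul]
    algebra
  · simp only [opJ, J41, J42, J43, J44, opJk, pair, R, map_add, Pi.add_apply, Pi.sub_apply,
      Pi.smul_apply, Pi.neg_apply, smul_eq_mul]
    algebra

theorem pair_real (u h : Fld m B) : star (pair u h) = pair u h := by
  simp only [pair, sA, vA, star_add, star_mul, star_star, star_dotProduct_star_right]
  ring

/-- The link between `𝒥` and `∇`. The variable `k` is kept free because `D (Dinv f) = f` is not
automatic: the defect `D k - pair u h` is exactly the `𝔪_∥`-part, and the `𝔪_⊥`-part is `𝒥` up to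
`ad (r)`. -/
theorem nabla_mPar_add_mPerp (K : Calc B) (u h : Fld m B) (k : B) (hu : u.IsImag) (hh : h.IsImag)
    (hk : star k = k) (r : ℝ) (hr : r ≠ 0) :
    nabla K u (mPar m ((1 / (2 * r) : ℂ) • k) + mPerp (adInv r h)) =
      mPar m ((1 / (2 * r) : ℂ) • (K.D k - pair u h)) -
        ⁅mPar m (algebraMap ℂ B (r : ℂ)), hPerp ((opJk K u k h).smul (1 / (4 * r ^ 2)))⁆ := by
  have hr' : (r : ℂ) ≠ 0 := by exact_mod_cast hr
  have hi : (adInv r h).IsImag := by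
    unfold Fld.IsImag at *
    simp only [adInv, star_smul, hh]
    simp
  have hk' : star ((1 / (2 * r) : ℂ) • k) = (1 / (2 * r) : ℂ) • k := by
    rw [star_smul, hk]; simp
  rw [nabla_add, nabla, nabla, K.isRealAdd_D.mPar_map, K.isRealAdd_D.mPerp_map,
    bracket_hPerp_mPerp u _ hu hi, bracket_skew (hPerp u) (mPar m _), bracket_mPar_hPerp _ hk',
    bracket_mPar_hPerp _ (star_algebraMap_ofReal r)]
  have hρ : star (1 / r : ℂ) = 1 / r := by simp
  have c1 : (1 / (2 * r) : ℂ) = (1 / r) / 2 := by field_simp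
  -- The weight `2r` times `1/(4r²)` leaves `1/(2r)` on scalars; on vectors the weight `r` leaves
  -- `1/(4r)`.
  have c2 : ∀ b : B, 2 * algebraMap ℂ B (r : ℂ) * (((1 / (4 * r ^ 2) : ℝ) : ℂ) • b) =
      ((1 / r : ℂ) / 2) • b := fun b => by
    have e : ∀ c : ℂ, 2 * algebraMap ℂ B (r : ℂ) * (c • b) = (2 * r * c) • b := fun c => by algebra
    rw [e]
    congr 1
    push_cast
    field_simp
    norm_num
  have c3 : ∀ b : Fin m → B, algebraMap ℂ B (r : ℂ) • (((1 / (4 * r ^ 2) : ℝ) : ℂ) • b) =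
      ((1 / r : ℂ) / 4) • b := fun b => by
    rw [algebraMap_smul, smul_smul]
    congr 1
    push_cast
    field_simp
  have hdr : ∀ x y : Fin m → B, x ⬝ᵥ star (-((1 / r : ℂ) • y)) = -((1 / r : ℂ) • (x ⬝ᵥ star y)) :=
    fun x y => by rw [star_neg, star_smul, hρ, dotProduct_neg, dotProduct_smul]
  have hdl : ∀ x y : Fin m → B, -((1 / r : ℂ) • y) ⬝ᵥ x = -((1 / r : ℂ) • (y ⬝ᵥ x)) :=
    fun x y => by rw [neg_dotProduct, smul_dotProduct]
  have hdr' : ∀ x y : Fin m → B, x ⬝ᵥ (-((1 / r : ℂ) • y)) = -((1 / r : ℂ) • (x ⬝ᵥ y)) :=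
    fun x y => by rw [dotProduct_neg, dotProduct_smul]
  have hs : ∀ b : B, star (((1 / r : ℂ) / 2) • b) = ((1 / r : ℂ) / 2) • star b := fun b => by
    rw [star_smul, star_div₀, hρ]; simp
  have hsv : ∀ b : Fin m → B, star (-((1 / r : ℂ) • b)) = -((1 / r : ℂ) • star b) := fun b => by
    rw [star_neg, star_smul, hρ]
  unfold Fld.IsImag at hu hh
  -- The `𝔪_∥`-component. For imaginary entries `sS u.s1 h.s1 = -sA u.s1 h.s1`, so all terms combine
  -- into `-pair u h`.
  have eA : K.D ((1 / (2 * r) : ℂ) • k) + (sS u.s1 (adInv r h).s1 - sA u.s2 (adInv r h).s2 +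
      (1 / 2 : ℂ) • (vA u.v1 (adInv r h).v1 + vA u.v2 (adInv r h).v2)) =
      (1 / (2 * r) : ℂ) • (K.D k - pair u h) := by
    simp only [pair, adInv, sA, sS, vA, hdr, hdl, c1, hs, hu, hh, K.D.map_smul]
    algebra
  -- The `𝔪_⊥`-component, with the `𝒥`-term moved to the left; only the bracket of `u` with the
  -- `k`-part of `𝔪_∥` is left.
  have eX : (((adInv r h).map K.D).add (brM u (adInv r h))).add
      ⟨-(2 * (algebraMap ℂ B) r * ((opJk K u k h).smul (1 / (4 * r ^ 2))).s1),
        -(2 * (algebraMap ℂ B) r * ((opJk K u k h).smul (1 / (4 * r ^ 2))).s2),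
        (algebraMap ℂ B) r • ((opJk K u k h).smul (1 / (4 * r ^ 2))).v1,
        (algebraMap ℂ B) r • ((opJk K u k h).smul (1 / (4 * r ^ 2))).v2⟩ =
      ⟨-(2 * ((1 / (2 * r) : ℂ) • k) * u.s1), -(2 * ((1 / (2 * r) : ℂ) • k) * u.s2),
        ((1 / (2 * r) : ℂ) • k) • u.v1, ((1 / (2 * r) : ℂ) • k) • u.v2⟩ := by
    simp only [Fld.smul, c2, c3]
    ext
    · simp only [Fld.add, Fld.map, adInv, brM, opJk, vC, sS, hdr, hdl, c1, K.D.map_smul]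
      algebra
    · simp only [Fld.add, Fld.map, adInv, brM, opJk, vS, sS, hdr', hdl, c1, K.D.map_smul]
      algebra
    · simp only [Fld.add, Fld.map, adInv, brM, opJk, R, Ls, hsv, c1, K.D.map_smul, Pi.add_apply,
        Pi.sub_apply, Pi.smul_apply, Pi.neg_apply, smul_eq_mul, map_neg, Calc.DV]
      algebra
    · simp only [Fld.add, Fld.map, adInv, brM, opJk, R, Ls, hsv, c1, K.D.map_smul, Pi.add_apply,
        Pi.sub_apply, Pi.smul_apply, Pi.neg_apply, smul_eq_mul, map_neg, Calc.DV]
      algebra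
  rw [← eX, ← eA, mPerp_add, mPerp_add, mPar_add (K.D _)]
  abel

end Operators

theorem bracket_add_right {ι A : Type} [Fintype ι] [CommRing A] (X Y Z : Matrix ι ι A) :
    ⁅X, Y + Z⁆ = ⁅X, Y⁆ + ⁅X, Z⁆ := by
  simp only [Ring.lie_def, mul_add, add_mul]
  abel

theorem bracket_add_left {ι A : Type} [Fintype ι] [CommRing A] (X Y Z : Matrix ι ι A) :
    ⁅X + Y, Z⁆ = ⁅X, Z⁆ + ⁅Y, Z⁆ := by
  simp only [Ring.lie_def, mul_add, add_mul]
  abel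

theorem bracket_sub_right {ι A : Type} [Fintype ι] [CommRing A] (X Y Z : Matrix ι ι A) :
    ⁅X, Y - Z⁆ = ⁅X, Y⁆ - ⁅X, Z⁆ := by
  simp only [Ring.lie_def, mul_sub, sub_mul]
  abel

/-! ### The Cartan equations are the flow equations -/

section CartanEquations

variable {B : Type} [CommRing B] [Algebra ℂ B] [StarRing B] [StarModule ℂ B] {m : ℕ}

/-- `ad (r)` is injective from `𝔥_⊥` into `𝔪_⊥`, which meets `𝔪_∥` only in zero. -/
theorem mPar_add_bracket_eq_zero_iff (r : ℝ) (hr : r ≠ 0) (a : B) (x : Fld m B) :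
    mPar m a + ⁅mPar m (algebraMap ℂ B (r : ℂ)), hPerp x⁆ = 0 ↔ a = 0 ∧ x = ⟨0, 0, 0, 0⟩ := by
  have hr' : (r : ℂ) ≠ 0 := by exact_mod_cast hr
  have h0 : (0 : Mat m B) = mPerp ⟨0, 0, 0, 0⟩ + mPar m 0 := by
    simp [mPerp_eq, mPar_eq, zero_eq_quat, ← zero_eq_blk, quat_add]
  have e1 : ∀ b : B, 2 * algebraMap ℂ B (r : ℂ) * b = (2 * (r : ℂ)) • b := fun b => by algebra
  rw [bracket_mPar_hPerp _ (star_algebraMap_ofReal r), add_comm, h0, mPerp_add_mPar_inj, and_comm]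
  simp only [Fld.mk.injEq, e1, neg_eq_zero, algebraMap_smul, smul_eq_zero, mul_eq_zero, hr',
    Fld.ext_iff]
  simp

theorem cartan_torsion_iff (K : Calc B) (u w h : Fld m B) (k : B) (r : ℝ) (hr : r ≠ 0)
    (hu : u.IsImag) (hh : h.IsImag) (hk : star k = k) :
    nabla K u (mPar m ((1 / (2 * r) : ℂ) • k) + mPerp (adInv r h)) +
        ⁅mPar m (algebraMap ℂ B (r : ℂ)), hPerp w⁆ = 0 ↔
      K.D k = pair u h ∧ w = (opJk K u k h).smul (1 / (4 * r ^ 2)) := by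
  have hr' : (1 / (2 * r) : ℂ) ≠ 0 := by simpa using hr
  have e : ∀ X Y Z W : Mat m B, X - ⁅Y, Z⁆ + ⁅Y, W⁆ = X + ⁅Y, W - Z⁆ := fun X Y Z W => by
    rw [bracket_sub_right]
    abel
  rw [nabla_mPar_add_mPerp K u h k hu hh hk r hr, e, ← hPerp_sub,
    mPar_add_bracket_eq_zero_iff r hr, smul_eq_zero_iff_right hr', sub_eq_zero]
  refine and_congr_right fun _ => ?_
  simp only [Fld.ext_iff, Fld.sub, sub_eq_zero, ← Pi.zero_def]

theorem isImag_of_adInv {r : ℝ} (hr : r ≠ 0) {h : Fld m B} (hi : (adInv r h).IsImag) :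
    h.IsImag := by
  have hr' : (1 / (2 * r) : ℂ) ≠ 0 := by simpa using hr
  have hs : star (1 / (2 * r) : ℂ) = 1 / (2 * r) := by simp
  unfold Fld.IsImag at *
  simp only [adInv, star_smul, hs, ← smul_neg] at hi
  exact smul_right_injective B hr' hi

theorem cartanEqs_iff (n : ℕ) (K : Calc B) (Dt : Derivation ℂ B B)
    (hDt : ∀ f, Dt (star f) = star (Dt f)) (u hl h w : Fld (n - 1) B) (hp : B)
    (wp : ParFld (n - 1) B) (hu : u.IsImag) (hli : hl.IsImag) (hw : w.IsImag)
    (hh : hPerp h = ⁅eX n B, mPerp hl⁆) (hwp : wp = (srcH u w).map K.Dinv)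
    (hhp : hp = ((√(chi n) / 2 : ℝ) : ℂ) • K.Dinv (pair u h)) :
    CartanEqs K.D Dt (eX n B) (mPar (n - 1) hp + mPerp hl) (hPerp u) (hPar wp + hPerp w) ↔
      relH (n - 1) B K u w ((u.map Dt).sub h) ∧
      ∃ v, relJ (n - 1) B K u h v ∧ w = v.smul (chi n / 4) := by
  have hchi : 0 < chi n := by unfold chi; positivity
  have hsq : √(chi n) ≠ 0 := (Real.sqrt_pos.2 hchi).ne'
  -- With `e_x = (r)` the theorem's constants become `√χ/2 = 1/(2r)` and `χ/4 = 1/(4r²)`.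
  obtain ⟨r, hr⟩ : ∃ r : ℝ, r = 1 / √(chi n) := ⟨_, rfl⟩
  have hr0 : r ≠ 0 := by rw [hr]; exact one_div_ne_zero hsq
  have hD : IsRealAdd (Dt : B → B) := ⟨map_add Dt, hDt⟩
  have hk : star (K.Dinv (pair u h)) = K.Dinv (pair u h) := by rw [← K.Dinv_star, pair_real]
  have hstar := star_algebraMap_ofReal (B := B) r
  have hp' : hp = (1 / (2 * r) : ℂ) • K.Dinv (pair u h) := by
    rw [hhp, hr]
    congr 1
    push_cast
    field_simp
  have hc : 1 / (4 * r ^ 2) = chi n / 4 := by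
    rw [hr, div_pow, one_pow, Real.sq_sqrt hchi.le]
    field_simp
  have hps : star hp = hp := by rw [hp', star_smul, hk]; simp
  unfold eX at *
  rw [← hr] at hh ⊢
  have hE : (mPar (n - 1) (algebraMap ℂ B (r : ℂ))).map Dt = 0 := by
    rw [hD.mPar_map, Derivation.map_algebraMap]
    simp [mPar_eq, zero_eq_quat, ← zero_eq_blk]
  have hhl := (bracket_mPar_mPerp_eq_iff r hr0 h hl).1 hh
  have hhi : h.IsImag := isImag_of_adInv hr0 (hhl ▸ hli)
  have hwa : wp.IsAlg := hwp ▸ (srcH_isAlg u w).map K.isRealAdd_Dinv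
  unfold CartanEqs relH relJ
  -- The torsion equation reads `∇e_t + [e_x, ϖ] = 0`, since `e_x` is constant and commutes with
  -- `𝔥_∥`.
  have key1 : (mPar (n - 1) hp + mPerp hl).map K.D -
      (mPar (n - 1) (algebraMap ℂ B (r : ℂ))).map Dt + ⁅hPerp u, mPar (n - 1) hp + mPerp hl⁆ -
      ⁅hPar wp + hPerp w, mPar (n - 1) (algebraMap ℂ B (r : ℂ))⁆ =
      nabla K u (mPar (n - 1) ((1 / (2 * r) : ℂ) • K.Dinv (pair u h)) + mPerp (adInv r h)) +
        ⁅mPar (n - 1) (algebraMap ℂ B (r : ℂ)), hPerp w⁆ := by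
    rw [hE, ← hhl, ← hp', bracket_skew (hPar wp + hPerp w), bracket_add_right _ (hPar wp),
      bracket_mPar_hPar _ hstar, nabla]
    abel
  -- The left side of the curvature equation is `∇ω_t - u_t`. Its `𝔥_∥`-part expresses that the
  -- antiderivatives in `ℋ` exist.
  have key2 : (hPar wp + hPerp w).map K.D - (hPerp u).map Dt + ⁅hPerp u, hPar wp + hPerp w⁆ =
      hPerp (opH K u w) + hPar (wp.map K.D) - (hPerp (u.map Dt) + hPar (srcH u w)) := by
    have := nabla_hPerp_add_hPar K u w wp hu hw hwa
    rw [hwp, ← opH_eq, ← hwp, nabla] at this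
    rw [add_comm (hPar wp), hD.hPerp_map, sub_add_eq_add_sub, this]
    abel
  have key3 : -⁅mPar (n - 1) (algebraMap ℂ B (r : ℂ)), mPar (n - 1) hp + mPerp hl⁆ = -hPerp h := by
    rw [bracket_add_right, bracket_mPar_mPar _ _ hstar hps, zero_add, hh]
  have key4 : hPerp (opH K u w) + hPar (wp.map K.D) - (hPerp (u.map Dt) + hPar (srcH u w)) =
      -hPerp h ↔ opH K u w = (u.map Dt).sub h ∧ wp.map K.D = srcH u w := by
    rw [← hPerp_add_hPar_inj, hPerp_sub, sub_eq_iff_eq_add]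
    constructor
    · intro H; rw [H]; abel
    · intro H; rw [H]; abel
  rw [key1, key2, key3, key4, cartan_torsion_iff K u w h _ r hr0 hu hhi hk, ← opJ_eq, hc, ← hwp]
  constructor
  · rintro ⟨⟨h1, h2⟩, h3, h4⟩
    exact ⟨⟨hw, h4, h3.symm⟩, _, ⟨hhi, h1, rfl⟩, h2⟩
  · rintro ⟨⟨-, h4, h3⟩, v, ⟨-, h1, rfl⟩, h2⟩
    exact ⟨⟨h1, h2⟩, h3.symm, h4⟩

end CartanEquations
-- Maurer-Cartan equation of a smooth lift and its even and odd parts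
section ParallelFrames

/-- Mixed partial derivatives of smooth functions commute. -/
theorem Smooth.deriv_comm (v w : ℝ × ℝ) (f : Smooth) :
    Smooth.deriv v (Smooth.deriv w f) = Smooth.deriv w (Smooth.deriv v f) := by
  apply Subtype.ext
  funext p
  have hf : ContDiff ℝ ((⊤ : ℕ∞) : WithTop ℕ∞) f.1 := Smooth.isSmooth f
  have hsymm : IsSymmSndFDerivAt ℝ f.1 p :=
    (hf.contDiffAt).isSymmSndFDerivAt (by
      rw [minSmoothness_of_isRCLikeNormedField]
      exact WithTop.coe_le_coe.2 (le_top : (2 : ℕ∞) ≤ ⊤))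
  have hd : DifferentiableAt ℝ (fderiv ℝ f.1) p :=
    (hf.fderiv_right (m := ((⊤ : ℕ∞) : WithTop ℕ∞)) (by simp)).differentiable (by simp) p
  have e : ∀ a b : ℝ × ℝ, (Smooth.deriv a (Smooth.deriv b f)).1 p =
      fderiv ℝ (fderiv ℝ f.1) p a b := by
    intro a b
    change fderiv ℝ (fun q => fderiv ℝ f.1 q b) p a = _
    rw [fderiv_clm_apply hd (differentiableAt_const b)]
    simp
  rw [e, e]
  exact hsymm v w

theorem Smooth.deriv_star (v : ℝ × ℝ) (f : Smooth) :
    Smooth.deriv v (star f) = star (Smooth.deriv v f) := by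
  apply Subtype.ext
  funext p
  change fderiv ℝ (fun q => Complex.conjCLE (f.1 q)) p v = Complex.conjCLE (fderiv ℝ f.1 p v)
  have h := (Complex.conjCLE.toContinuousLinearMap.hasFDerivAt (x := f.1 p)).comp p
    ((Smooth.isSmooth f).diffAt p).hasFDerivAt
  have h2 := h.fderiv
  exact congrArg (fun T => T v) h2

/-- The Maurer-Cartan equation of a unitary matrix. -/
theorem maurerCartan {ι B : Type} [Fintype ι] [DecidableEq ι] [CommRing B] [Algebra ℂ B]
    [StarRing B] (Dx Dt : Derivation ℂ B B) (hx : ∀ f, Dx (star f) = star (Dx f))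
    (ht : ∀ f, Dt (star f) = star (Dt f)) (hc : ∀ f, Dx (Dt f) = Dt (Dx f))
    (g : Matrix ι ι B) (hg : gᴴ * g = 1) :
    (gᴴ * g.map Dt).map Dx - (gᴴ * g.map Dx).map Dt + ⁅gᴴ * g.map Dx, gᴴ * g.map Dt⁆ = 0 := by
  have hg' : g * gᴴ = 1 := mul_eq_one_comm.1 hg
  have hm : ∀ (D : Derivation ℂ B B) (X Y : Matrix ι ι B),
      (X * Y).map D = X.map D * Y + X * Y.map D := by
    intro D X Y
    ext i j
    simp [Matrix.mul_apply, Finset.sum_add_distrib, mul_comm, add_comm]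
  -- Derivative of the inverse, obtained by differentiating `gᴴ g = 1`.
  have hH : ∀ D : Derivation ℂ B B, (∀ f, D (star f) = star (D f)) →
      gᴴ.map D = -(gᴴ * g.map D * gᴴ) := by
    intro D hD
    have h1 : (gᴴ * g).map D = 0 := by
      rw [hg]
      ext i j
      by_cases hij : i = j <;> simp [Matrix.one_apply, hij]
    rw [hm] at h1
    have h2 := congrArg (· * gᴴ) h1
    simp only [add_mul, mul_assoc, hg', mul_one, zero_mul] at h2
    rw [mul_assoc]
    exact eq_neg_of_add_eq_zero_left h2
  have hcc : (g.map Dt).map Dx = (g.map Dx).map Dt := by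
    ext i j
    exact hc _
  rw [hm, hm, hH Dx hx, hH Dt ht, hcc, Ring.lie_def]
  simp only [neg_mul, mul_assoc]
  abel

/-- The grading of the index set that defines the splitting `𝔥 ⊕ 𝔪`. -/
def grade {m : ℕ} : Idx m ⊕ Idx m → Bool
  | .inl (.inl 0) => true
  | .inr (.inl 0) => true
  | _ => false

section Grading

variable {B : Type} [CommRing B] {m : ℕ}

/-- Matrices that preserve the grading. -/
def IsEven (X : Mat m B) : Prop := ∀ i j, grade i ≠ grade j → X i j = 0

/-- Matrices that reverse the grading. -/
def IsOdd (X : Mat m B) : Prop := ∀ i j, grade i = grade j → X i j = 0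

theorem IsEven.add {X Y : Mat m B} (hX : IsEven X) (hY : IsEven Y) : IsEven (X + Y) :=
  fun i j h => by simp [hX i j h, hY i j h]

theorem IsEven.neg {X : Mat m B} (hX : IsEven X) : IsEven (-X) :=
  fun i j h => by simp [hX i j h]

theorem IsOdd.add {X Y : Mat m B} (hX : IsOdd X) (hY : IsOdd Y) : IsOdd (X + Y) :=
  fun i j h => by simp [hX i j h, hY i j h]

theorem IsOdd.neg {X : Mat m B} (hX : IsOdd X) : IsOdd (-X) :=
  fun i j h => by simp [hX i j h]

theorem IsEven.map {X : Mat m B} (hX : IsEven X) {f : B → B} (hf : f 0 = 0) : IsEven (X.map f) :=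
  fun i j h => by simp [hX i j h, hf]

theorem IsOdd.map {X : Mat m B} (hX : IsOdd X) {f : B → B} (hf : f 0 = 0) : IsOdd (X.map f) :=
  fun i j h => by simp [hX i j h, hf]

theorem IsEven.mul_even {X Y : Mat m B} (hX : IsEven X) (hY : IsEven Y) : IsEven (X * Y) := by
  intro i j h
  rw [Matrix.mul_apply]
  refine Finset.sum_eq_zero fun k _ => ?_
  by_cases hk : grade i = grade k
  · rw [hY k j (hk ▸ h), mul_zero]
  · rw [hX i k hk, zero_mul]

theorem IsEven.mul_odd {X Y : Mat m B} (hX : IsEven X) (hY : IsOdd Y) : IsOdd (X * Y) := by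
  intro i j h
  rw [Matrix.mul_apply]
  refine Finset.sum_eq_zero fun k _ => ?_
  by_cases hk : grade i = grade k
  · rw [hY k j (hk ▸ h), mul_zero]
  · rw [hX i k hk, zero_mul]

theorem IsOdd.mul_even {X Y : Mat m B} (hX : IsOdd X) (hY : IsEven Y) : IsOdd (X * Y) := by
  intro i j h
  rw [Matrix.mul_apply]
  refine Finset.sum_eq_zero fun k _ => ?_
  by_cases hk : grade i = grade k
  · rw [hX i k hk, zero_mul]
  · rw [hY k j (fun h' => hk (h.trans h'.symm)), mul_zero]

theorem IsOdd.mul_odd {X Y : Mat m B} (hX : IsOdd X) (hY : IsOdd Y) : IsEven (X * Y) := by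
  intro i j h
  rw [Matrix.mul_apply]
  refine Finset.sum_eq_zero fun k _ => ?_
  by_cases hk : grade i = grade k
  · rw [hX i k hk, zero_mul]
  · have : grade k = grade j := by
      revert h hk
      cases grade i <;> cases grade j <;> cases grade k <;> simp
    rw [hY k j this, mul_zero]

theorem IsEven.bracket_even {X Y : Mat m B} (hX : IsEven X) (hY : IsEven Y) : IsEven ⁅X, Y⁆ := by
  rw [Ring.lie_def, sub_eq_add_neg]
  exact (hX.mul_even hY).add (hY.mul_even hX).neg

theorem IsEven.bracket_odd {X Y : Mat m B} (hX : IsEven X) (hY : IsOdd Y) : IsOdd ⁅X, Y⁆ := by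
  rw [Ring.lie_def, sub_eq_add_neg]
  exact (hX.mul_odd hY).add (hY.mul_even hX).neg

theorem IsOdd.bracket_odd {X Y : Mat m B} (hX : IsOdd X) (hY : IsOdd Y) : IsEven ⁅X, Y⁆ := by
  rw [Ring.lie_def, sub_eq_add_neg]
  exact (hX.mul_odd hY).add (hY.mul_odd hX).neg

theorem eq_zero_of_isOdd_add_isEven {X Y : Mat m B} (hX : IsOdd X) (hY : IsEven Y)
    (h : X + Y = 0) : X = 0 ∧ Y = 0 := by
  have key : ∀ i j, X i j = 0 ∧ Y i j = 0 := by
    intro i j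
    have h1 : X i j + Y i j = 0 := congrFun (congrFun h i) j
    by_cases hg : grade i = grade j
    · have h2 := hX i j hg
      exact ⟨h2, by rwa [h2, zero_add] at h1⟩
    · have h2 := hY i j hg
      exact ⟨by rwa [h2, add_zero] at h1, h2⟩
  exact ⟨Matrix.ext fun i j => (key i j).1, Matrix.ext fun i j => (key i j).2⟩

variable [StarRing B]

theorem isOdd_quat_blk (b c : B) (r p : Fin m → B) (b' c' : B) (r' p' : Fin m → B) :
    IsOdd (quat (blk 0 b c 0 r 0 p 0 0) (blk 0 b' c' 0 r' 0 p' 0 0)) := by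
  rintro ((i | i) | (i | i)) ((j | j) | (j | j)) h
  all_goals try (fin_cases i)
  all_goals try (fin_cases j)
  all_goals simp_all [grade, quat, blk]

theorem isEven_quat_blk (a d : B) (s q : Fin m → B) (N : Matrix (Fin m) (Fin m) B) (a' d' : B)
    (s' q' : Fin m → B) (N' : Matrix (Fin m) (Fin m) B) :
    IsEven (quat (blk a 0 0 d 0 s 0 q N) (blk a' 0 0 d' 0 s' 0 q' N')) := by
  rintro ((i | i) | (i | i)) ((j | j) | (j | j)) h
  all_goals try (fin_cases i)
  all_goals try (fin_cases j)
  all_goals simp_all [grade, quat, blk]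

theorem isOdd_mPar (a : B) : IsOdd (mPar m a) := by
  rw [mPar_eq]
  exact isOdd_quat_blk _ _ _ _ _ _ _ _

theorem isOdd_mPerp (h : Fld m B) : IsOdd (mPerp h) := by
  rw [mPerp_eq]
  exact isOdd_quat_blk _ _ _ _ _ _ _ _

theorem isEven_hPar (p : ParFld m B) : IsEven (hPar p) := by
  rw [hPar_eq]
  exact isEven_quat_blk _ _ _ _ _ _ _ _ _ _

theorem isEven_hPerp (h : Fld m B) : IsEven (hPerp h) := by
  rw [hPerp_eq]
  exact isEven_quat_blk _ _ _ _ _ _ _ _ _ _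

end Grading

/-- `𝔪` is odd and `𝔥` even for `grade`, and brackets respect parity. Hence the odd part of the
Maurer-Cartan equation is the torsion equation and the even part is the curvature equation. -/
theorem ParallelFlow.cartanEqs {n : ℕ} (Φ : ParallelFlow n) :
    CartanEqs Smooth.dx Smooth.dt (eX n Smooth) (mPar (n - 1) Φ.hp + mPerp Φ.hl) (hPerp Φ.u)
      (hPar Φ.wp + hPerp Φ.w) := by
  have hmc := maurerCartan Smooth.dx Smooth.dt (Smooth.deriv_star _) (Smooth.deriv_star _)
    (Smooth.deriv_comm _ _) Φ.g Φ.unitary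
  rw [Φ.frame_x, Φ.frame_t] at hmc
  have hodd : IsOdd (eX n Smooth) := isOdd_mPar _
  have hodd' : IsOdd (mPar (n - 1) Φ.hp + mPerp Φ.hl) := (isOdd_mPar _).add (isOdd_mPerp _)
  have heven := isEven_hPerp Φ.u
  have heven' : IsEven (hPar Φ.wp + hPerp Φ.w) := (isEven_hPar _).add (isEven_hPerp _)
  generalize eX n Smooth = E at *
  generalize mPar (n - 1) Φ.hp + mPerp Φ.hl = E' at *
  generalize hPerp Φ.u = W at *
  generalize hPar Φ.wp + hPerp Φ.w = W' at *
  have h1 : IsOdd (E'.map Smooth.dx + -E.map Smooth.dt + (⁅W, E'⁆ + -⁅W', E⁆)) :=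
    ((hodd'.map (map_zero _)).add (hodd.map (map_zero _)).neg).add
      ((heven.bracket_odd hodd').add (heven'.bracket_odd hodd).neg)
  have h2 : IsEven (W'.map Smooth.dx + -W.map Smooth.dt + (⁅W, W'⁆ + ⁅E, E'⁆)) :=
    ((heven'.map (map_zero _)).add (heven.map (map_zero _)).neg).add
      ((heven.bracket_even heven').add (hodd.bracket_odd hodd'))
  have h3 : (E'.map Smooth.dx + -E.map Smooth.dt + (⁅W, E'⁆ + -⁅W', E⁆)) +
      (W'.map Smooth.dx + -W.map Smooth.dt + (⁅W, W'⁆ + ⁅E, E'⁆)) = 0 := by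
    rw [Matrix.map_add _ (map_add _), Matrix.map_add _ (map_add _), bracket_add_left,
      bracket_add_right, bracket_add_right] at hmc
    rw [← hmc, bracket_skew W' E]
    abel
  obtain ⟨h4, h5⟩ := eq_zero_of_isOdd_add_isEven h1 h2 h3
  constructor
  · rw [← h4]
    abel
  · rw [eq_neg_iff_add_eq_zero, ← h5]
    abel

theorem ParallelFlow.flowEqs {n : ℕ} (Φ : ParallelFlow n) (h : Fld (n - 1) Smooth)
    (K : Calc Smooth) (hK : K.D = Smooth.dx) (hh : hPerp h = ⁅eX n Smooth, mPerp Φ.hl⁆)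
    (hwp : Φ.wp = (srcH Φ.u Φ.w).map K.Dinv)
    (hhp : Φ.hp = ((√(chi n) / 2 : ℝ) : ℂ) • K.Dinv (pair Φ.u h)) :
    relH (n - 1) Smooth K Φ.u Φ.w ((Φ.u.map Smooth.dt).sub h) ∧
      ∃ v, relJ (n - 1) Smooth K Φ.u h v ∧ Φ.w = v.smul (chi n / 4) := by
  refine (cartanEqs_iff n K Smooth.dt (Smooth.deriv_star _) Φ.u Φ.hl h Φ.w Φ.hp Φ.wp Φ.u_imag
    Φ.hl_imag Φ.w_imag hh hwp hhp).1 ?_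
  rw [hK]
  exact Φ.cartanEqs

end ParallelFrames

/-! ### Invariant trace form: skew-symmetry, Jacobi identity and closedness in abstract form -/

section TraceForm

variable {ι B : Type} [Fintype ι] [CommRing B]

/-- The trace form. -/
def ip (X Y : Matrix ι ι B) : B := (X * Y).trace

theorem ip_comm (X Y : Matrix ι ι B) : ip X Y = ip Y X := Matrix.trace_mul_comm X Y

theorem ip_add_left (X Y Z : Matrix ι ι B) : ip (X + Y) Z = ip X Z + ip Y Z := by
  simp [ip, add_mul]

theorem ip_add_right (X Y Z : Matrix ι ι B) : ip X (Y + Z) = ip X Y + ip X Z := by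
  simp [ip, mul_add]

theorem ip_neg_left (X Z : Matrix ι ι B) : ip (-X) Z = -ip X Z := by simp [ip]

theorem ip_neg_right (X Z : Matrix ι ι B) : ip X (-Z) = -ip X Z := by simp [ip]

theorem ip_smul_right [Algebra ℂ B] (c : ℂ) (X Z : Matrix ι ι B) : ip X (c • Z) = c • ip X Z := by
  simp [ip]

theorem ip_bracket (X Y Z : Matrix ι ι B) : ip ⁅X, Y⁆ Z = ip X ⁅Y, Z⁆ := by
  simp only [ip, Ring.lie_def, mul_sub, sub_mul, Matrix.trace_sub, mul_assoc]
  rw [Matrix.trace_mul_comm Y, mul_assoc]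

theorem ip_bracket_left (E X Y : Matrix ι ι B) : ip ⁅E, X⁆ Y = -ip X ⁅E, Y⁆ := by
  rw [bracket_skew E X, ip_neg_left, ip_bracket]

/-- The alternating trilinear form `tr (X [Y, Z])`. -/
def triple (X Y Z : Matrix ι ι B) : B := ip X ⁅Y, Z⁆

theorem triple_swap_right (X Y Z : Matrix ι ι B) : triple X Y Z = -triple X Z Y := by
  rw [triple, triple, bracket_skew, ip_neg_right]

theorem triple_swap_left (X Y Z : Matrix ι ι B) : triple X Y Z = -triple Y X Z := by
  rw [triple, triple, ← ip_bracket, ← ip_bracket, bracket_skew, ip_neg_left]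

theorem bracket_smul_left [Algebra ℂ B] (c : ℂ) (X Y : Matrix ι ι B) : ⁅c • X, Y⁆ = c • ⁅X, Y⁆ := by
  simp [Ring.lie_def, smul_sub]

theorem bracket_leibniz (E X Y : Matrix ι ι B) : ⁅E, ⁅X, Y⁆⁆ = ⁅⁅E, X⁆, Y⁆ + ⁅X, ⁅E, Y⁆⁆ := by
  simp only [Ring.lie_def]
  noncomm_ring

/-- Infinitesimal ad-invariance of the Cartan 3-form, the only algebraic identity behind the
cancellation of cubic terms. -/
theorem triple_invariant (E X Y Z : Matrix ι ι B) :
    triple ⁅E, X⁆ Y Z + triple X ⁅E, Y⁆ Z + triple X Y ⁅E, Z⁆ = 0 := by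
  rw [triple, triple, triple, ip_bracket_left, bracket_leibniz, ip_add_right]
  ring

theorem triple_rotate (X Y Z : Matrix ι ι B) : triple X Y Z = triple Y Z X := by
  rw [triple_swap_left, triple_swap_right, neg_neg]

theorem triple_add_middle (X Y Z W : Matrix ι ι B) :
    triple X (Y + Z) W = triple X Y W + triple X Z W := by
  simp only [triple, bracket_add_left, ip_add_right]

theorem triple_smul_middle [Algebra ℂ B] (c : ℂ) (X Y W : Matrix ι ι B) :
    triple X (c • Y) W = c • triple X Y W := by
  simp only [triple, bracket_smul_left, ip_smul_right]

theorem triple_neg_left (X Y W : Matrix ι ι B) : triple (-X) Y W = -triple X Y W := by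
  simp only [triple, ip_neg_left]

theorem triple_neg_right (X Y W : Matrix ι ι B) : triple X Y (-W) = -triple X Y W := by
  rw [← triple_rotate, triple_neg_left, triple_rotate]

variable [Algebra ℂ B] (D : Derivation ℂ B B)

theorem map_derivation_mul (X Y : Matrix ι ι B) : (X * Y).map D = X.map D * Y + X * Y.map D := by
  ext i j
  simp [Matrix.mul_apply, Finset.sum_add_distrib, mul_comm, add_comm]

theorem derivation_ip (X Y : Matrix ι ι B) : D (ip X Y) = ip (X.map D) Y + ip X (Y.map D) := by
  have h : ∀ Z : Matrix ι ι B, D Z.trace = (Z.map D).trace := fun Z => by simp [Matrix.trace]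
  rw [ip, h, map_derivation_mul, Matrix.trace_add]
  rfl

theorem map_derivation_bracket (X Y : Matrix ι ι B) :
    ⁅X, Y⁆.map D = ⁅X.map D, Y⁆ + ⁅X, Y.map D⁆ := by
  simp only [Ring.lie_def]
  rw [Matrix.map_sub _ (map_sub D), map_derivation_mul, map_derivation_mul]
  abel

/-- The covariant derivative with connection matrix `U`. -/
def covD (U X : Matrix ι ι B) : Matrix ι ι B := X.map D + ⁅U, X⁆

theorem derivation_ip_covD (U X Y : Matrix ι ι B) :
    D (ip X Y) = ip (covD D U X) Y + ip X (covD D U Y) := by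
  rw [derivation_ip, covD, covD, ip_add_left, ip_add_right, ip_bracket_left]
  ring

theorem covD_bracket (U X Y : Matrix ι ι B) :
    covD D U ⁅X, Y⁆ = ⁅covD D U X, Y⁆ + ⁅X, covD D U Y⁆ := by
  rw [covD, bracket_leibniz, map_derivation_bracket, covD, covD, bracket_add_left,
    bracket_add_right]
  abel

theorem derivation_triple (U X Y Z : Matrix ι ι B) :
    D (triple X Y Z) =
      triple (covD D U X) Y Z + triple X (covD D U Y) Z + triple X Y (covD D U Z) := by
  simp only [triple]
  rw [derivation_ip_covD D U, covD_bracket, ip_add_right]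
  ring

/-- An evolutionary field commutes with `D` but moves the connection `U`; the extra bracket is the
source of all cubic terms below. -/
theorem map_covD (E : Derivation ℂ B B) (hE : ∀ f, E (D f) = D (E f)) (U X : Matrix ι ι B) :
    (covD D U X).map E = covD D U (X.map E) + ⁅U.map E, X⁆ := by
  have h : (X.map D).map E = (X.map E).map D := by
    ext i j
    exact hE _
  rw [covD, covD, Matrix.map_add _ (map_add E), map_derivation_bracket, h]
  abel

variable {D}

/-- Skew-symmetry of `c₁ ∇ + c₂ (ad e) ∇⁻¹ (ad e)`. -/
theorem pencil_skew {U e P₀ P₁ M₀ M₁ X₀ X₁ : Matrix ι ι B} {c₁ c₂ : ℂ}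
    (hX₀ : X₀ = c₁ • covD D U P₀ + c₂ • ⁅e, M₀⁆) (hX₁ : X₁ = c₁ • covD D U P₁ + c₂ • ⁅e, M₁⁆)
    (hM₀ : covD D U M₀ = -⁅e, P₀⁆) (hM₁ : covD D U M₁ = -⁅e, P₁⁆) :
    ip P₀ X₁ + ip P₁ X₀ = D (c₁ • ip P₀ P₁ + c₂ • ip M₀ M₁) := by
  rw [map_add, D.map_smul, D.map_smul, derivation_ip_covD D U, derivation_ip_covD D U, hM₀, hM₁, hX₀,
    hX₁]
  simp only [ip_add_right, ip_smul_right, ip_neg_left, ip_neg_right, ip_bracket_left]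
  rw [ip_comm P₁ (covD D U P₀), ip_comm M₀ ⁅e, P₁⁆, ip_bracket_left]
  algebra

theorem map_bracket_of_const {E : Derivation ℂ B B} {e : Matrix ι ι B} (he : e.map E = 0)
    (X : Matrix ι ι B) : ⁅e, X⁆.map E = ⁅e, X.map E⁆ := by
  rw [map_derivation_bracket, he]
  simp [Ring.lie_def]

/-- One term of the Jacobi identity of `c₁ ∇ + c₂ (ad e) ∇⁻¹ (ad e)`. -/
theorem pencil_jacobi_term {U e P₀ P₁ M₀ M₁ X₀ X₁ X₂ : Matrix ι ι B} {c₁ c₂ : ℂ}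
    {E₂ : Derivation ℂ B B} (hE : ∀ f, E₂ (D f) = D (E₂ f)) (hU : U.map E₂ = X₂)
    (he : e.map E₂ = 0)
    (hX₀ : X₀ = c₁ • covD D U P₀ + c₂ • ⁅e, M₀⁆) (hX₁ : X₁ = c₁ • covD D U P₁ + c₂ • ⁅e, M₁⁆)
    (hM₀ : covD D U M₀ = -⁅e, P₀⁆) (hM₁ : covD D U M₁ = -⁅e, P₁⁆) :
    E₂ (ip P₀ X₁) = ip (P₀.map E₂) X₁ - ip (P₁.map E₂) X₀ + c₁ • triple P₀ X₂ P₁ +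
      c₂ • triple M₀ X₂ M₁ + D (c₁ • ip P₀ (P₁.map E₂) + c₂ • ip M₀ (M₁.map E₂)) := by
  have hms : ∀ (c : ℂ) (X : Matrix ι ι B), (c • X).map E₂ = c • X.map E₂ := fun c X => by
    ext i j; simp
  -- The constraint `∇M₁ = -[e, P₁]` differentiated along `E₂`, with `e` constant.
  have h1 : covD D U (M₁.map E₂) + ⁅X₂, M₁⁆ = -⁅e, P₁.map E₂⁆ := by
    rw [← hU, ← map_covD D E₂ hE, hM₁, ← map_bracket_of_const he]
    ext i j; simp
  have h2 : X₁.map E₂ = c₁ • (covD D U (P₁.map E₂) + ⁅X₂, P₁⁆) + c₂ • ⁅e, M₁.map E₂⁆ := by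
    rw [hX₁, Matrix.map_add _ (map_add E₂), hms, hms, map_covD D E₂ hE, hU, map_bracket_of_const he]
  rw [map_add, D.map_smul, D.map_smul, derivation_ip E₂, h2, derivation_ip_covD D U,
    derivation_ip_covD D U M₀, eq_sub_of_add_eq h1, hM₀, hX₀]
  simp only [sub_eq_add_neg, triple, ip_add_right, ip_smul_right, ip_neg_left, ip_neg_right, ip_bracket_left]
  rw [ip_comm (P₁.map E₂) (covD D U P₀), ip_comm (P₁.map E₂) ⁅e, M₀⁆, ip_bracket_left]
  algebra

/-- The Jacobi identity of `c₁ ∇ + c₂ (ad e) ∇⁻¹ (ad e)`, for gradients `Pᵢ`. -/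
theorem pencil_jacobi {U e : Matrix ι ι B} {P M X : Fin 3 → Matrix ι ι B} {c₁ c₂ : ℂ}
    {E : Fin 3 → Derivation ℂ B B} (hE : ∀ i f, E i (D f) = D (E i f))
    (hU : ∀ i, U.map (E i) = X i) (he : ∀ i, e.map (E i) = 0)
    (hX : ∀ i, X i = c₁ • covD D U (P i) + c₂ • ⁅e, M i⁆)
    (hM : ∀ i, covD D U (M i) = -⁅e, P i⁆)
    (hP : ∀ i j k, ∃ η, ip ((P i).map (E j)) (X k) - ip ((P i).map (E k)) (X j) = D η) :
    ∃ η, E 2 (ip (P 0) (X 1)) + E 0 (ip (P 1) (X 2)) + E 1 (ip (P 2) (X 0)) = D η := by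
  -- In the cyclic sum the first-order terms regroup by gradient: each `P i` meets the two other
  -- fields once with each sign, which is the shape of `hP`.
  obtain ⟨a, ha⟩ := hP 0 2 1
  obtain ⟨b, hb⟩ := hP 1 0 2
  obtain ⟨c, hc⟩ := hP 2 1 0
  rw [pencil_jacobi_term (hE 2) (hU 2) (he 2) (hX 0) (hX 1) (hM 0) (hM 1),
    pencil_jacobi_term (hE 0) (hU 0) (he 0) (hX 1) (hX 2) (hM 1) (hM 2),
    pencil_jacobi_term (hE 1) (hU 1) (he 1) (hX 2) (hX 0) (hM 2) (hM 0)]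
  -- Expansion in `c₁, c₂`: the `c₁²` terms form `D` of a triple product, the `c₂²` terms cancel by
  -- `ad e`-invariance, and the mixed terms form a total derivative after `[e, P i]` is replaced by
  -- `-∇(M i)`.
  have key : c₁ • triple (P 0) (X 2) (P 1) + c₂ • triple (M 0) (X 2) (M 1) +
      (c₁ • triple (P 1) (X 0) (P 2) + c₂ • triple (M 1) (X 0) (M 2)) +
      (c₁ • triple (P 2) (X 1) (P 0) + c₂ • triple (M 2) (X 1) (M 0)) =
      D ((c₁ * c₁) • triple (P 0) (P 2) (P 1) + (c₁ * c₂) • (triple (M 0) (P 2) (M 1) +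
        triple (M 1) (P 0) (M 2) + triple (M 2) (P 1) (M 0))) := by
    simp only [map_add, D.map_smul, derivation_triple D U, hM, hX, triple_add_middle,
      triple_smul_middle, triple_neg_left, triple_neg_right]
    have i0 := triple_invariant e (P 0) (M 2) (P 1)
    have i1 := triple_invariant e (P 1) (M 0) (P 2)
    have i2 := triple_invariant e (P 2) (M 1) (P 0)
    have i3 := triple_invariant e (M 0) (M 2) (M 1)
    rw [triple_rotate ⁅e, P 0⁆, ← triple_rotate ⁅e, P 1⁆, add_right_comm, add_eq_zero_iff_neg_eq] at i0
    rw [triple_rotate ⁅e, P 1⁆, ← triple_rotate ⁅e, P 2⁆, add_right_comm, add_eq_zero_iff_neg_eq] at i1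
    rw [triple_rotate ⁅e, P 2⁆, ← triple_rotate ⁅e, P 0⁆, add_right_comm, add_eq_zero_iff_neg_eq] at i2
    rw [← triple_rotate (M 1) ⁅e, M 0⁆, triple_rotate (M 0) (M 2) ⁅e, M 1⁆, add_right_comm,
      add_eq_zero_iff_neg_eq] at i3
    rw [← i0, ← i1, ← i2, ← i3, ← triple_rotate (P 1) (covD D U (P 0)),
      triple_rotate (P 0) (P 2) (covD D U (P 1))]
    algebra
  generalize (c₁ * c₁) • triple (P 0) (P 2) (P 1) + (c₁ * c₂) • (triple (M 0) (P 2) (M 1) +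
    triple (M 1) (P 0) (M 2) + triple (M 2) (P 1) (M 0)) = k at key
  generalize c₁ • ip (P 0) ((P 1).map (E 2)) + c₂ • ip (M 0) ((M 1).map (E 2)) = z₀
  generalize c₁ • ip (P 1) ((P 2).map (E 0)) + c₂ • ip (M 1) ((M 2).map (E 0)) = z₁
  generalize c₁ • ip (P 2) ((P 0).map (E 1)) + c₂ • ip (M 2) ((M 0).map (E 1)) = z₂
  refine ⟨a + b + c + k + z₀ + z₁ + z₂, ?_⟩
  simp only [map_add]
  linear_combination ha + hb + hc + key

/-- One term of the closedness of the form `(ad e) ∇ (ad e)`. -/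
theorem symplectic_term {U e Y₁ Y₂ M₁ M₂ h₀ h₁ h₂ : Matrix ι ι B} {E₀ E₁ : Derivation ℂ B B}
    (hE : ∀ f, E₀ (D f) = D (E₀ f)) (hU : U.map E₀ = h₀) (he : e.map E₀ = 0)
    (h1 : h₁ = ⁅e, M₁⁆) (h2 : h₂ = ⁅e, M₂⁆) (hM₁ : covD D U M₁ = -⁅e, Y₁⁆)
    (hM₂ : covD D U M₂ = -⁅e, Y₂⁆) :
    E₀ (ip h₁ Y₂) - ip (h₁.map E₀ - h₀.map E₁) Y₂ =
      ip (h₀.map E₁) Y₂ - ip (h₂.map E₀) Y₁ + triple M₁ h₀ M₂ + D (ip M₁ (M₂.map E₀)) := by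
  have h3 : covD D U (M₂.map E₀) + ⁅h₀, M₂⁆ = -⁅e, Y₂.map E₀⁆ := by
    rw [← hU, ← map_covD D E₀ hE, hM₂, ← map_bracket_of_const he]
    ext i j; simp
  rw [derivation_ip, derivation_ip_covD D U, eq_sub_of_add_eq h3, hM₁, h2, map_bracket_of_const he,
    sub_eq_add_neg (h₁.map E₀), ip_add_left, ip_neg_left, triple, h1, ip_bracket_left, 
    ip_bracket_left e (M₂.map E₀), ip_comm (-⁅e, Y₁⁆), ip_neg_right, sub_eq_add_neg (-⁅e, _⁆),
    ip_add_right, ip_neg_right, ip_neg_right]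
  ring

/-- Closedness of the form `(ad e) ∇ (ad e)`. -/
theorem symplectic_closed {U e : Matrix ι ι B} {Y M h : Fin 3 → Matrix ι ι B}
    {E : Fin 3 → Derivation ℂ B B} (hE : ∀ i f, E i (D f) = D (E i f))
    (hU : ∀ i, U.map (E i) = h i) (he : ∀ i, e.map (E i) = 0) (hh : ∀ i, h i = ⁅e, M i⁆)
    (hM : ∀ i, covD D U (M i) = -⁅e, Y i⁆) :
    E 0 (ip (h 1) (Y 2)) - ip ((h 1).map (E 0) - (h 0).map (E 1)) (Y 2) +
      (E 1 (ip (h 2) (Y 0)) - ip ((h 2).map (E 1) - (h 1).map (E 2)) (Y 0)) +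
      (E 2 (ip (h 0) (Y 1)) - ip ((h 0).map (E 2) - (h 2).map (E 0)) (Y 1)) =
      D (ip (M 1) ((M 2).map (E 0)) + ip (M 2) ((M 0).map (E 1)) + ip (M 0) ((M 1).map (E 2))) := by
  rw [symplectic_term (hE 0) (hU 0) (he 0) (hh 1) (hh 2) (hM 1) (hM 2),
    symplectic_term (hE 1) (hU 1) (he 1) (hh 2) (hh 0) (hM 2) (hM 0),
    symplectic_term (hE 2) (hU 2) (he 2) (hh 0) (hh 1) (hM 0) (hM 1), map_add, map_add]
  -- The terms `ip ((h i).map (E j)) (Y k)` cancel in pairs under cyclic summation. As `h i = [e, M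
  -- i]`, the three cubic terms are the three summands of this invariance identity.
  have i := triple_invariant e (M 0) (M 2) (M 1)
  rw [← triple_rotate (M 1) ⁅e, M 0⁆, triple_rotate (M 0) (M 2) ⁅e, M 1⁆, ← hh, ← hh, ← hh] at i
  linear_combination i

end TraceForm

/-! ### Real coordinates and the pairing -/

section Coordinates

/-- The real coordinates, listed. -/
def Coord.equiv (m : ℕ) : Coord m ≃ Fin 3 ⊕ (Fin m ⊕ Fin m) ⊕ (Fin m ⊕ Fin m) where
  toFun
    | .im1 => .inl 0
    | .re2 => .inl 1
    | .im2 => .inl 2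
    | .reV1 k => .inr (.inl (.inl k))
    | .imV1 k => .inr (.inl (.inr k))
    | .reV2 k => .inr (.inr (.inl k))
    | .imV2 k => .inr (.inr (.inr k))
  invFun
    | .inl 0 => .im1
    | .inl 1 => .re2
    | .inl 2 => .im2
    | .inr (.inl (.inl k)) => .reV1 k
    | .inr (.inl (.inr k)) => .imV1 k
    | .inr (.inr (.inl k)) => .reV2 k
    | .inr (.inr (.inr k)) => .imV2 k
  left_inv a := by cases a <;> rfl
  right_inv a := by
    rcases a with a | (a | a) | (a | a)
    · fin_cases a <;> rfl
    all_goals rfl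

instance Coord.fintype (m : ℕ) : Fintype (Coord m) := Fintype.ofEquiv _ (Coord.equiv m).symm

theorem sum_coord {m : ℕ} {B : Type} [CommRing B] (f : Coord m → B) :
    ∑ α, f α = f .im1 + f .re2 + f .im2 + (∑ k, f (.reV1 k) + ∑ k, f (.imV1 k)) +
      (∑ k, f (.reV2 k) + ∑ k, f (.imV2 k)) := by
  rw [← Equiv.sum_comp (Coord.equiv m).symm f, Fintype.sum_sum_type, Fintype.sum_sum_type,
    Fintype.sum_sum_type, Fintype.sum_sum_type, Fin.sum_univ_three]
  rw [← add_assoc]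
  rfl

variable {B : Type} [CommRing B] [Algebra ℂ B] [StarRing B] [StarModule ℂ B] {m : ℕ}

/-- The covector with real components `a`. -/
noncomputable def ofCoord (a : Coord m → B) : Fld m B where
  s1 := (Complex.I / 2) • a .im1
  s2 := (1 / 2 : ℂ) • (a .re2 + Complex.I • a .im2)
  v1 := fun k => (1 / 2 : ℂ) • (a (.reV1 k) + Complex.I • a (.imV1 k))
  v2 := fun k => (1 / 2 : ℂ) • (a (.reV2 k) + Complex.I • a (.imV2 k))

theorem varDer_eq (K : Calc B) (u : Fld m B) (f : Density m B) :
    varDer K u f = ofCoord (euler K u f) := rfl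

theorem ofCoord_map (E : Derivation ℂ B B) (a : Coord m → B) :
    (ofCoord a).map E = ofCoord (fun α => E (a α)) := by
  simp [ofCoord, Fld.map]

theorem isImag_ofCoord {a : Coord m → B} (ha : ∀ α, star (a α) = a α) : (ofCoord a).IsImag := by
  unfold Fld.IsImag
  simp only [ofCoord, star_smul, ha]
  simp [neg_div]

theorem star_coord (u : Fld m B) (α : Coord m) : star (u.coord α) = u.coord α := by
  have hre : ∀ b : B, star (re b) = re b := fun b => by
    rw [re, star_half_smul, star_add, star_star, add_comm]
  have him : ∀ b : B, star (im b) = im b := fun b => by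
    rw [im, star_smul, star_sub, star_star]
    have : star (-Complex.I / 2) = Complex.I / 2 := by simp
    rw [this]
    module
  cases α <;> simp only [Fld.coord, hre, him]

theorem coord_map (E : Derivation ℂ B B) (hE : ∀ f, E (star f) = star (E f)) (u : Fld m B)
    (α : Coord m) : (u.map E).coord α = E (u.coord α) := by
  cases α <;> simp [Fld.coord, Fld.map, re, im, hE]

/-- The normalisation of `varDer` is designed for this: `x ȳ + y x̄` with `x = (a + ib)/2`, `a` and
`b` real, equals `a re y + b im y`. -/
theorem pair_ofCoord {a : Coord m → B} (ha : ∀ α, star (a α) = a α) (y : Fld m B) :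
    pair (ofCoord a) y = ∑ α, a α * y.coord α := by
  have hI : Complex.I * Complex.I = -1 := Complex.I_mul_I
  have key : ∀ x z b : B, star x = x → star z = z →
      sA ((1 / 2 : ℂ) • (x + Complex.I • z)) b = x * re b + z * im b := by
    intro x z b hx hz
    simp only [sA, re, im, star_half_smul, star_add, star_smul, hx, hz, RCLike.star_def,
      Complex.conj_I, map_div₀, map_one, map_ofNat]
    algebra
  have key1 : sA ((Complex.I / 2) • a .im1) y.s1 = a .im1 * im y.s1 := by
    have : star (Complex.I / 2) = -Complex.I / 2 := by simp
    simp only [sA, im, star_smul, ha, this]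
    algebra
  have keyv : ∀ (x z b : Fin m → B), (∀ k, star (x k) = x k) → (∀ k, star (z k) = z k) →
      vA (fun k => (1 / 2 : ℂ) • (x k + Complex.I • z k)) b =
        ∑ k, x k * re (b k) + ∑ k, z k * im (b k) := by
    intro x z b hx hz
    rw [← Finset.sum_add_distrib, vA, dotProduct, dotProduct, ← Finset.sum_add_distrib]
    exact Finset.sum_congr rfl fun k _ => key _ _ _ (hx k) (hz k)
  rw [pair, sum_coord]
  simp only [ofCoord]
  rw [key1, key _ _ _ (ha _) (ha _), keyv _ _ _ (fun _ => ha _) (fun _ => ha _),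
    keyv _ _ _ (fun _ => ha _) (fun _ => ha _)]
  simp only [Fld.coord]
  ring

end Coordinates

/-! ### Euler operator and self-adjointness of the linearised gradient -/

section Euler

variable {σ B : Type} [CommRing B]

/-- The commutator of two partial derivatives is again a derivation and kills every variable. -/
theorem pderiv_pderiv_comm (i j : σ) (f : MvPolynomial σ B) :
    MvPolynomial.pderiv i (MvPolynomial.pderiv j f) =
      MvPolynomial.pderiv j (MvPolynomial.pderiv i f) := by
  classical
  have h : ⁅(MvPolynomial.pderiv i : Derivation B (MvPolynomial σ B) (MvPolynomial σ B)),
      (MvPolynomial.pderiv j : Derivation B (MvPolynomial σ B) (MvPolynomial σ B))⁆ = 0 := by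
    refine MvPolynomial.derivation_ext fun k => ?_
    have hs : ∀ a b : σ, MvPolynomial.pderiv a
        ((Pi.single b 1 : σ → MvPolynomial σ B) k) = 0 := by
      intro a b
      rw [Pi.single_apply]
      split_ifs <;> simp
    rw [Derivation.commutator_apply, MvPolynomial.pderiv_X, MvPolynomial.pderiv_X, hs, hs, sub_zero]
    rfl
  have h2 := congrArg (fun d : Derivation B (MvPolynomial σ B) (MvPolynomial σ B) => d f) h
  simp only [Derivation.commutator_apply, Derivation.zero_apply] at h2
  exact sub_eq_zero.1 h2

variable [Algebra ℂ B]

theorem derivation_iterate_comm {D E : Derivation ℂ B B} (h : ∀ f, E (D f) = D (E f)) (k : ℕ)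
    (f : B) : E (D^[k] f) = D^[k] (E f) := by
  induction k generalizing f with
  | zero => rfl
  | succ k ih => rw [Function.iterate_succ_apply, ih, h, Function.iterate_succ_apply]

theorem iterate_zero_eq (D : Derivation ℂ B B) (k : ℕ) : D^[k] 0 = 0 :=
  Function.iterate_fixed (map_zero D) k

/-- Integration by parts. -/
theorem integrate_by_parts (D : Derivation ℂ B B) (k : ℕ) (x y : B) :
    (-1) ^ k * D^[k] x * y - x * D^[k] y ∈ LinearMap.range (D : B →ₗ[ℂ] B) := by
  induction k generalizing y with
  | zero => simp
  | succ k ih =>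
    have h1 : D ((-1) ^ k * D^[k] x * y) =
        (-1) ^ k * D^[k] x * D y - (-1) ^ (k + 1) * D (D^[k] x) * y := by
      have : D ((-1) ^ k) = 0 := by
        rcases neg_one_pow_eq_or B k with h | h <;> simp [h]
      rw [D.leibniz, D.leibniz, this]
      simp only [smul_eq_mul]
      ring
    have h2 := Submodule.sub_mem _ (ih (D y))
      (LinearMap.mem_range_self (D : B →ₗ[ℂ] B) ((-1) ^ k * D^[k] x * y))
    have h3 : (D : B →ₗ[ℂ] B) ((-1) ^ k * D^[k] x * y) = D ((-1) ^ k * D^[k] x * y) := rfl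
    rw [h3, h1] at h2
    rw [Function.iterate_succ_apply', Function.iterate_succ_apply]
    convert h2 using 1
    ring

/-- The chain rule for a derivation that vanishes on the coefficients of a polynomial. -/
theorem derivation_eval_map (E : Derivation ℂ B B) (A : Subring B) (hA : ∀ a ∈ A, E a = 0)
    {τ : Type} [Fintype τ] (x : τ × ℕ → B) (f : MvPolynomial (τ × ℕ) A) :
    ∃ N₀, ∀ N, N₀ ≤ N → E (MvPolynomial.eval x (MvPolynomial.map A.subtype f)) =
      ∑ α, ∑ k ∈ Finset.range N,
        MvPolynomial.eval x (MvPolynomial.pderiv (α, k) (MvPolynomial.map A.subtype f)) *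
          E (x (α, k)) := by
  classical
  induction f using MvPolynomial.induction_on with
  | C a => exact ⟨0, fun N _ => by simp [hA a a.2]⟩
  | add p q hp hq =>
    obtain ⟨N₁, h₁⟩ := hp
    obtain ⟨N₂, h₂⟩ := hq
    refine ⟨max N₁ N₂, fun N hN => ?_⟩
    rw [map_add, map_add, map_add, h₁ N (le_trans (le_max_left _ _) hN),
      h₂ N (le_trans (le_max_right _ _) hN), ← Finset.sum_add_distrib]
    refine Finset.sum_congr rfl fun α _ => ?_
    rw [← Finset.sum_add_distrib]
    refine Finset.sum_congr rfl fun k _ => ?_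
    rw [map_add, map_add, add_mul]
  | mul_X p n hp =>
    obtain ⟨N₁, h₁⟩ := hp
    -- The range excludes its bound, so `n.2 + 1` is what makes the order of the new variable occur
    -- in the sum.
    refine ⟨max N₁ (n.2 + 1), fun N hN => ?_⟩
    have hn : n.2 ∈ Finset.range N :=
      Finset.mem_range.2 (lt_of_lt_of_le (Nat.lt_succ_self _) (le_trans (le_max_right _ _) hN))
    have hX : ∑ α, ∑ k ∈ Finset.range N, MvPolynomial.eval x
        (MvPolynomial.pderiv (α, k) (MvPolynomial.X n : MvPolynomial (τ × ℕ) B)) * E (x (α, k)) =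
        E (x n) := by
      rw [Finset.sum_eq_single n.1, Finset.sum_eq_single n.2]
      · simp
      · intro k _ hk
        rw [MvPolynomial.pderiv_X_of_ne (fun h => hk (by rw [h])), map_zero, zero_mul]
      · exact fun h => absurd hn h
      · intro α _ hα
        refine Finset.sum_eq_zero fun k _ => ?_
        rw [MvPolynomial.pderiv_X_of_ne (fun h => hα (by rw [h])), map_zero, zero_mul]
      · exact fun h => absurd (Finset.mem_univ _) h
    rw [map_mul, MvPolynomial.map_X, map_mul, MvPolynomial.eval_X, E.leibniz,
      h₁ N (le_trans (le_max_left _ _) hN), ← hX]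
    simp only [smul_eq_mul, Finset.mul_sum, ← Finset.sum_add_distrib]
    refine Finset.sum_congr rfl fun α _ => Finset.sum_congr rfl fun k _ => ?_
    rw [Derivation.leibniz, map_add, smul_eq_mul, smul_eq_mul, map_mul, map_mul,
      MvPolynomial.eval_X]
    ring

variable [StarRing B] [StarModule ℂ B] {m : ℕ}

/-- All jet variables of `f` have order less than `N`. -/
def OrderLT (f : Density m B) (N : ℕ) : Prop := ∀ p : Coord m × ℕ, N ≤ p.2 →
  MvPolynomial.pderiv p f = 0

theorem exists_orderLT (f : Density m B) : ∃ N, OrderLT f N := by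
  refine ⟨f.vars.sup Prod.snd + 1, fun p hp => ?_⟩
  refine MvPolynomial.pderiv_eq_zero_of_notMem_vars fun h => ?_
  have : p.2 ≤ f.vars.sup Prod.snd := Finset.le_sup (f := Prod.snd) h
  omega

theorem OrderLT.pderiv {f : Density m B} {N : ℕ} (h : OrderLT f N) (q : Coord m × ℕ) :
    OrderLT (MvPolynomial.pderiv q f) N := fun p hp => by
  rw [pderiv_pderiv_comm, h p hp, map_zero]

/-- The elements killed by `E` form a subring. Viewing `f` as a polynomial over it makes the chain
rule an induction in which `E` never meets a nonconstant coefficient. -/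
theorem Kills.exists_map {E : Derivation ℂ B B} {f : Density m B} (h : Kills E f) :
    ∃ (A : Subring B) (g : MvPolynomial (Coord m × ℕ) A), (∀ a ∈ A, E a = 0) ∧
      MvPolynomial.map A.subtype g = f := by
  let A : Subring B :=
    { carrier := {a | E a = 0}
      mul_mem' := fun {a b} (ha : E a = 0) (hb : E b = 0) => by
        change E (a * b) = 0
        rw [E.leibniz, ha, hb, smul_zero, smul_zero, add_zero]
      one_mem' := by change E 1 = 0; simp
      add_mem' := fun {a b} (ha : E a = 0) (hb : E b = 0) => by
        change E (a + b) = 0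
        rw [map_add, ha, hb, add_zero]
      zero_mem' := by change E 0 = 0; simp
      neg_mem' := fun {a} (ha : E a = 0) => by
        change E (-a) = 0
        rw [map_neg, ha, neg_zero] }
  have hm : f ∈ (MvPolynomial.map (σ := Coord m × ℕ) A.subtype).range := by
    change f ∈ Set.range (MvPolynomial.map (σ := Coord m × ℕ) A.subtype)
    rw [MvPolynomial.mem_range_map_iff_coeffs_subset]
    intro b hb
    obtain ⟨s, _, rfl⟩ := MvPolynomial.mem_coeffs_iff.1 hb
    exact ⟨⟨_, h s⟩, rfl⟩
  obtain ⟨g, hg⟩ := hm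
  exact ⟨A, g, fun a ha => ha, hg⟩

theorem Kills.pderiv {E : Derivation ℂ B B} {f : Density m B} (h : Kills E f) (p : Coord m × ℕ) :
    Kills E (MvPolynomial.pderiv p f) := by
  obtain ⟨A, g, hA, rfl⟩ := h.exists_map
  intro s
  rw [MvPolynomial.pderiv_map, MvPolynomial.coeff_map]
  exact hA _ (Subtype.property _)

theorem Kills.derivation_evalJet {K : Calc B} {u : Fld m B} {E : Derivation ℂ B B} {f : Density m B}
    (h : Kills E f) (hE : IsEvol K E) {N : ℕ} (hN : OrderLT f N) :
    E (evalJet K u f) = ∑ α, ∑ k ∈ Finset.range N,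
      evalJet K u (MvPolynomial.pderiv (α, k) f) * K.D^[k] (E (u.coord α)) := by
  obtain ⟨A, g, hA, rfl⟩ := h.exists_map
  obtain ⟨N₀, h₀⟩ := derivation_eval_map E A hA
    (fun p : Coord m × ℕ => (⇑K.D)^[p.2] (u.coord p.1)) g
  -- The chain rule is applied at a bound above both; terms of order at least `N` then drop out by
  -- `hN`.
  rw [evalJet, h₀ (max N₀ N) (le_max_left _ _)]
  refine Finset.sum_congr rfl fun α _ => ?_
  rw [Finset.sum_subset (Finset.range_mono (le_max_right N₀ N))]
  · refine Finset.sum_congr rfl fun k _ => ?_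
    rw [derivation_iterate_comm hE.comm]
    rfl
  · intro k _ hk
    rw [hN (α, k) (by simpa using hk), evalJet, map_zero, zero_mul]

/-- A range of summation independent of `α` and of the occurring variables, as needed for exchanging
double sums; terms in only one of the two index sets vanish. -/
theorem euler_eq_sum_range (K : Calc B) (u : Fld m B) {f : Density m B} {N : ℕ} (hN : OrderLT f N)
    (α : Coord m) : euler K u f α = ∑ k ∈ Finset.range N,
      (-1) ^ k * (⇑K.D)^[k] (evalJet K u (MvPolynomial.pderiv (α, k) f)) := by
  classical
  have h0 : ∀ k, MvPolynomial.pderiv (α, k) f = 0 →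
      (-1) ^ k * (⇑K.D)^[k] (evalJet K u (MvPolynomial.pderiv (α, k) f)) = 0 := fun k hk => by
    rw [hk, evalJet, map_zero, iterate_zero_eq, mul_zero]
  rw [euler, Finset.sum_subset Finset.subset_union_left (s₂ := _ ∪ Finset.range N),
    ← Finset.sum_subset Finset.subset_union_right (s₁ := Finset.range N)]
  · exact fun k _ hk => h0 k (hN (α, k) (by simpa using hk))
  · intro k _ hk
    refine h0 k (MvPolynomial.pderiv_eq_zero_of_notMem_vars fun h => hk ?_)
    exact Finset.mem_image.2 ⟨_, h, rfl⟩

theorem star_evalJet (K : Calc B) (u : Fld m B) {f : Density m B} (hf : IsRealDensity f) :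
    star (evalJet K u f) = evalJet K u f := by
  rw [evalJet, MvPolynomial.eval_eq, star_sum]
  refine Finset.sum_congr rfl fun s _ => ?_
  have h : ∀ k (b : B), star b = b → star ((⇑K.D)^[k] b) = (⇑K.D)^[k] b := by
    intro k
    induction k with
    | zero => exact fun b hb => hb
    | succ k ih =>
      intro b hb
      rw [Function.iterate_succ_apply]
      exact ih _ (by rw [← K.D_star, hb])
  rw [star_mul', hf s, star_prod]
  congr 1
  refine Finset.prod_congr rfl fun p _ => ?_
  rw [star_pow, h _ _ (star_coord u _)]

theorem IsRealDensity.pderiv {f : Density m B} (hf : IsRealDensity f) (p : Coord m × ℕ) :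
    IsRealDensity (MvPolynomial.pderiv p f) := by
  have hm : MvPolynomial.map (starRingEnd B) f = f := by
    ext s
    rw [MvPolynomial.coeff_map]
    exact hf s
  intro s
  have h := congrArg (MvPolynomial.coeff s) (MvPolynomial.pderiv_map (φ := starRingEnd B) (f := f)
    (i := p))
  rw [hm, MvPolynomial.coeff_map] at h
  exact h.symm

theorem star_euler (K : Calc B) (u : Fld m B) {f : Density m B} (hf : IsRealDensity f)
    (α : Coord m) : star (euler K u f α) = euler K u f α := by
  rw [euler, star_sum]
  refine Finset.sum_congr rfl fun k _ => ?_
  have h : ∀ k (b : B), star b = b → star ((⇑K.D)^[k] b) = (⇑K.D)^[k] b := by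
    intro k
    induction k with
    | zero => exact fun b hb => hb
    | succ k ih =>
      intro b hb
      rw [Function.iterate_succ_apply]
      exact ih _ (by rw [← K.D_star, hb])
  rw [star_mul', star_pow, star_neg, star_one, h _ _ (star_evalJet K u (hf.pderiv _))]

theorem sum_swap_pairs {τ : Type} [Fintype τ] (s : Finset ℕ) (G : τ → ℕ → τ → ℕ → B) :
    ∑ α, ∑ k ∈ s, ∑ β, ∑ l ∈ s, G α k β l = ∑ α, ∑ k ∈ s, ∑ β, ∑ l ∈ s, G β l α k := by
  calc ∑ α, ∑ k ∈ s, ∑ β, ∑ l ∈ s, G α k β l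
      = ∑ α, ∑ β, ∑ k ∈ s, ∑ l ∈ s, G α k β l := Finset.sum_congr rfl fun α _ => Finset.sum_comm
    _ = ∑ β, ∑ α, ∑ k ∈ s, ∑ l ∈ s, G α k β l := Finset.sum_comm
    _ = ∑ β, ∑ α, ∑ l ∈ s, ∑ k ∈ s, G α k β l :=
        Finset.sum_congr rfl fun β _ => Finset.sum_congr rfl fun α _ => Finset.sum_comm
    _ = ∑ β, ∑ l ∈ s, ∑ α, ∑ k ∈ s, G α k β l := Finset.sum_congr rfl fun β _ => Finset.sum_comm

/-- The variational derivative has a self-adjoint linearisation. -/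
theorem helmholtz (K : Calc B) (u : Fld m B) {f : Density m B}
    (hf : IsRealDensity f) {E E' : Derivation ℂ B B} (hE : IsEvol K E) (hE' : IsEvol K E')
    (hk : Kills E f) (hk' : Kills E' f) :
    IsTotal K (pair ((varDer K u f).map E) (u.map E') - pair ((varDer K u f).map E') (u.map E)) := by
  obtain ⟨N, hN⟩ := exists_orderLT f
  have hreal : ∀ (E : Derivation ℂ B B), (∀ f, E (star f) = star (E f)) →
      ∀ α, star (E (euler K u f α)) = E (euler K u f α) := fun E hE α => by
    rw [← hE, star_euler K u hf]
  -- Integrating by parts turns the linearised gradient into the second variation of `f`, a bilinear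
  -- form in the two fields.
  have key : ∀ (E E' : Derivation ℂ B B), IsEvol K E → IsEvol K E' → Kills E f →
      pair ((varDer K u f).map E) (u.map E') -
        ∑ α, ∑ k ∈ Finset.range N, ∑ β, ∑ l ∈ Finset.range N,
          evalJet K u (MvPolynomial.pderiv (β, l) (MvPolynomial.pderiv (α, k) f)) *
            K.D^[l] (E (u.coord β)) * K.D^[k] (E' (u.coord α)) ∈
        LinearMap.range (K.D : B →ₗ[ℂ] B) := by
    intro E E' hE hE' hk
    rw [varDer_eq, ofCoord_map, pair_ofCoord (hreal E hE.real),
      ← Finset.sum_sub_distrib]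
    refine Submodule.sum_mem _ fun α _ => ?_
    rw [euler_eq_sum_range K u hN, coord_map E' hE'.real, map_sum, Finset.sum_mul,
      ← Finset.sum_sub_distrib]
    refine Submodule.sum_mem _ fun k _ => ?_
    have h1 : E ((-1) ^ k * (⇑K.D)^[k] (evalJet K u (MvPolynomial.pderiv (α, k) f))) =
        (-1) ^ k * (⇑K.D)^[k] (E (evalJet K u (MvPolynomial.pderiv (α, k) f))) := by
      have : E ((-1) ^ k) = 0 := by
        rcases neg_one_pow_eq_or B k with h | h <;> simp [h]
      rw [E.leibniz, this, derivation_iterate_comm hE.comm, smul_zero, add_zero, smul_eq_mul]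
    have h2 := integrate_by_parts K.D k (E (evalJet K u (MvPolynomial.pderiv (α, k) f)))
      (E' (u.coord α))
    rw [h1]
    convert h2 using 2
    rw [(hk.pderiv (α, k)).derivation_evalJet hE (hN.pderiv _), Finset.sum_mul]
    refine Finset.sum_congr rfl fun β _ => ?_
    rw [Finset.sum_mul]
  have h1 := key E E' hE hE' hk
  have h2 := key E' E hE' hE hk'
  -- The second variation is symmetric because partial derivatives commute.
  have h3 : ∑ α, ∑ k ∈ Finset.range N, ∑ β, ∑ l ∈ Finset.range N,
      evalJet K u (MvPolynomial.pderiv (β, l) (MvPolynomial.pderiv (α, k) f)) *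
        K.D^[l] (E' (u.coord β)) * K.D^[k] (E (u.coord α)) =
      ∑ α, ∑ k ∈ Finset.range N, ∑ β, ∑ l ∈ Finset.range N,
      evalJet K u (MvPolynomial.pderiv (β, l) (MvPolynomial.pderiv (α, k) f)) *
        K.D^[l] (E (u.coord β)) * K.D^[k] (E' (u.coord α)) := by
    rw [sum_swap_pairs]
    refine Finset.sum_congr rfl fun α _ => Finset.sum_congr rfl fun k _ =>
      Finset.sum_congr rfl fun β _ => Finset.sum_congr rfl fun l _ => ?_
    rw [pderiv_pderiv_comm]
    ring
  rw [h3] at h2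
  obtain ⟨η, hη⟩ := Submodule.sub_mem _ h1 h2
  refine ⟨η, ?_⟩
  rw [sub_sub_sub_cancel_right] at hη
  exact hη.symm

end Euler

/-! ### The trace form on `𝔥` -/

section TraceOnBlocks

variable {B : Type} [CommRing B] [StarRing B] {m : ℕ}

theorem trace_fromBlocks {κ ν : Type} [Fintype κ] [Fintype ν] (X : Matrix κ κ B)
    (Y : Matrix κ ν B) (Z : Matrix ν κ B) (W : Matrix ν ν B) :
    (Matrix.fromBlocks X Y Z W).trace = X.trace + W.trace := by
  simp [Matrix.trace, Fintype.sum_sum_type]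

theorem trace_blk (a b c d : B) (r s p q : Fin m → B) (N : Matrix (Fin m) (Fin m) B) :
    (blk a b c d r s p q N).trace = a + d + N.trace := by
  rw [blk, trace_fromBlocks, Matrix.trace_fin_two]
  rfl

theorem trace_quat (X Y : Matrix (Idx m) (Idx m) B) :
    (quat X Y).trace = X.trace + star X.trace := by
  rw [quat, trace_fromBlocks]
  simp [Matrix.trace, star_sum]

theorem ip_hPerp_hPar (x : Fld m B) (p : ParFld m B) : ip (hPar p) (hPerp x) = 0 := by
  rw [ip, hPerp_eq, hPar_eq, quat_mul, trace_quat]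
  simp only [blk_map_star, blk_mul, blk_sub, trace_blk]
  simp

variable [Algebra ℂ B] [StarModule ℂ B]

/-- Transfers the abstract identities to `pair`; with `ip_hPerp_hPar`, the `𝔥_∥`-correction of a
lift is invisible when paired with `𝔥_⊥`. -/
theorem ip_hPerp_hPerp {x : Fld m B} (hx : x.IsImag) (y : Fld m B) :
    ip (hPerp x) (hPerp y) = -((2 : ℂ) • pair x y) := by
  unfold Fld.IsImag at hx
  rw [ip, hPerp_eq, hPerp_eq, quat_mul, trace_quat]
  simp only [blk_map_star, blk_mul, blk_sub, trace_blk]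
  simp [hx, pair, sA, vA, star_dotProduct_star_right, Matrix.trace_vecMulVec]
  simp only [dotProduct_comm (star _)]
  simp [star_dotProduct_star_right]
  algebra

end TraceOnBlocks

/-! ### Lifts of `ℋ`, `𝒥` and their pencil -/

section Structure

variable {B : Type} [CommRing B] [Algebra ℂ B] [StarRing B] [StarModule ℂ B] {m : ℕ}

theorem hPerp_smul (c : ℝ) (x : Fld m B) : hPerp (x.smul c) = (c : ℂ) • hPerp x := by
  have h : ∀ X Y : Matrix (Idx m) (Idx m) B, (c : ℂ) • quat X Y = quat ((c : ℂ) • X) ((c : ℂ) • Y) := by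
    intro X Y
    unfold quat
    rw [Matrix.fromBlocks_smul, Matrix.fromBlocks_inj]
    refine ⟨rfl, rfl, ?_, ?_⟩ <;> ext i j <;> simp [-Complex.coe_smul]
  have h2 : ∀ (a b c' d : B) (r s p q : Fin m → B) (N : Matrix (Fin m) (Fin m) B),
      (c : ℂ) • blk a b c' d r s p q N = blk ((c : ℂ) • a) ((c : ℂ) • b) ((c : ℂ) • c') ((c : ℂ) • d)
        ((c : ℂ) • r) ((c : ℂ) • s) ((c : ℂ) • p) ((c : ℂ) • q) ((c : ℂ) • N) := by
    intro a b c' d r s p q N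
    unfold blk
    rw [Matrix.fromBlocks_smul, Matrix.fromBlocks_inj]
    refine ⟨by simp [-Complex.coe_smul], by simp [-Complex.coe_smul], ?_, rfl⟩
    ext i j
    fin_cases j <;> rfl
  rw [hPerp_eq, hPerp_eq, h, h2, h2]
  simp [Fld.smul, -Complex.coe_smul, star_smul]

/-- The nonlocal part is forgotten on purpose: the Hamiltonian property uses only that some
`𝔥_∥`-correction puts `∇` of the lift into `𝔥_⊥`. -/
theorem relH.exists_lift {K : Calc B} {u P X : Fld m B} (hu : u.IsImag) (h : relH m B K u P X) :
    ∃ p : ParFld m B, hPerp X = covD K.D (hPerp u) (hPerp P + hPar p) := by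
  obtain ⟨hP, hs, rfl⟩ := h
  refine ⟨(srcH u P).map K.Dinv, ?_⟩
  have := nabla_hPerp_add_hPar K u P _ hu hP ((srcH_isAlg u P).map K.isRealAdd_Dinv)
  rw [hs, sub_self, add_zero, ← opH_eq] at this
  exact this.symm

/-- The element `(1/2)` of `𝔪_∥`. -/
noncomputable def eHalf (m : ℕ) (B : Type) [CommRing B] [StarRing B] [Algebra ℂ B] : Mat m B :=
  mPar m (algebraMap ℂ B ((1 / 2 : ℝ) : ℂ))

theorem eHalf_map (E : Derivation ℂ B B) (hE : ∀ f, E (star f) = star (E f)) :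
    (eHalf m B).map E = 0 := by
  rw [eHalf, IsRealAdd.mPar_map ⟨map_add E, hE⟩, Derivation.map_algebraMap]
  simp [mPar_eq, zero_eq_quat, ← zero_eq_blk]

theorem eHalf_bracket_hPar (p : ParFld m B) : ⁅eHalf m B, hPar p⁆ = 0 :=
  bracket_mPar_hPar _ (star_algebraMap_ofReal _) p

theorem eHalf_bracket_hPerp_inj {x y : Fld m B} :
    ⁅eHalf m B, hPerp x⁆ = ⁅eHalf m B, hPerp y⁆ ↔ x = y := by
  constructor
  · intro h
    have h0 : mPar m (0 : B) = 0 := by simp [mPar_eq, zero_eq_quat, ← zero_eq_blk]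
    have h1 := (mPar_add_bracket_eq_zero_iff (1 / 2) (by norm_num) (0 : B) (x.sub y)).1 (by
      rw [h0, zero_add, hPerp_sub, bracket_sub_right]
      exact sub_eq_zero.2 h)
    simpa only [Fld.ext_iff, Fld.sub, sub_eq_zero] using h1.2
  · rintro rfl
    rfl

/-- A potential of `h` in `𝔪` whose covariant derivative is `𝒥 h`. -/
noncomputable def liftJ (K : Calc B) (u h : Fld m B) : Mat m B :=
  mPar m (K.Dinv (pair u h)) + mPerp (adInv (1 / 2) h)

theorem star_Dinv_pair (K : Calc B) (u h : Fld m B) :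
    star (K.Dinv (pair u h)) = K.Dinv (pair u h) := by
  rw [← K.Dinv_star, pair_real]

theorem eHalf_bracket_liftJ (K : Calc B) (u h : Fld m B) :
    ⁅eHalf m B, liftJ K u h⁆ = hPerp h := by
  rw [eHalf, liftJ, bracket_add_right, bracket_mPar_mPar _ _ (star_algebraMap_ofReal _)
    (star_Dinv_pair K u h), zero_add]
  exact ((bracket_mPar_mPerp_eq_iff (1 / 2) (by norm_num) h _).2 rfl).symm

/-- The choice `r = 1/2` makes both `1/(2r)` and `1/(4r²)` equal to 1, so `𝒥` appears without a
factor. -/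
theorem nabla_liftJ {K : Calc B} {u h : Fld m B} (hu : u.IsImag) (hh : h.IsImag)
    (hs : K.D (K.Dinv (pair u h)) = pair u h) :
    nabla K u (liftJ K u h) = -⁅eHalf m B, hPerp (opJ K u h)⁆ := by
  have h2 := nabla_mPar_add_mPerp K u h _ hu hh (star_Dinv_pair K u h) (1 / 2) (by norm_num)
  have h1 : (opJk K u (K.Dinv (pair u h)) h).smul (1 / (4 * (1 / 2) ^ 2)) = opJ K u h := by
    rw [opJ_eq]
    norm_num [Fld.smul]
  have h3 : (1 / (2 * ((1 / 2 : ℝ) : ℂ))) • K.Dinv (pair u h) = K.Dinv (pair u h) := by norm_num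
  have h0 : mPar m (0 : B) = 0 := by simp [mPar_eq, zero_eq_quat, ← zero_eq_blk]
  rw [hs, sub_self, smul_zero, h1, h3, h0, zero_sub] at h2
  exact h2

theorem relJ.exists_lift {K : Calc B} {u h Y : Fld m B} (hu : u.IsImag) (hJ : relJ m B K u h Y) :
    ∃ M : Mat m B, hPerp h = ⁅eHalf m B, M⁆ ∧
      covD K.D (hPerp u) M = -⁅eHalf m B, hPerp Y⁆ := by
  obtain ⟨hh, hs, rfl⟩ := hJ
  exact ⟨liftJ K u h, (eHalf_bracket_liftJ K u h).symm, nabla_liftJ hu hh hs⟩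

/-- Puts the pencil in the form required by `pencil_skew` and `pencil_jacobi`. One `p` serves both
equations because `e` commutes with `𝔥_∥`. -/
theorem addInv.exists_lift {c₁ c₂ : ℝ} {K : Calc B} {u P X : Fld m B} (hu : u.IsImag)
    (h : addInv c₁ c₂ (relH m) (relJ m) B K u P X) :
    ∃ (p : ParFld m B) (M : Mat m B),
      hPerp X = (c₁ : ℂ) • covD K.D (hPerp u) (hPerp P + hPar p) +
        (c₂ : ℂ) • ⁅if c₂ = 0 then 0 else eHalf m B, M⁆ ∧
      covD K.D (hPerp u) M = -⁅if c₂ = 0 then 0 else eHalf m B, hPerp P + hPar p⁆ := by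
  obtain ⟨Y, W, h1, h2, rfl⟩ := h
  have hp : ∃ p : ParFld m B, (c₁ : ℂ) • hPerp Y =
      (c₁ : ℂ) • covD K.D (hPerp u) (hPerp P + hPar p) := by
    -- For `c₁ = 0` nothing is known about `ℋ`, but the term vanishes and any correction will do.
    by_cases hc : c₁ = 0
    · exact ⟨⟨0, 0, 0, 0⟩, by simp [hc]⟩
    · obtain ⟨p, hp⟩ := (h1 hc).exists_lift hu
      exact ⟨p, by rw [hp]⟩
  obtain ⟨p, hp⟩ := hp
  rw [hPerp_add, hPerp_smul, hPerp_smul, hp]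
  -- For `c₂ = 0` no `M` is available; replacing `e` by 0 lets `M = 0` satisfy the constraint.
  by_cases hc : c₂ = 0
  · refine ⟨p, 0, ?_, ?_⟩
    · simp [hc]
    · simp [hc, covD, Ring.lie_def]
  · obtain ⟨M, hM, hM'⟩ := (h2 hc).exists_lift hu
    refine ⟨p, M, ?_, ?_⟩
    · rw [if_neg hc, ← hM]
    · rw [if_neg hc, bracket_add_right, eHalf_bracket_hPar, add_zero, hM']

theorem IsTotal.of_neg_two_smul {K : Calc B} {b η : B} (hη : -((2 : ℂ) • b) = K.D η) :
    IsTotal K b := by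
  refine ⟨(-1 / 2 : ℂ) • η, ?_⟩
  rw [K.D.map_smul, ← hη]
  module

theorem isImag_varDer (K : Calc B) (u : Fld m B) {f : Density m B} (hf : IsRealDensity f) :
    (varDer K u f).IsImag := by
  rw [varDer_eq]
  exact isImag_ofCoord (star_euler K u hf)

end Structure

/-- Compatibility: the whole pencil is handled by the abstract identities, the factor -2 between
`ip` and `pair` being divided out at the end. -/
theorem isCosymplectic_addInv (m : ℕ) (c₁ c₂ : ℝ) :
    IsCosymplectic (addInv c₁ c₂ (relH m) (relJ m)) where
  skew := by
    intro B _ _ _ _ K u hu F G hF hG X Y hX hY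
    obtain ⟨p, M, h1, h2⟩ := hX.exists_lift hu
    obtain ⟨q, N, h3, h4⟩ := hY.exists_lift hu
    have h := pencil_skew h1 h3 h2 h4
    rw [ip_add_left, ip_add_left, ip_hPerp_hPar, ip_hPerp_hPar, add_zero, add_zero,
      ip_hPerp_hPerp (isImag_varDer K u hF), ip_hPerp_hPerp (isImag_varDer K u hG)] at h
    refine IsTotal.of_neg_two_smul (Eq.trans ?_ h)
    module
  jacobi := by
    intro B _ _ _ _ K u hu F hF E hE hK hO
    choose p M h1 h2 using fun i => (hO i).exists_lift hu
    have hreal : ∀ i, IsRealAdd (E i : B → B) := fun i => ⟨map_add (E i), (hE i).real⟩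
    have hip : ∀ i (Z : Fld m B), ip (hPerp (varDer K u (F i)) + hPar (p i)) (hPerp Z) =
        -((2 : ℂ) • pair (varDer K u (F i)) Z) := fun i Z => by
      rw [ip_add_left, ip_hPerp_hPar, add_zero, ip_hPerp_hPerp (isImag_varDer K u (hF i))]
    have hip' : ∀ i j (Z : Fld m B), ip ((hPerp (varDer K u (F i)) + hPar (p i)).map (E j))
        (hPerp Z) = -((2 : ℂ) • pair ((varDer K u (F i)).map (E j)) Z) := fun i j Z => by
      rw [Matrix.map_add _ (map_add (E j)), (hreal j).hPerp_map, (hreal j).hPar_map, ip_add_left,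
        ip_hPerp_hPar, add_zero,
        ip_hPerp_hPerp ((hreal j).isImag_map (isImag_varDer K u (hF i)))]
    obtain ⟨η, hη⟩ := pencil_jacobi (D := K.D) (E := E) (U := hPerp u)
      (e := if c₂ = 0 then 0 else eHalf m B) (X := fun i => hPerp (u.map (E i)))
      (P := fun i => hPerp (varDer K u (F i)) + hPar (p i)) (M := M)
      (fun i => (hE i).comm) (fun i => (hreal i).hPerp_map u)
      (fun i => by
        split_ifs
        · ext; simp
        · exact eHalf_map _ (hE i).real) h1 h2
      -- Pairing with `𝔥_⊥` removes the `𝔥_∥`-correction, so the condition on the lifts reduces to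
      -- `helmholtz` for the gradients themselves.
      (fun i j k => by
        obtain ⟨η, hη⟩ := helmholtz K u (hF i) (hE j) (hE k) (hK j i) (hK k i)
        refine ⟨(-2 : ℂ) • η, ?_⟩
        rw [hip', hip', K.D.map_smul, ← hη]
        module)
    refine IsTotal.of_neg_two_smul (Eq.trans ?_ hη)
    simp only [hip, map_neg, (E _).map_smul]
    module

theorem isCosymplectic_relH (m : ℕ) : IsCosymplectic (relH m) := by
  have himp : ∀ (B : Type) [CommRing B] [Algebra ℂ B] [StarRing B] [StarModule ℂ B] (K : Calc B)
      (u P X : Fld m B), relH m B K u P X → addInv 1 0 (relH m) (relJ m) B K u P X := by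
    intro B _ _ _ _ K u P X h
    -- `ℋ` is the member `c₁ = 1`, `c₂ = 0` of the pencil; the second witness is arbitrary, its
    -- coefficient being 0.
    refine ⟨X, X, fun _ => h, fun h => absurd rfl h, ?_⟩
    ext <;> simp [Fld.add, Fld.smul]
  have hc := isCosymplectic_addInv m 1 0
  exact
    { skew := fun B _ _ _ _ K u hu F G hF hG X Y hX hY =>
        hc.skew B K u hu F G hF hG X Y (himp B K u _ _ hX) (himp B K u _ _ hY)
      jacobi := fun B _ _ _ _ K u hu F hF E hE hK hO =>
        hc.jacobi B K u hu F hF E hE hK fun i => himp B K u _ _ (hO i) }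

theorem isSymplectic_relJ (m : ℕ) : IsSymplectic (relJ m) where
  skew := by
    intro B _ _ _ _ K u hu h₁ h₂ Y₁ Y₂ hY₁ hY₂
    obtain ⟨M, h1, h2⟩ := hY₁.exists_lift hu
    obtain ⟨N, h3, h4⟩ := hY₂.exists_lift hu
    refine IsTotal.of_neg_two_smul (η := ip M N) ?_
    rw [derivation_ip_covD K.D (hPerp u), h2, h4, ip_comm, ip_neg_right, ip_neg_right,
      ← neg_eq_iff_eq_neg.2 (ip_bracket_left (eHalf m B) N (hPerp Y₁)),
      ← neg_eq_iff_eq_neg.2 (ip_bracket_left (eHalf m B) M (hPerp Y₂)), ← h1, ← h3,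
      ip_hPerp_hPerp hY₁.1, ip_hPerp_hPerp hY₂.1]
    module
  closed := by
    intro B _ _ _ _ K u hu E hE Y hY
    have hreal : ∀ i, IsRealAdd (E i : B → B) := fun i => ⟨map_add (E i), (hE i).real⟩
    choose M h1 h2 using fun i => (hY i).exists_lift hu
    have h := symplectic_closed (D := K.D) (E := E) (U := hPerp u) (e := eHalf m B)
      (h := fun i => hPerp (u.map (E i))) (M := M) (Y := fun i => hPerp (Y i))
      (fun i => (hE i).comm) (fun i => (hreal i).hPerp_map u) (fun i => eHalf_map _ (hE i).real)
      h1 h2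
    -- The characteristic of the commutator of two evolutionary fields.
    have hc : ∀ i j, (hPerp (u.map (E j))).map (E i) - (hPerp (u.map (E i))).map (E j) =
        hPerp (u.map (⁅E i, E j⁆ : Derivation ℂ B B)) := by
      intro i j
      rw [(hreal i).hPerp_map, (hreal j).hPerp_map, ← hPerp_sub, hPerp_inj]
      rfl
    have hci : ∀ i j, (u.map (⁅E i, E j⁆ : Derivation ℂ B B)).IsImag := fun i j =>
      IsRealAdd.isImag_map ⟨map_add _, fun f => by
        rw [Derivation.commutator_apply, Derivation.commutator_apply, (hE j).real, (hE i).real,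
          (hE i).real, (hE j).real, star_sub]⟩ hu
    simp only [hc] at h
    rw [ip_hPerp_hPerp (hci _ _), ip_hPerp_hPerp (hci _ _), ip_hPerp_hPerp (hci _ _),
      ip_hPerp_hPerp (hY 0).1, ip_hPerp_hPerp (hY 1).1, ip_hPerp_hPerp (hY 2).1] at h
    refine IsTotal.of_neg_two_smul (Eq.trans ?_ h)
    simp only [map_neg, (E _).map_smul]
    module

/-! ### Conjugation by `Sp(1) × Sp(n-1)` in components -/

section Conjugation

variable {B : Type} [CommRing B] [StarRing B] {m : ℕ}

/-- The conjugate `g h gᴴ` of `h ∈ 𝔥_⊥`, in components. -/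
def conjPerp (p : ParFld m B) (h : Fld m B) : Fld m B where
  s1 := (p.c * h.s1 - p.d * star h.s2) * star p.c + (p.c * h.s2 + p.d * star h.s1) * star p.d
  s2 := -((p.c * h.s1 - p.d * star h.s2) * p.d) + (p.c * h.s2 + p.d * star h.s1) * p.c
  v1 := (p.c • h.v1 - p.d • star h.v2) ᵥ* p.Cᴴ + (p.c • h.v2 + p.d • star h.v1) ᵥ* p.Dᴴ
  v2 := -((p.c • h.v1 - p.d • star h.v2) ᵥ* p.Dᵀ) + (p.c • h.v2 + p.d • star h.v1) ᵥ* p.Cᵀ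

/-- The conjugate `g q gᴴ` of `q ∈ 𝔥_∥`, in components. -/
def conjPar (p q : ParFld m B) : ParFld m B where
  c := (p.c * q.c - p.d * star q.d) * star p.c + (p.c * q.d + p.d * star q.c) * star p.d
  d := -((p.c * q.c - p.d * star q.d) * p.d) + (p.c * q.d + p.d * star q.c) * p.c
  C := (p.C * q.C - p.D * q.D.map star) * p.Cᴴ + (p.C * q.D + p.D * q.C.map star) * p.Dᴴ
  D := -((p.C * q.C - p.D * q.D.map star) * p.Dᵀ) + (p.C * q.D + p.D * q.C.map star) * p.Cᵀ

theorem hPar_conjTranspose (p : ParFld m B) :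
    (hPar p)ᴴ = quat (blk (star p.c) 0 0 (star p.c) 0 0 0 0 p.Cᴴ)
      (blk (-p.d) 0 0 (-p.d) 0 0 0 0 (-p.Dᵀ)) := by
  rw [hPar_eq, quat_conjTranspose, quat_inj]
  constructor
  · ext i j
    rcases i with i | i <;> rcases j with j | j <;> try fin_cases i
    all_goals try fin_cases j
    all_goals simp [blk]
  · ext i j
    rcases i with i | i <;> rcases j with j | j <;> try fin_cases i
    all_goals try fin_cases j
    all_goals simp [blk]

theorem map_star_transpose (X : Matrix (Fin m) (Fin m) B) : Xᵀ.map star = Xᴴ := rfl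

theorem map_star_conjTranspose (X : Matrix (Fin m) (Fin m) B) : Xᴴ.map star = Xᵀ := by
  ext i j; simp

theorem map_star_neg (X : Matrix (Fin m) (Fin m) B) : (-X).map star = -X.map star := by
  ext i j; simp

theorem hPerp_conjPerp (p : ParFld m B) (h : Fld m B) :
    hPerp (conjPerp p h) = hPar p * hPerp h * (hPar p)ᴴ := by
  rw [hPar_conjTranspose, hPar_eq, hPerp_eq, hPerp_eq, quat_mul, quat_mul, quat_inj]
  simp only [blk_map_star, blk_mul, blk_add, blk_sub, blk_inj]
  simp [conjPerp, map_star_transpose, map_star_conjTranspose, map_star_neg, Matrix.star_vecMul]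
  simp only [Matrix.vecMul_neg, Matrix.mulVec_add, Matrix.mulVec_sub, Matrix.mulVec_neg,
    Matrix.mulVec_smul, Matrix.vecMul_transpose, Matrix.vecMul_sub, smul_sub, smul_neg]
  refine ⟨⟨?_, ?_, ?_⟩, ?_, ?_, ?_⟩
  all_goals first | trivial | ring1

/-- The component formula is the same as on `𝔥_⊥`, in line with the fact that `ad e`, which commutes
with the group, only rescales the scalar and the vector components. -/
theorem mPerp_conjPerp (p : ParFld m B) (h : Fld m B) :
    mPerp (conjPerp p h) = hPar p * mPerp h * (hPar p)ᴴ := by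
  rw [hPar_conjTranspose, hPar_eq, mPerp_eq, mPerp_eq, quat_mul, quat_mul, quat_inj]
  simp only [blk_map_star, blk_mul, blk_add, blk_sub, blk_inj]
  simp [conjPerp, map_star_transpose, map_star_conjTranspose, map_star_neg, Matrix.star_vecMul]
  simp only [Matrix.vecMul_neg, Matrix.mulVec_add, Matrix.mulVec_sub, Matrix.mulVec_neg,
    Matrix.mulVec_smul, Matrix.vecMul_transpose, Matrix.vecMul_sub, smul_sub, smul_neg]
  refine ⟨⟨?_, ?_⟩, ?_, ?_⟩
  all_goals first | trivial | module

theorem hPar_conjPar (p q : ParFld m B) :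
    hPar (conjPar p q) = hPar p * hPar q * (hPar p)ᴴ := by
  rw [hPar_conjTranspose, hPar_eq, hPar_eq, hPar_eq, quat_mul, quat_mul, quat_inj]
  simp only [blk_map_star, blk_mul, blk_add, blk_sub, blk_inj]
  simp [conjPar, map_star_transpose, map_star_conjTranspose, map_star_neg]

theorem ofHPerp_hPerp (h : Fld m B) : ofHPerp (hPerp h) = h := by
  ext <;> simp [ofHPerp, hPerp, quat]

end Conjugation
-- Invariance of `ℋ` and `𝒥`
section Invariance

variable {B : Type} [CommRing B] [Algebra ℂ B] [StarRing B] [StarModule ℂ B] {m : ℕ}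

/-- Stated for linear `f` so that it covers both `D` and `Dinv`. -/
theorem map_conj_const {ι : Type} [Fintype ι] (f : B →ₗ[ℂ] B) (A C : Matrix ι ι ℂ)
    (X : Matrix ι ι B) :
    (A.map (algebraMap ℂ B) * X * C.map (algebraMap ℂ B)).map f =
      A.map (algebraMap ℂ B) * X.map f * C.map (algebraMap ℂ B) := by
  ext i j
  simp only [Matrix.mul_apply, Matrix.map_apply, map_sum, Finset.sum_mul]
  refine Finset.sum_congr rfl fun k _ => Finset.sum_congr rfl fun l _ => ?_
  have : algebraMap ℂ B (A i l) * X l k * algebraMap ℂ B (C k j) = (A i l * C k j) • X l k := by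
    algebra
  rw [this, map_smul]
  algebra

/-- Constant elements of `Sp(1) × Sp(m)`. -/
noncomputable def constPar (B : Type) [CommRing B] [Algebra ℂ B] (p : ParFld m ℂ) : ParFld m B :=
  p.map (algebraMap ℂ B)

theorem isRealAdd_algebraMap : IsRealAdd (algebraMap ℂ B : ℂ → B) :=
  ⟨map_add _, fun x => algebraMap_star_comm x⟩

theorem hPar_constPar (p : ParFld m ℂ) :
    hPar (constPar B p) = (hPar p).map (algebraMap ℂ B) :=
  (isRealAdd_algebraMap.hPar_map p).symm

theorem conjTranspose_hPar_constPar (p : ParFld m ℂ) :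
    (hPar (constPar B p))ᴴ = (hPar p)ᴴ.map (algebraMap ℂ B) := by
  rw [hPar_constPar]
  ext i j
  exact (algebraMap_star_comm _).symm

theorem IsSpSp.conjTranspose_mul {p : ParFld m ℂ} (hp : IsSpSp p) :
    (hPar (constPar B p))ᴴ * hPar (constPar B p) = 1 := by
  rw [conjTranspose_hPar_constPar, hPar_constPar, ← Matrix.map_mul, hp]
  simp

theorem Ad_eq (p : ParFld m ℂ) (u : Fld m B) : Ad p u = conjPerp (constPar B p) u := by
  rw [Ad, ← hPar_constPar, ← hPerp_conjPerp, ofHPerp_hPerp]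

theorem conj_map (p : ParFld m ℂ) (f : B →ₗ[ℂ] B) (X : Mat m B) :
    (hPar (constPar B p) * X * (hPar (constPar B p))ᴴ).map f =
      hPar (constPar B p) * X.map f * (hPar (constPar B p))ᴴ := by
  rw [conjTranspose_hPar_constPar, hPar_constPar, map_conj_const]

theorem IsSpSp.conj_bracket {p : ParFld m ℂ} (hp : IsSpSp p) (X Y : Mat m B) :
    ⁅hPar (constPar B p) * X * (hPar (constPar B p))ᴴ,
      hPar (constPar B p) * Y * (hPar (constPar B p))ᴴ⁆ =
      hPar (constPar B p) * ⁅X, Y⁆ * (hPar (constPar B p))ᴴ := by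
  have h := hp.conjTranspose_mul (B := B)
  generalize hPar (constPar B p) = g at *
  have h2 : ∀ X Y : Mat m B, g * X * gᴴ * (g * Y * gᴴ) = g * (X * Y) * gᴴ := fun X Y => by
    calc g * X * gᴴ * (g * Y * gᴴ) = g * X * (gᴴ * g) * Y * gᴴ := by simp only [mul_assoc]
      _ = _ := by rw [h]; simp only [mul_assoc, one_mul]
  rw [Ring.lie_def, Ring.lie_def, h2, h2, mul_sub, sub_mul]

theorem IsSpSp.conj_nabla {p : ParFld m ℂ} (hp : IsSpSp p) (K : Calc B) (u : Fld m B) (X : Mat m B) :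
    nabla K (Ad p u) (hPar (constPar B p) * X * (hPar (constPar B p))ᴴ) =
      hPar (constPar B p) * nabla K u X * (hPar (constPar B p))ᴴ := by
  have h := conj_map p (K.D : B →ₗ[ℂ] B) X
  rw [Derivation.coeFn_coe] at h
  rw [nabla, Ad_eq, hPerp_conjPerp, hp.conj_bracket, h, nabla, mul_add, add_mul]

theorem isImag_Ad (p : ParFld m ℂ) {u : Fld m B} (hu : u.IsImag) : (Ad p u).IsImag := by
  unfold Fld.IsImag at *
  rw [Ad_eq]
  simp only [conjPerp, star_add, star_mul, star_sub, star_neg, star_star, hu]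
  ring

/-- Conjugation is a Lie algebra automorphism preserving both summands of `𝔥`, so it carries the
`𝔥_∥`-part of the bracket along. -/
theorem IsSpSp.srcH_Ad {p : ParFld m ℂ} (hp : IsSpSp p) {u w : Fld m B} (hu : u.IsImag)
    (hw : w.IsImag) : srcH (Ad p u) (Ad p w) = conjPar (constPar B p) (srcH u w) := by
  have h1 := bracket_hPerp_hPerp (Ad p u) (Ad p w) (isImag_Ad p hu) (isImag_Ad p hw)
  rw [Ad_eq, Ad_eq, hPerp_conjPerp, hPerp_conjPerp, hp.conj_bracket,
    bracket_hPerp_hPerp u w hu hw, mul_sub, sub_mul, ← hPerp_conjPerp, ← hPar_conjPar,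
    sub_eq_sub_iff_add_eq_add] at h1
  rw [Ad_eq, Ad_eq]
  exact (hPerp_add_hPar_inj.1 h1).2

theorem conjPar_map (p : ParFld m ℂ) (q : ParFld m B) (f : B →ₗ[ℂ] B) (hf : IsRealAdd (f : B → B)) :
    (conjPar (constPar B p) q).map f = conjPar (constPar B p) (q.map f) := by
  have h := conj_map p f (hPar q)
  rw [← hPar_conjPar, hf.hPar_map, hf.hPar_map, ← hPar_conjPar] at h
  -- A zero `𝔥_⊥`-part is added so that directness of the sum yields injectivity of `hPar`.
  exact (hPerp_add_hPar_inj.1 (congrArg (hPerp ⟨0, 0, 0, 0⟩ + ·) h)).2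

theorem nabla_eq_hPerp_opH {K : Calc B} {u P : Fld m B} (hu : u.IsImag) (hP : P.IsImag)
    (hs : ((srcH u P).map K.Dinv).map K.D = srcH u P) :
    nabla K u (hPerp P + hPar ((srcH u P).map K.Dinv)) = hPerp (opH K u P) := by
  rw [nabla_hPerp_add_hPar K u P _ hu hP ((srcH_isAlg u P).map K.isRealAdd_Dinv), hs, sub_self,
    add_zero, ← opH_eq]

/-- The conjugate of the lift of `P` is the lift of the conjugate, antiderivatives included, and `∇`
intertwines. -/
theorem isSpInvariant_relH (m : ℕ) : IsSpInvariant (relH m) := by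
  intro p hp B _ _ _ _ K u P X hu h
  obtain ⟨hP, hs, rfl⟩ := h
  have hs' : ((srcH (Ad p u) (Ad p P)).map K.Dinv).map K.D = srcH (Ad p u) (Ad p P) := by
    rw [hp.srcH_Ad hu hP, conjPar_map p _ K.Dinv K.isRealAdd_Dinv]
    have h := conjPar_map p ((srcH u P).map K.Dinv) (K.D : B →ₗ[ℂ] B) K.isRealAdd_D
    rw [Derivation.coeFn_coe] at h
    rw [h, hs]
  refine ⟨isImag_Ad p hP, hs', ?_⟩
  have h1 := nabla_eq_hPerp_opH (isImag_Ad p hu) (isImag_Ad p hP) hs'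
  rw [hp.srcH_Ad hu hP, conjPar_map p _ K.Dinv K.isRealAdd_Dinv, hPar_conjPar, Ad_eq p P,
    hPerp_conjPerp, ← add_mul, ← mul_add, hp.conj_nabla, nabla_eq_hPerp_opH hu hP hs,
    ← hPerp_conjPerp, hPerp_inj, ← Ad_eq, ← Ad_eq] at h1
  exact h1

theorem adInv_conjPerp (r : ℝ) (q : ParFld m B) (h : Fld m B) :
    adInv r (conjPerp q h) = conjPerp q (adInv r h) := by
  have h1 : star (1 / r : ℂ) = 1 / r := by simp
  have h2 : star (1 / (2 * r) : ℂ) = 1 / (2 * r) := by simp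
  have e1 : q.c • -((1 / r : ℂ) • h.v1) - q.d • star (-((1 / r : ℂ) • h.v2)) =
      -((1 / r : ℂ) • (q.c • h.v1 - q.d • star h.v2)) := by
    rw [star_neg, star_smul, h1]
    ext k
    simp only [Pi.sub_apply, Pi.smul_apply, Pi.neg_apply, smul_eq_mul]
    algebra
  have e2 : q.c • -((1 / r : ℂ) • h.v2) + q.d • star (-((1 / r : ℂ) • h.v1)) =
      -((1 / r : ℂ) • (q.c • h.v2 + q.d • star h.v1)) := by
    rw [star_neg, star_smul, h1]
    ext k
    simp only [Pi.add_apply, Pi.smul_apply, Pi.neg_apply, smul_eq_mul]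
    algebra
  rw [Fld.ext_iff]
  refine ⟨?_, ?_, ?_, ?_⟩
  · simp only [adInv, conjPerp, star_smul, h2]
    algebra
  · simp only [adInv, conjPerp, star_smul, h2]
    algebra
  · simp only [adInv, conjPerp, e1, e2, Matrix.neg_vecMul, Matrix.smul_vecMul]
    module
  · simp only [adInv, conjPerp, e1, e2, Matrix.neg_vecMul, Matrix.smul_vecMul]
    module

/-- The commutation shown for `𝔥_∥` never used that `p` is a Lie algebra element, so it holds for
group elements of the same shape. -/
theorem IsSpSp.conj_mPar {p : ParFld m ℂ} (hp : IsSpSp p) {a : B} (ha : star a = a) :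
    hPar (constPar B p) * mPar m a * (hPar (constPar B p))ᴴ = mPar m a := by
  have h := bracket_mPar_hPar a ha (constPar B p)
  rw [Ring.lie_def, sub_eq_zero] at h
  have hg := hp.conjTranspose_mul (B := B)
  generalize hPar (constPar B p) = g at *
  have hg' : g * gᴴ = 1 := mul_eq_one_comm.1 hg
  rw [← h, mul_assoc, hg', mul_one]

theorem IsSpSp.pair_Ad {p : ParFld m ℂ} (hp : IsSpSp p) {u : Fld m B} (hu : u.IsImag)
    (h : Fld m B) : pair (Ad p u) (Ad p h) = pair u h := by
  have h1 : ip (hPerp (Ad p u)) (hPerp (Ad p h)) = ip (hPerp u) (hPerp h) := by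
    rw [Ad_eq, Ad_eq, hPerp_conjPerp, hPerp_conjPerp, ip, ip]
    have hg := hp.conjTranspose_mul (B := B)
    generalize hPar (constPar B p) = g at *
    calc (g * hPerp u * gᴴ * (g * hPerp h * gᴴ)).trace
        = (g * (hPerp u * (gᴴ * g) * hPerp h * gᴴ)).trace := by simp only [mul_assoc]
      _ = (hPerp u * hPerp h).trace := by
        rw [hg, Matrix.trace_mul_comm, mul_one, mul_assoc, hg, mul_one]
  rw [ip_hPerp_hPerp hu, ip_hPerp_hPerp (isImag_Ad p hu), neg_inj] at h1
  exact smul_right_injective B (two_ne_zero' ℂ) h1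

theorem IsSpSp.liftJ_Ad {p : ParFld m ℂ} (hp : IsSpSp p) (K : Calc B) {u : Fld m B} (hu : u.IsImag)
    (h : Fld m B) :
    liftJ K (Ad p u) (Ad p h) =
      hPar (constPar B p) * liftJ K u h * (hPar (constPar B p))ᴴ := by
  rw [liftJ, liftJ, hp.pair_Ad hu, mul_add, add_mul, hp.conj_mPar (star_Dinv_pair K u h), Ad_eq,
    adInv_conjPerp, mPerp_conjPerp]

/-- `pair u h` and `e` are fixed by the group, so the potential `liftJ` is equivariant; `𝒥` is
recovered by injectivity of `ad e` on `𝔥_⊥`. -/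
theorem isSpInvariant_relJ (m : ℕ) : IsSpInvariant (relJ m) := by
  intro p hp B _ _ _ _ K u h X hu hJ
  obtain ⟨hh, hs, rfl⟩ := hJ
  have hs' : K.D (K.Dinv (pair (Ad p u) (Ad p h))) = pair (Ad p u) (Ad p h) := by
    rw [hp.pair_Ad hu, hs]
  refine ⟨isImag_Ad p hh, hs', ?_⟩
  have h1 := nabla_liftJ (isImag_Ad p hu) (isImag_Ad p hh) hs'
  have he : hPar (constPar B p) * eHalf m B * (hPar (constPar B p))ᴴ = eHalf m B :=
    hp.conj_mPar (star_algebraMap_ofReal _)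
  rw [hp.liftJ_Ad K hu, hp.conj_nabla, nabla_liftJ hu hh hs, mul_neg, neg_mul, ← hp.conj_bracket,
    he, ← hPerp_conjPerp, neg_inj, eHalf_bracket_hPerp_inj, ← Ad_eq] at h1
  exact h1

end Invariance

end SpFlow

theorem mainTheorem2 (n : ℕ) (hn : 1 ≤ n) :
    -- The Cartan structure equations of a parallel frame are equivalent to the flow equations
    -- `u_t = ℋ(w) + h`, `w = (χ/4) 𝒥(h)`, where `h = [e_x, h_⊥]`.
    (∀ (B : Type) [CommRing B] [Algebra ℂ B] [StarRing B] [StarModule ℂ B]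
        (K : Calc B) (Dt : Derivation ℂ B B), (∀ f, Dt (star f) = star (Dt f)) →
      ∀ (u hl h w : Fld (n - 1) B) (hp : B) (wp : ParFld (n - 1) B),
        u.IsImag → hl.IsImag → w.IsImag → star hp = hp → wp.IsAlg →
        hPerp h = ⁅eX n B, mPerp hl⁆ →
        wp = (srcH u w).map K.Dinv →
        hp = ((√(chi n) / 2 : ℝ) : ℂ) • K.Dinv (pair u h) →
        (CartanEqs K.D Dt (eX n B) (mPar (n - 1) hp + mPerp hl) (hPerp u) (hPar wp + hPerp w) ↔
          relH (n - 1) B K u w ((u.map Dt).sub h) ∧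
          ∃ v, relJ (n - 1) B K u h v ∧ w = v.smul (chi n / 4))) ∧
    -- Every non-stretching curve flow in a parallel frame satisfies these flow equations.
    (∀ (Φ : ParallelFlow n) (h : Fld (n - 1) Smooth) (K : Calc Smooth), K.D = Smooth.dx →
      hPerp h = ⁅eX n Smooth, mPerp Φ.hl⁆ →
      Φ.wp = (srcH Φ.u Φ.w).map K.Dinv →
      Φ.hp = ((√(chi n) / 2 : ℝ) : ℂ) • K.Dinv (pair Φ.u h) →
        relH (n - 1) Smooth K Φ.u Φ.w ((Φ.u.map Smooth.dt).sub h) ∧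
        ∃ v, relJ (n - 1) Smooth K Φ.u h v ∧ Φ.w = v.smul (chi n / 4)) ∧
    -- The operators are cosymplectic and symplectic, compatible, and invariant.
    IsCosymplectic (relH (n - 1)) ∧
    IsSymplectic (relJ (n - 1)) ∧
    (∀ c₁ c₂ : ℝ, IsCosymplectic (addInv c₁ c₂ (relH (n - 1)) (relJ (n - 1)))) ∧
    IsSpInvariant (relH (n - 1)) ∧
    IsSpInvariant (relJ (n - 1)) := by
  refine ⟨?_, ?_, isCosymplectic_relH _, isSymplectic_relJ _, fun c₁ c₂ => isCosymplectic_addInv _ c₁ c₂,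
    isSpInvariant_relH _, isSpInvariant_relJ _⟩
  · intro B _ _ _ _ K Dt hDt u hl h w hp wp hu hli hw _ _ hh hwp hhp
    exact cartanEqs_iff n K Dt hDt u hl h w hp wp hu hli hw hh hwp hhp
  · intro Φ h K hK hh hwp hhp
    exact Φ.flowEqs h K hK hh hwp hhp
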